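/- For real $A,B$ and $n\ge 0$ let $$P_n^{(A,B)}(x)=\sum_{\mu=0}^{n}\binom{n+A}{n-\mu}\binom{n+B}{\mu}\Big(\frac{x-1}{2}\Big)^{\mu}\Big(\frac{x+1}{2}\Big)^{n-\mu}$$ be the Jacobi polynomials (with generalized binomial coefficients). Let $\alpha,\beta>-1$, $a>-1$ and $\lambda\in(0,1)$, and put $$Q_n=\lambda^{an+\alpha}(1-\lambda^2)^{\beta}P_n^{(an+\alpha,\beta)}(1-2\lambda^2).$$ All constants below, including those in the $O$-terms, may depend on $a,\alpha,\beta,\lambda$ but not on $n$, and $O$-terms refer to $n\to\infty$. (1) If $a\in\big(-\frac{2\lambda}{1+\lambda},\frac{2\lambda}{1-\lambda}\big)$, then $$P_n^{(an+\alpha,\beta)}(1-2\lambda^2)=\sqrt{\frac{2}{n\pi}}\,\frac{\lambda^{-\alpha-an}\,((1-\lambda^2)(a+1))^{-\beta/2}}{\big((1-\lambda^2)((a+2)\lambda+a)((a+2)\lambda-a)\big)^{1/4}}\Big(\cos\theta_n+O(n^{-1})\Big),$$ $$\theta_n=(n+1)h(\varphi_+)+(\alpha-a)\varphi_++(\beta-1)\psi+\frac{\pi}{4}.$$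 Here $\varphi_+\in[0,\pi]$ is defined by $$z_+=e^{i\varphi_+}=y+i\sqrt{1-y^2},\qquad y=\frac{a+a\lambda^2+2\lambda^2}{2\lambda(a+1)},$$ $h(\varphi)=\operatorname{Arg}\Big(\frac{z^{a+1}(1-\lambda z)}{z-\lambda}\Big)$ with $z=e^{i\varphi}$, and $\psi=\operatorname{Arg}(1-\lambda z_+)$; powers and arguments are principal. (2) If $a=\frac{2\lambda}{1-\lambda}$, then $$P_n^{(an+\alpha,\beta)}(1-2\lambda^2)=\frac{\lambda^{-an-\alpha}(1+\lambda)^{-\beta}}{3^{2/3}\,\Gamma(2/3)\,n^{1/3}\lambda^{1/3}(1+\lambda)^{1/3}}\big(1+O(n^{-1/3})\big).$$ If $a=-\frac{2\lambda}{1+\lambda}$, then $$P_n^{(an+\alpha,\beta)}(1-2\lambda^2)=\frac{\Gamma(1/3)\,\lambda^{-\alpha-an}(1-\lambda)^{-\beta}}{3^{2/3}\,\pi\, n^{1/3}\lambda^{1/3}(1-\lambda)^{1/3}}\Big(\frac{\sqrt3}{2}\big(\cos((an+\alpha)\pi)-\sqrt3\sin((an+\alpha)\pi)\big)+O(n^{-1/3})\Big).$$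 (3) If $a\in\big(-1,-\frac{2\lambda}{1+\lambda}\big)\cup\big(\frac{2\lambda}{1-\lambda},\infty\big)$, then $Q_n$ decays exponentially along the $n$ for which $an+\alpha$ is an integer: there are $C>0$ and $\rho\in(0,1)$ with $|Q_n|\le C\rho^n$ for all such $n$. (4) If $a\in\big(-1,-\frac{2\lambda}{1+\lambda}\big)$, then $Q_n$ grows exponentially when $an+\alpha$ is not an integer, in the following sense. There are $c,C>0$, $\kappa>1$ and $\rho\in(0,1)$ such that for all $n\ge 0$ $$|Q_n|\ \ge\ c\,\kappa^n\,|\sin(\pi(an+\alpha))|-C\rho^n .$$ Moreover there are $\sigma\in(0,1)$ and $\kappa'>1$ such that $|Q_n|\ge\kappa'^{\,n}$ for all sufficiently large $n$ with $\operatorname{dist}(an+\alpha,\mathbb Z)\ge\sigma^n$. If $a\in\big(\frac{2\lambda}{1-\lambda},\infty\big)$, then there are $C>0$ and $\rho\in(0,1)$ with $|Q_n|\le C\rho^n$ for all $n$ for which $an+\alpha$ is not an integer. -/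

import Mathlib

open Filter Asymptotics

noncomputable section

/-- The Jacobi polynomial `P_n^{(α,β)}(x)` for arbitrary real parameters, where `Ring.choose r k` is
the generalized binomial coefficient `r (r - 1) ⋯ (r - k + 1) / k!`. -/
def jacobiP (n : ℕ) (α β x : ℝ) : ℝ :=
  ∑ μ ∈ Finset.range (n + 1),
    Ring.choose ((n : ℝ) + α) (n - μ) * Ring.choose ((n : ℝ) + β) μ *
      ((x - 1) / 2) ^ μ * ((x + 1) / 2) ^ (n - μ)

/-- `P_n^{(a n + α, β)}(1 - 2 l ^ 2)`. -/
def varJacobi (a α β l : ℝ) (n : ℕ) : ℝ :=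
  jacobiP n (a * n + α) β (1 - 2 * l ^ 2)

/-- `l ^ (a n + α) (1 - l ^ 2) ^ β P_n^{(a n + α, β)}(1 - 2 l ^ 2)`. -/
def scaledJacobi (a α β l : ℝ) (n : ℕ) : ℝ :=
  l ^ (a * n + α) * (1 - l ^ 2) ^ β * varJacobi a α β l n

/-- The real part of the stationary point. -/
def statRe (a l : ℝ) : ℝ :=
  (a + a * l ^ 2 + 2 * l ^ 2) / (2 * l * (a + 1))

/-- The stationary point `z₊ = exp (i φ₊)` on the upper unit circle. -/
def zPlus (a l : ℝ) : ℂ :=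
  (statRe a l : ℂ) + Complex.I * (Real.sqrt (1 - statRe a l ^ 2) : ℂ)

/-- The angle `φ₊ ∈ [0, π]` of `z₊`. -/
def phiPlus (a l : ℝ) : ℝ := Complex.arg (zPlus a l)

/-- `h(φ) = Arg (z ^ (a + 1) (1 - l z) / (z - l))` at `z = exp (i φ)`, with principal powers. -/
def phaseH (a l φ : ℝ) : ℝ :=
  let z : ℂ := Complex.exp (Complex.I * (φ : ℂ))
  Complex.arg (z ^ ((a : ℂ) + 1) * (1 - (l : ℂ) * z) / (z - (l : ℂ)))

/-- `ψ = arg (1 - l z₊)`, the principal argument. -/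
def psiAngle (a l : ℝ) : ℝ := Complex.arg (1 - (l : ℂ) * zPlus a l)

/-- The amplitude in the oscillatory range. -/
def oscAmp (a α β l : ℝ) (n : ℕ) : ℝ :=
  Real.sqrt (2 / (n * Real.pi)) *
    (l ^ (-α - a * n) * ((1 - l ^ 2) * (a + 1)) ^ (-β / 2) /
      ((1 - l ^ 2) * ((a + 2) * l + a) * ((a + 2) * l - a)) ^ (1 / 4 : ℝ))

/-- The argument of the cosine in the oscillatory range. -/
def oscPhase (a α β l : ℝ) (n : ℕ) : ℝ :=
  ((n : ℝ) + 1) * phaseH a l (phiPlus a l) + (α - a) * phiPlus a l +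
    (β - 1) * psiAngle a l + Real.pi / 4

/-- The leading term at the transition point `a = 2 l / (1 - l)`. -/
def upperLead (a α β l : ℝ) (n : ℕ) : ℝ :=
  l ^ (-(a * n) - α) * (1 + l) ^ (-β) /
    ((3 : ℝ) ^ (2 / 3 : ℝ) * Real.Gamma (2 / 3) * (n : ℝ) ^ (1 / 3 : ℝ) * l ^ (1 / 3 : ℝ) *
      (1 + l) ^ (1 / 3 : ℝ))

/-- The amplitude at the transition point `a = -2 l / (1 + l)`. -/
def lowerAmp (a α β l : ℝ) (n : ℕ) : ℝ :=
  Real.Gamma (1 / 3) * l ^ (-α - a * n) * (1 - l) ^ (-β) /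
    ((3 : ℝ) ^ (2 / 3 : ℝ) * Real.pi * (n : ℝ) ^ (1 / 3 : ℝ) * l ^ (1 / 3 : ℝ) *
      (1 - l) ^ (1 / 3 : ℝ))

/-- The oscillating factor at the transition point `a = -2 l / (1 + l)`. -/
def lowerOsc (a α : ℝ) (n : ℕ) : ℝ :=
  Real.sqrt 3 / 2 *
    (Real.cos ((a * n + α) * Real.pi) - Real.sqrt 3 * Real.sin ((a * n + α) * Real.pi))

end

/-! The scaled polynomial $Q_n$ is a residue. With $z=e^w$, the integrand $G(w)^n g(w)$, where
$G=e^{(a+1)w}(1-lz)/(z-l)$ and $g=e^{(\alpha+1)w}(1-lz)^\beta/(z-l)$, has a pole of order $n+1$ at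
$w=\log l$ whose residue is $Q_n$: expanding in $\xi=z/l-1$ produces a product of two binomial
series, and its coefficient of $\xi^n$ is the Jacobi sum (`sum_kernelCoeff_eq`). Cauchy's theorem on
the rectangle between $\operatorname{Im}w=\pm\pi$, with its left side sent to $-\infty$, gives
`vertical_integral_representation`. Since $z^{an+\alpha}$ is multivalued, the two horizontal edges
do not cancel; they leave $\sin(\pi(an+\alpha))$ times a positive integral along the cut.

Conjugation symmetry halves the contour. If $\Phi$ is a primitive of the integrand on the strip
$|\operatorname{Re}w|<-\log l$, real on the real axis, then $\pi Q_n$ is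
$\operatorname{Im}\Phi(s+\pi i)$ minus the cut term, for every real $s$ in the strip
(`exists_primitive_representation`). All contour deformation is thereby reduced to adding increments
of $\Phi$ along straight segments.

The geometry rests on three facts. $|G|=1$ on the imaginary axis. On a vertical line to its left
$|G|$ increases with $\cos\operatorname{Im}w$, on a line to its right it decreases
(`norm_saddleBase_le_of_neg`, `norm_saddleBase_le_of_pos`), so a vertical segment is controlled by
one endpoint. For $a\ge-2l/(1+l)$ the modulus on the cut is increasing up to $0$, where it equals
$1$ (`strictMonoOn_cutBase`), so stopping at $s<0$ makes the cut term exponentially small.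

Between the transition values the contour starts on the real axis to the right, rises to a point
near the saddle $i\varphi_+$, crosses the imaginary axis along steepest descent, and rises on the
left to $\operatorname{Im}w=\pi$. Only the short crossing contributes, with relative error $O(1/n)$
(`exists_quadratic_saddle_segment`). At the transition values the saddle reaches $0$ or $\pi i$ and
becomes double; one or two descent rays replace the crossing and give the $n^{-1/3}$ laws
(`exists_cubic_saddle_ray`).

Above the upper value $|G|<1$ on an entire vertical line just left of $0$, and everything decays.
Below the lower value $|G|<1$ on an entire line just right of $0$, but the modulus on the cut
exceeds $1$ somewhere to the left of $0$. Hence $Q_n$ is $-\sin(\pi(an+\alpha))$ times an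
exponentially large quantity, up to an exponentially small error (`scaledJacobi_of_lt_lower`). -/

/-! ### Laplace's method on a half interval. -/

/-- Rescaling $t=n^{-1/p}u$ shows that the factor $n^j$ is exactly compensated by $t^{pj}$. All
error terms $n^jt^{q+pj}$ with the same $q$ therefore have one common order, whatever $j$ is. -/
theorem exists_moment_exp_neg_mul_pow {p : ℕ} (hp : 0 < p) (q j : ℕ) {b : ℝ} (hb : 0 < b) :
    ∃ C : ℝ, 0 ≤ C ∧ ∀ n : ℕ, 1 ≤ n →
      MeasureTheory.IntegrableOn (fun t : ℝ => Real.exp (-(b * n) * t ^ p) * ((n : ℝ) ^ j * t ^ (q + p * j)))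
        (Set.Ioi 0) ∧
      ∫ t in Set.Ioi (0 : ℝ), Real.exp (-(b * n) * t ^ p) * ((n : ℝ) ^ j * t ^ (q + p * j)) =
        C * (n : ℝ) ^ (-((q : ℝ) + 1) / p) := by
  have hp' : (0 : ℝ) < p := by exact_mod_cast hp
  refine ⟨b ^ (-(((q + p * j : ℕ) : ℝ) + 1) / p) * (1 / p) *
    Real.Gamma ((((q + p * j : ℕ) : ℝ) + 1) / p), by positivity, fun n hn => ?_⟩
  have hn' : (0 : ℝ) < n := by exact_mod_cast hn
  have hq : (-1 : ℝ) < ((q + p * j : ℕ) : ℝ) := lt_of_lt_of_le (by norm_num) (Nat.cast_nonneg _)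
  have hbn : 0 < b * n := by positivity
  have heq : (fun t : ℝ => Real.exp (-(b * n) * t ^ p) * ((n : ℝ) ^ j * t ^ (q + p * j))) =
      fun t : ℝ => (n : ℝ) ^ j *
        (t ^ (((q + p * j : ℕ) : ℝ)) * Real.exp (-(b * n) * t ^ (p : ℝ))) := by
    funext t
    rw [Real.rpow_natCast, Real.rpow_natCast]
    ring
  constructor
  · rw [heq]
    exact (integrableOn_rpow_mul_exp_neg_mul_rpow hq hp' hbn).const_mul _
  · rw [heq, MeasureTheory.integral_const_mul, integral_rpow_mul_exp_neg_mul_rpow hp' hq hbn,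
      Real.mul_rpow hb.le hn'.le, ← Real.rpow_natCast (n : ℝ) j]
    have : (n : ℝ) ^ (-((q : ℝ) + 1) / p) =
        (n : ℝ) ^ (j : ℝ) * (n : ℝ) ^ (-(((q + p * j : ℕ) : ℝ) + 1) / p) := by
      rw [← Real.rpow_add hn']
      congr 1
      push_cast
      field_simp
      ring
    rw [this]
    ring

/-- Laplace's method on `[0, δ]` for an integrand close to `c exp (-κ n t ^ p)`. -/
theorem laplace_half_interval {p : ℕ} (hp : 0 < p) (q J : ℕ) {κ δ M : ℝ} (hκ : 0 < κ) (hδ : 0 < δ)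
    (hM : 0 ≤ M) (c : ℂ) :
    ∃ C : ℝ, ∀ n : ℕ, 1 ≤ n → ∀ H : ℝ → ℂ, ContinuousOn H (Set.Icc 0 δ) →
      (∀ t ∈ Set.Icc 0 δ, ‖H t - c * Real.exp (-(κ * n) * t ^ p)‖ ≤
        ∑ j ∈ Finset.range J, M * (Real.exp (-(κ / 2 * n) * t ^ p) * ((n : ℝ) ^ j * t ^ (q + p * j)))) →
      ‖(∫ t in (0 : ℝ)..δ, H t) -
        c * (((κ * n) ^ (-1 / (p : ℝ)) * Real.Gamma (1 / p + 1) : ℝ) : ℂ)‖ ≤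
        C * (n : ℝ) ^ (-((q : ℝ) + 1) / p) := by
  have hp' : (0 : ℝ) < p := by exact_mod_cast hp
  choose Cm hCm0 hCm using fun j => exists_moment_exp_neg_mul_pow hp q j (half_pos hκ)
  obtain ⟨Ct, hCt0, hCt⟩ := exists_moment_exp_neg_mul_pow hp q 0 hκ
  refine ⟨(∑ j ∈ Finset.range J, M * Cm j) + ‖c‖ * (δ⁻¹ ^ q * Ct), fun n hn H hH hbd => ?_⟩
  have hn' : (0 : ℝ) < n := by exact_mod_cast hn
  have hκn : 0 < κ * n := by positivity
  set E : ℝ → ℝ := fun t => Real.exp (-(κ * n) * t ^ p) with hE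
  have hEc : Continuous E := by fun_prop
  have hEint : MeasureTheory.IntegrableOn E (Set.Ioi 0) := by
    have := integrableOn_rpow_mul_exp_neg_mul_rpow (s := 0) (by norm_num) hp' hκn
    simpa [hE] using this
  have hEval : ∫ t in Set.Ioi (0 : ℝ), E t = (κ * n) ^ (-1 / (p : ℝ)) * Real.Gamma (1 / p + 1) := by
    have := integral_exp_neg_mul_rpow hp' hκn
    simpa [hE] using this
  have hsplit : ∫ t in Set.Ioi (0 : ℝ), E t = (∫ t in (0 : ℝ)..δ, E t) + ∫ t in Set.Ioi δ, E t := by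
    rw [intervalIntegral.integral_of_le hδ.le, ← MeasureTheory.setIntegral_union
      Set.Ioc_disjoint_Ioi_same measurableSet_Ioi
      (hEint.mono_set Set.Ioc_subset_Ioi_self)
      (hEint.mono_set (Set.Ioi_subset_Ioi hδ.le)), Set.Ioc_union_Ioi_eq_Ioi hδ.le]
  -- Beyond $\delta$ one has $1\le(t/\delta)^q$, so the tail is absorbed by the $q$-th moment and no
  -- separate exponential estimate is needed.
  have htail : ∫ t in Set.Ioi δ, E t ≤ δ⁻¹ ^ q * Ct * (n : ℝ) ^ (-((q : ℝ) + 1) / p) := by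
    obtain ⟨hi, hv⟩ := hCt n hn
    simp only [pow_zero, one_mul, mul_zero, add_zero] at hi hv
    calc ∫ t in Set.Ioi δ, E t ≤ ∫ t in Set.Ioi δ, δ⁻¹ ^ q * (E t * t ^ q) := by
          refine MeasureTheory.setIntegral_mono_on (hEint.mono_set (Set.Ioi_subset_Ioi hδ.le))
            ((hi.mono_set (Set.Ioi_subset_Ioi hδ.le)).const_mul _) measurableSet_Ioi ?_
          intro t ht
          have ht' : δ < t := ht
          have h1 : 1 ≤ (δ⁻¹ * t) ^ q := one_le_pow₀ (by
            rw [inv_mul_eq_div, one_le_div hδ]; exact ht'.le)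
          have h2 : 0 < E t := Real.exp_pos _
          calc E t ≤ E t * (δ⁻¹ * t) ^ q := le_mul_of_one_le_right h2.le h1
            _ = δ⁻¹ ^ q * (E t * t ^ q) := by rw [mul_pow]; ring
      _ ≤ ∫ t in Set.Ioi 0, δ⁻¹ ^ q * (E t * t ^ q) := by
          refine MeasureTheory.setIntegral_mono_set (hi.const_mul _) ?_
            (Set.Ioi_subset_Ioi hδ.le).eventuallyLE
          filter_upwards [MeasureTheory.ae_restrict_mem measurableSet_Ioi] with t ht
          have ht' : 0 < t := ht
          have : 0 < E t := Real.exp_pos _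
          simp only [Pi.zero_apply]
          positivity
      _ = _ := by rw [MeasureTheory.integral_const_mul, hv]; ring
  have hmain : ‖∫ t in (0 : ℝ)..δ, (H t - c * E t)‖ ≤
      ∑ j ∈ Finset.range J, M * Cm j * (n : ℝ) ^ (-((q : ℝ) + 1) / p) := by
    have hcont : ∀ j, Continuous fun t : ℝ =>
        M * (Real.exp (-(κ / 2 * n) * t ^ p) * ((n : ℝ) ^ j * t ^ (q + p * j))) :=
      fun j => by fun_prop
    refine (intervalIntegral.norm_integral_le_of_norm_le hδ.le
      (Eventually.of_forall fun t ht => hbd t ⟨ht.1.le, ht.2⟩)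
      ((continuous_finsetSum _ fun j _ => hcont j).intervalIntegrable _ _)).trans ?_
    rw [intervalIntegral.integral_finsetSum fun j _ => (hcont j).intervalIntegrable _ _]
    refine Finset.sum_le_sum fun j _ => ?_
    obtain ⟨hi, hv⟩ := hCm j n hn
    rw [intervalIntegral.integral_const_mul, mul_assoc, ← hv, intervalIntegral.integral_of_le hδ.le]
    refine mul_le_mul_of_nonneg_left ?_ hM
    refine MeasureTheory.setIntegral_mono_set hi ?_ Set.Ioc_subset_Ioi_self.eventuallyLE
    filter_upwards [MeasureTheory.ae_restrict_mem measurableSet_Ioi] with t ht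
    have ht' : 0 < t := ht
    simp only [Pi.zero_apply]
    positivity
  have hHi : IntervalIntegrable H MeasureTheory.volume 0 δ :=
    ContinuousOn.intervalIntegrable (by rwa [Set.uIcc_of_le hδ.le])
  have hcE : IntervalIntegrable (fun t => c * (E t : ℂ)) MeasureTheory.volume 0 δ :=
    Continuous.intervalIntegrable (by fun_prop) _ _
  rw [intervalIntegral.integral_sub hHi hcE, intervalIntegral.integral_const_mul,
    intervalIntegral.integral_ofReal] at hmain
  have h0 : 0 ≤ ∫ t in Set.Ioi δ, E t :=
    MeasureTheory.setIntegral_nonneg measurableSet_Ioi fun t _ => (Real.exp_pos _).le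
  calc _ = ‖((∫ t in (0 : ℝ)..δ, H t) - c * ((∫ t in (0 : ℝ)..δ, E t : ℝ) : ℂ)) -
        c * ((∫ t in Set.Ioi δ, E t : ℝ) : ℂ)‖ := by
        rw [← hEval, hsplit]; push_cast; congr 1; ring
    _ ≤ _ := norm_sub_le _ _
    _ ≤ (∑ j ∈ Finset.range J, M * Cm j * (n : ℝ) ^ (-((q : ℝ) + 1) / p)) +
        ‖c‖ * (δ⁻¹ ^ q * Ct * (n : ℝ) ^ (-((q : ℝ) + 1) / p)) := by
        refine add_le_add hmain ?_
        rw [norm_mul, Complex.norm_real, Real.norm_of_nonneg h0]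
        exact mul_le_mul_of_nonneg_left htail (norm_nonneg _)
    _ = _ := by rw [← Finset.sum_mul]; ring

/-! ### Local contributions of double and simple saddle points. -/

theorem norm_exp_sub_one_le_mul_exp (x : ℂ) : ‖Complex.exp x - 1‖ ≤ ‖x‖ * Real.exp ‖x‖ := by
  simpa using Complex.norm_exp_sub_sum_le_norm_mul_exp x 1

theorem norm_exp_sub_one_sub_le_mul_exp (x : ℂ) :
    ‖Complex.exp x - 1 - x‖ ≤ ‖x‖ ^ 2 * Real.exp ‖x‖ := by
  have := Complex.norm_exp_sub_sum_le_norm_mul_exp x 2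
  simpa [Finset.sum_range_succ, sub_sub] using this

theorem AnalyticAt.exists_taylor_bound_on_line {F : ℂ → ℂ} {w₀ d : ℂ} (hF : AnalyticAt ℂ F w₀)
    (hd : ‖d‖ = 1) (N : ℕ) :
    ∃ M : ℝ, 0 ≤ M ∧ ∃ δ : ℝ, 0 < δ ∧ ∀ t : ℝ, |t| ≤ δ →
      ‖F (w₀ + t * d) - ∑ i ∈ Finset.range N, iteratedDeriv i F w₀ / i.factorial * (t * d) ^ i‖ ≤
        M * |t| ^ N := by
  obtain ⟨M, hM⟩ := (hF.hasFPowerSeriesAt.isBigO_sub_partialSum_pow N).bound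
  obtain ⟨δ, hδ, hball⟩ := Metric.eventually_nhds_iff.1 hM
  refine ⟨max M 0, le_max_right _ _, δ / 2, half_pos hδ, fun t ht => ?_⟩
  have hn : ‖(t : ℂ) * d‖ = |t| := by rw [norm_mul, hd, mul_one, Complex.norm_real, Real.norm_eq_abs]
  have := hball (y := t * d) (by rw [dist_zero_right, hn]; linarith)
  rw [norm_pow, norm_norm, hn] at this
  refine le_trans (le_of_eq ?_) (this.trans (mul_le_mul_of_nonneg_right (le_max_left _ _) (by positivity)))
  congr 2
  simp [FormalMultilinearSeries.partialSum, FormalMultilinearSeries.ofScalars, mul_comm]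

theorem AnalyticAt.exists_continuousOn_line {F : ℂ → ℂ} {w₀ d : ℂ} (hF : AnalyticAt ℂ F w₀)
    (hd : ‖d‖ = 1) :
    ∃ δ : ℝ, 0 < δ ∧ ContinuousOn (fun t : ℝ => F (w₀ + t * d)) (Set.Icc (-δ) δ) := by
  obtain ⟨δ, hδ, hball⟩ := Metric.eventually_nhds_iff.1 hF.eventually_analyticAt
  refine ⟨δ / 2, half_pos hδ, fun t ht => ?_⟩
  have : dist (w₀ + t * d) w₀ < δ := by
    rw [dist_eq_norm, add_sub_cancel_left, norm_mul, hd, mul_one, Complex.norm_real, Real.norm_eq_abs]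
    linarith [abs_le.2 ht]
  have h1 := (hball this).continuousAt
  exact (ContinuousAt.comp (f := fun t : ℝ => w₀ + t * d) h1 (by fun_prop)).continuousWithinAt

/-- Leading behaviour of an exponential integral along a descent ray from a double saddle point. -/
theorem exists_cubic_saddle_ray {F g : ℂ → ℂ} {w₀ d : ℂ} {κ : ℝ} (hF : AnalyticAt ℂ F w₀)
    (hg : AnalyticAt ℂ g w₀) (hd : ‖d‖ = 1) (hκ : 0 < κ) (h0 : F w₀ = 0)
    (h1 : iteratedDeriv 1 F w₀ = 0) (h2 : iteratedDeriv 2 F w₀ = 0)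
    (h3 : iteratedDeriv 3 F w₀ / 6 * d ^ 3 = -κ) :
    ∃ δ₀ : ℝ, 0 < δ₀ ∧ ∀ δ : ℝ, 0 < δ → δ ≤ δ₀ →
      (∀ t ∈ Set.Icc 0 δ, (F (w₀ + t * d)).re ≤ -(κ / 2) * t ^ 3) ∧
      ∃ C : ℝ, ∀ n : ℕ, 1 ≤ n →
        ‖(∫ t in (0 : ℝ)..δ, Complex.exp (n * F (w₀ + t * d)) * g (w₀ + t * d)) -
          g w₀ * (((κ * n) ^ (-1 / 3 : ℝ) * Real.Gamma (1 / 3 + 1) : ℝ) : ℂ)‖ ≤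
          C * (n : ℝ) ^ (-2 / 3 : ℝ) := by
  obtain ⟨M₁, hM₁, δ₁, hδ₁, hT₁⟩ := hF.exists_taylor_bound_on_line hd 4
  obtain ⟨M₂, hM₂, δ₂, hδ₂, hT₂⟩ := hg.exists_taylor_bound_on_line hd 1
  obtain ⟨δ₃, hδ₃, hc₃⟩ := hF.exists_continuousOn_line hd
  obtain ⟨δ₄, hδ₄, hc₄⟩ := hg.exists_continuousOn_line hd
  -- For $t\le\delta_5$ the quartic remainder is at most half of $\kappa t^3$, so half of the decay
  -- survives. The added $1$ keeps the denominator positive when $M_1=0$.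
  set δ₅ := κ / 2 / (M₁ + 1) with hδ₅
  have hδ₅' : 0 < δ₅ := by positivity
  refine ⟨min (min δ₁ δ₂) (min (min δ₃ δ₄) (min δ₅ 1)), by positivity, fun δ hδ hle => ?_⟩
  simp only [le_min_iff] at hle
  obtain ⟨⟨l1, l2⟩, ⟨l3, l4⟩, l5, l6⟩ := hle
  have hr : ∀ t ∈ Set.Icc 0 δ, ‖F (w₀ + t * d) + κ * t ^ 3‖ ≤ M₁ * t ^ 4 := by
    intro t ht
    have := hT₁ t (by rw [abs_of_nonneg ht.1]; linarith [ht.2])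
    rw [abs_of_nonneg ht.1] at this
    refine le_trans (le_of_eq ?_) this
    congr 1
    simp only [Finset.sum_range_succ, Finset.sum_range_zero, h1, h2, iteratedDeriv_zero, h0]
    norm_num [Nat.factorial]
    linear_combination ((t : ℂ) ^ 3) * h3
  have hr' : ∀ t ∈ Set.Icc 0 δ, M₁ * t ^ 4 ≤ κ / 2 * t ^ 3 := by
    intro t ht
    have h5 : t * (M₁ + 1) ≤ κ / 2 := by
      rw [hδ₅, le_div_iff₀ (by positivity)] at l5
      exact (mul_le_mul_of_nonneg_right ht.2 (by positivity)).trans l5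
    have : 0 ≤ t ^ 3 := pow_nonneg ht.1 3
    nlinarith [ht.1, mul_nonneg this ht.1]
  have hgd : ∀ t ∈ Set.Icc 0 δ, ‖g (w₀ + t * d) - g w₀‖ ≤ M₂ * t := by
    intro t ht
    have := hT₂ t (by rw [abs_of_nonneg ht.1]; linarith [ht.2])
    rw [abs_of_nonneg ht.1] at this
    simpa using this
  have hgB : ∀ t ∈ Set.Icc 0 δ, ‖g (w₀ + t * d)‖ ≤ ‖g w₀‖ + M₂ := by
    intro t ht
    have h6 := hgd t ht
    have h7 : ‖g (w₀ + t * d)‖ ≤ ‖g w₀‖ + ‖g (w₀ + t * d) - g w₀‖ := by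
      simpa using norm_add_le (g w₀) (g (w₀ + t * d) - g w₀)
    nlinarith [ht.1, ht.2]
  refine ⟨fun t ht => ?_, ?_⟩
  · have h8 := (Complex.re_le_norm _).trans ((hr t ht).trans (hr' t ht))
    have : (F (w₀ + t * d) + κ * t ^ 3).re = (F (w₀ + t * d)).re + κ * t ^ 3 := by
      rw [Complex.add_re]; norm_cast
    rw [this] at h8
    linarith
  · set B := ‖g w₀‖ + M₂ with hB
    -- The two error terms are $t$, from the variation of $g$, and $nt^4$, from the quartic
    -- remainder of $F$: hence $q=1$ and $J=2$.
    obtain ⟨C, hC⟩ := laplace_half_interval (p := 3) (by norm_num) 1 2 (M := M₂ + M₁ * B) hκ hδ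
      (by positivity) (g w₀)
    refine ⟨C, fun n hn => ?_⟩
    have hsub : Set.Icc 0 δ ⊆ Set.Icc (-δ₃) δ₃ := Set.Icc_subset_Icc (by linarith) l3
    have hsub' : Set.Icc 0 δ ⊆ Set.Icc (-δ₄) δ₄ := Set.Icc_subset_Icc (by linarith) l4
    have key := hC n hn (fun t => Complex.exp (n * F (w₀ + t * d)) * g (w₀ + t * d))
      ((((hc₃.mono hsub).const_smul (n : ℂ)).cexp).mul (hc₄.mono hsub')) ?_
    · norm_num at key ⊢
      exact key
    · intro t ht
      set r := F (w₀ + t * d) + κ * t ^ 3 with hrd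
      have hnr : ‖(n : ℂ) * r‖ ≤ n * (M₁ * t ^ 4) := by
        rw [norm_mul, Complex.norm_natCast]
        exact mul_le_mul_of_nonneg_left (hr t ht) (Nat.cast_nonneg n)
      have e1 : Complex.exp (n * F (w₀ + t * d)) =
          (Real.exp (-(κ * n) * t ^ 3) : ℂ) * Complex.exp (n * r) := by
        rw [Complex.ofReal_exp, ← Complex.exp_add, hrd]
        congr 1
        push_cast
        ring
      have e2 : Complex.exp (n * F (w₀ + t * d)) * g (w₀ + t * d) -
          g w₀ * (Real.exp (-(κ * n) * t ^ 3) : ℂ) = (Real.exp (-(κ * n) * t ^ 3) : ℂ) *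
          ((Complex.exp (n * r) - 1) * g (w₀ + t * d) + (g (w₀ + t * d) - g w₀)) := by
        rw [e1]; ring
      have hE : Real.exp (-(κ * n) * t ^ 3) * Real.exp (n * (κ / 2 * t ^ 3)) =
          Real.exp (-(κ / 2 * n) * t ^ 3) := by
        rw [← Real.exp_add]; congr 1; ring
      have hexp : ‖Complex.exp (n * r) - 1‖ ≤
          n * (M₁ * t ^ 4) * Real.exp (n * (κ / 2 * t ^ 3)) := by
        refine (norm_exp_sub_one_le_mul_exp _).trans (mul_le_mul hnr ?_ (Real.exp_pos _).le
          (by positivity))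
        exact Real.exp_le_exp.2 (hnr.trans
          (mul_le_mul_of_nonneg_left (hr' t ht) (Nat.cast_nonneg n)))
      have h1e : 1 ≤ Real.exp (n * (κ / 2 * t ^ 3)) :=
        Real.one_le_exp (mul_nonneg (Nat.cast_nonneg n) (by have := ht.1; positivity))
      have ht0 := ht.1
      rw [e2, norm_mul, Complex.norm_real, Real.norm_of_nonneg (Real.exp_pos _).le]
      calc _ ≤ Real.exp (-(κ * n) * t ^ 3) *
            (n * (M₁ * t ^ 4) * Real.exp (n * (κ / 2 * t ^ 3)) * B +
              M₂ * t * Real.exp (n * (κ / 2 * t ^ 3))) := by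
            refine mul_le_mul_of_nonneg_left ((norm_add_le _ _).trans (add_le_add ?_ ?_))
              (Real.exp_pos _).le
            · rw [norm_mul]
              exact mul_le_mul hexp (hgB t ht) (norm_nonneg _) (by positivity)
            · exact (hgd t ht).trans (le_mul_of_one_le_right (by positivity) h1e)
        _ = Real.exp (-(κ / 2 * n) * t ^ 3) * (n * (M₁ * t ^ 4) * B + M₂ * t) := by
            rw [← hE]; ring
        _ ≤ _ := by
            simp only [Finset.sum_range_succ, Finset.sum_range_zero]
            have : 0 ≤ Real.exp (-(κ / 2 * n) * t ^ 3) := (Real.exp_pos _).le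
            have h9 : 0 ≤ (n : ℝ) * t ^ 4 := by positivity
            have hB0 : 0 ≤ B := by positivity
            have h10 := mul_nonneg (mul_nonneg hM₁ hB0) ht0
            have h11 := mul_nonneg hM₂ h9
            refine (mul_le_mul_of_nonneg_left (a := Real.exp (-(κ / 2 * n) * t ^ 3))
              (c := (M₂ + M₁ * B) * (t + n * t ^ 4)) (by linarith) this).trans (le_of_eq ?_)
            norm_num
            ring

/-- Leading behaviour, with relative error `O(1 / n)`, of an exponential integral along the steepest
descent segment through a simple saddle point. -/
theorem exists_quadratic_saddle_segment {F g : ℂ → ℂ} {w₀ d : ℂ} {κ : ℝ} (hF : AnalyticAt ℂ F w₀)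
    (hg : AnalyticAt ℂ g w₀) (hd : ‖d‖ = 1) (hκ : 0 < κ) (h0 : F w₀ = 0)
    (h1 : iteratedDeriv 1 F w₀ = 0) (h2 : iteratedDeriv 2 F w₀ / 2 * d ^ 2 = -κ) :
    ∃ δ₀ : ℝ, 0 < δ₀ ∧ ∀ δ : ℝ, 0 < δ → δ ≤ δ₀ →
      (∀ t ∈ Set.Icc (-δ) δ, (F (w₀ + t * d)).re ≤ -(κ / 2) * t ^ 2) ∧
      ∃ C : ℝ, ∀ n : ℕ, 1 ≤ n →
        ‖(∫ t in (-δ)..δ, Complex.exp (n * F (w₀ + t * d)) * g (w₀ + t * d)) -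
          g w₀ * (Real.sqrt (Real.pi / (κ * n)) : ℂ)‖ ≤ C * (n : ℝ) ^ (-3 / 2 : ℝ) := by
  obtain ⟨M₁, hM₁, δ₁, hδ₁, hT₁⟩ := hF.exists_taylor_bound_on_line hd 4
  obtain ⟨M₂, hM₂, δ₂, hδ₂, hT₂⟩ := hg.exists_taylor_bound_on_line hd 2
  obtain ⟨δ₃, hδ₃, hc₃⟩ := hF.exists_continuousOn_line hd
  obtain ⟨δ₄, hδ₄, hc₄⟩ := hg.exists_continuousOn_line hd
  set c : ℂ := iteratedDeriv 3 F w₀ / 6 * d ^ 3 with hc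
  set g₁ : ℂ := iteratedDeriv 1 g w₀ * d with hg₁
  set M₃ : ℝ := M₁ + ‖c‖ with hM₃
  set δ₅ := κ / 2 / (M₃ + 1) with hδ₅
  have hM₃0 : 0 ≤ M₃ := by positivity
  have hδ₅' : 0 < δ₅ := by positivity
  refine ⟨min (min δ₁ δ₂) (min (min δ₃ δ₄) (min δ₅ 1)), by positivity, fun δ hδ hle => ?_⟩
  simp only [le_min_iff] at hle
  obtain ⟨⟨l1, l2⟩, ⟨l3, l4⟩, l5, l6⟩ := hle
  have hrc : ∀ t : ℝ, |t| ≤ δ → ‖F (w₀ + t * d) + κ * t ^ 2 - c * t ^ 3‖ ≤ M₁ * |t| ^ 4 := by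
    intro t ht
    refine le_trans (le_of_eq ?_) (hT₁ t (ht.trans l1))
    congr 1
    simp only [Finset.sum_range_succ, Finset.sum_range_zero, h1, iteratedDeriv_zero, h0, hc]
    norm_num [Nat.factorial]
    linear_combination ((t : ℂ) ^ 2) * h2
  have hr : ∀ t : ℝ, |t| ≤ δ → ‖F (w₀ + t * d) + κ * t ^ 2‖ ≤ M₃ * |t| ^ 3 := by
    intro t ht
    have h3 := hrc t ht
    have h4 : ‖F (w₀ + t * d) + κ * t ^ 2‖ ≤
        ‖F (w₀ + t * d) + κ * t ^ 2 - c * t ^ 3‖ + ‖c * t ^ 3‖ :=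
      (congrArg norm (sub_add_cancel _ _).symm).le.trans (norm_add_le _ _)
    rw [norm_mul, norm_pow, Complex.norm_real, Real.norm_eq_abs] at h4
    have h5 : |t| ^ 4 ≤ |t| ^ 3 :=
      pow_le_pow_of_le_one (abs_nonneg t) (ht.trans l6) (by norm_num)
    nlinarith
  have hr' : ∀ t : ℝ, |t| ≤ δ → M₃ * |t| ^ 3 ≤ κ / 2 * t ^ 2 := by
    intro t ht
    have h5 : |t| * (M₃ + 1) ≤ κ / 2 := by
      rw [hδ₅, le_div_iff₀ (by positivity)] at l5
      exact (mul_le_mul_of_nonneg_right ht (by positivity)).trans l5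
    rw [← sq_abs t]
    have := abs_nonneg t
    nlinarith [pow_nonneg this 2, pow_nonneg this 3]
  have hgd : ∀ t : ℝ, |t| ≤ δ → ‖g (w₀ + t * d) - g w₀ - g₁ * t‖ ≤ M₂ * t ^ 2 := by
    intro t ht
    have := hT₂ t (ht.trans l2)
    rw [sq_abs] at this
    refine le_trans (le_of_eq ?_) this
    congr 1
    simp only [Finset.sum_range_succ, Finset.sum_range_zero, iteratedDeriv_zero, hg₁]
    norm_num
    ring
  set M₄ : ℝ := M₂ + ‖g₁‖ with hM₄
  have hgd' : ∀ t : ℝ, |t| ≤ δ → ‖g (w₀ + t * d) - g w₀‖ ≤ M₄ * |t| := by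
    intro t ht
    have h3 := hgd t ht
    have h4 : ‖g (w₀ + t * d) - g w₀‖ ≤ ‖g (w₀ + t * d) - g w₀ - g₁ * t‖ + ‖g₁ * t‖ := by
      simpa using norm_add_le (g (w₀ + t * d) - g w₀ - g₁ * t) (g₁ * t)
    rw [norm_mul, Complex.norm_real, Real.norm_eq_abs] at h4
    have h5 : t ^ 2 ≤ |t| := by
      rw [← sq_abs]; nlinarith [abs_nonneg t]
    nlinarith
  set B := ‖g w₀‖ + M₄ with hB
  have hM₄0 : 0 ≤ M₄ := by positivity
  have hB0 : 0 ≤ B := by positivity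
  have hgB : ∀ t : ℝ, |t| ≤ δ → ‖g (w₀ + t * d)‖ ≤ B := by
    intro t ht
    have h6 := hgd' t ht
    have h7 : ‖g (w₀ + t * d)‖ ≤ ‖g w₀‖ + ‖g (w₀ + t * d) - g w₀‖ := by
      simpa using norm_add_le (g w₀) (g (w₀ + t * d) - g w₀)
    nlinarith [abs_nonneg t]
  refine ⟨fun t ht => ?_, ?_⟩
  · have ht' := abs_le.2 ht
    have h8 := (Complex.re_le_norm _).trans ((hr t ht').trans (hr' t ht'))
    have : (F (w₀ + t * d) + κ * t ^ 2).re = (F (w₀ + t * d)).re + κ * t ^ 2 := by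
      rw [Complex.add_re]; norm_cast
    rw [this] at h8
    linarith
  · set K : ℝ := M₃ ^ 2 * B + (M₁ * B + ‖c‖ * M₄) + M₂ with hK
    -- This is applied to $H(t)+H(-t)$. The linear term of $g$ and the cubic term of $F$ are odd and
    -- cancel, leaving $t^2$, $nt^4$ and $n^2t^6$, that is $q=2$ and $J=3$. The cancellation is what
    -- improves the relative error from $n^{-1/2}$ to $n^{-1}$.
    obtain ⟨C, hC⟩ := laplace_half_interval (p := 2) (by norm_num) 2 3 (M := 2 * K) hκ hδ
      (by positivity) (2 * g w₀)
    refine ⟨C, fun n hn => ?_⟩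
    have hn0 : (0 : ℝ) < n := by exact_mod_cast hn
    set H : ℝ → ℂ := fun t => Complex.exp (n * F (w₀ + t * d)) * g (w₀ + t * d) with hH
    have hHc : ContinuousOn H (Set.Icc (-δ) δ) :=
      (((hc₃.mono (Set.Icc_subset_Icc (by linarith) l3)).const_smul (n : ℂ)).cexp).mul
        (hc₄.mono (Set.Icc_subset_Icc (by linarith) l4))
    have hpt : ∀ t : ℝ, |t| ≤ δ →
        ‖H t - (Real.exp (-(κ * n) * t ^ 2) : ℂ) * (g w₀ + g₁ * t + n * c * g w₀ * t ^ 3)‖ ≤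
        Real.exp (-(κ / 2 * n) * t ^ 2) * (K * (t ^ 2 + n * t ^ 4 + n ^ 2 * t ^ 6)) := by
      intro t ht
      set r := F (w₀ + t * d) + κ * t ^ 2 with hrd
      have e1 : Complex.exp (n * F (w₀ + t * d)) =
          (Real.exp (-(κ * n) * t ^ 2) : ℂ) * Complex.exp (n * r) := by
        rw [Complex.ofReal_exp, ← Complex.exp_add, hrd]
        congr 1
        push_cast
        ring
      have e2 : H t - (Real.exp (-(κ * n) * t ^ 2) : ℂ) *
          (g w₀ + g₁ * t + n * c * g w₀ * t ^ 3) = (Real.exp (-(κ * n) * t ^ 2) : ℂ) *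
          ((Complex.exp (n * r) - 1 - n * r) * g (w₀ + t * d) +
            (n * (r - c * t ^ 3) * g (w₀ + t * d) +
              n * c * t ^ 3 * (g (w₀ + t * d) - g w₀)) +
            (g (w₀ + t * d) - g w₀ - g₁ * t)) := by
        simp only [hH]
        rw [e1]; ring
      have hE : Real.exp (-(κ * n) * t ^ 2) * Real.exp (n * (κ / 2 * t ^ 2)) =
          Real.exp (-(κ / 2 * n) * t ^ 2) := by
        rw [← Real.exp_add]; congr 1; ring
      have hnr : ‖(n : ℂ) * r‖ ≤ n * (M₃ * |t| ^ 3) := by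
        rw [norm_mul, Complex.norm_natCast]
        exact mul_le_mul_of_nonneg_left (hr t ht) (Nat.cast_nonneg n)
      set X := Real.exp (n * (κ / 2 * t ^ 2)) with hX
      have h1X : 1 ≤ X := Real.one_le_exp (by positivity)
      have hexp : ‖Complex.exp (n * r) - 1 - n * r‖ ≤ (n * (M₃ * |t| ^ 3)) ^ 2 * X := by
        refine (norm_exp_sub_one_sub_le_mul_exp _).trans (mul_le_mul
          (pow_le_pow_left₀ (norm_nonneg _) hnr 2) ?_ (Real.exp_pos _).le (by positivity))
        exact Real.exp_le_exp.2 (hnr.trans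
          (mul_le_mul_of_nonneg_left (hr' t ht) (Nat.cast_nonneg n)))
      have t4 : |t| ^ 4 = t ^ 4 := Even.pow_abs (by decide) t
      have t6 : |t| ^ 6 = t ^ 6 := Even.pow_abs (by decide) t
      rw [e2, norm_mul, Complex.norm_real, Real.norm_of_nonneg (Real.exp_pos _).le, ← hE,
        mul_assoc (Real.exp (-(κ * n) * t ^ 2)) X]
      refine mul_le_mul_of_nonneg_left ?_ (Real.exp_pos _).le
      have b1 : ‖(Complex.exp (n * r) - 1 - n * r) * g (w₀ + t * d)‖ ≤
          X * (M₃ ^ 2 * B * (n ^ 2 * t ^ 6)) := by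
        rw [norm_mul]
        refine (mul_le_mul hexp (hgB t ht) (norm_nonneg _) (by positivity)).trans (le_of_eq ?_)
        rw [← t6]; ring
      have b2 : ‖n * (r - c * t ^ 3) * g (w₀ + t * d)‖ ≤ X * (M₁ * B * (n * t ^ 4)) := by
        rw [norm_mul, norm_mul, Complex.norm_natCast]
        refine (mul_le_mul (mul_le_mul_of_nonneg_left (hrc t ht) hn0.le) (hgB t ht) (norm_nonneg _)
          (by positivity)).trans ?_
        rw [t4]
        refine le_trans (le_of_eq ?_) (le_mul_of_one_le_left (by positivity) h1X)
        ring
      have b3 : ‖n * c * t ^ 3 * (g (w₀ + t * d) - g w₀)‖ ≤ X * (‖c‖ * M₄ * (n * t ^ 4)) := by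
        rw [norm_mul, norm_mul, norm_mul, Complex.norm_natCast, norm_pow, Complex.norm_real,
          Real.norm_eq_abs]
        refine (mul_le_mul_of_nonneg_left (hgd' t ht) (by positivity)).trans ?_
        refine le_trans (le_of_eq ?_) (le_mul_of_one_le_left (by positivity) h1X)
        rw [← t4]; ring
      have b4 : ‖g (w₀ + t * d) - g w₀ - g₁ * t‖ ≤ X * (M₂ * t ^ 2) :=
        (hgd t ht).trans (le_mul_of_one_le_left (by positivity) h1X)
      refine (norm_add_le _ _).trans ((add_le_add ((norm_add_le _ _).trans (add_le_add b1
        ((norm_add_le _ _).trans (add_le_add b2 b3)))) b4).trans ?_)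
      rw [← mul_add, ← mul_add, ← mul_add]
      refine mul_le_mul_of_nonneg_left ?_ (by positivity)
      have p1 : 0 ≤ t ^ 2 := by positivity
      have p2 : 0 ≤ (n : ℝ) * t ^ 4 := by positivity
      have p3 : 0 ≤ (n : ℝ) ^ 2 * t ^ 6 := by positivity
      have q1 : 0 ≤ M₃ ^ 2 * B := by positivity
      have q2 : 0 ≤ M₁ * B + ‖c‖ * M₄ := by positivity
      have c1 : M₃ ^ 2 * B ≤ K := by linarith
      have c2 : M₁ * B + ‖c‖ * M₄ ≤ K := by linarith
      have c3 : M₂ ≤ K := by linarith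
      have := mul_le_mul_of_nonneg_right c1 p3
      have := mul_le_mul_of_nonneg_right c2 p2
      have := mul_le_mul_of_nonneg_right c3 p1
      linarith
    have hneg : ContinuousOn (fun t => H (-t)) (Set.Icc 0 δ) :=
      hHc.comp continuousOn_neg fun t ht => ⟨by linarith [ht.2], by linarith [ht.1]⟩
    have hpos : ContinuousOn H (Set.Icc 0 δ) := hHc.mono (Set.Icc_subset_Icc (by linarith) le_rfl)
    have key := hC n hn (fun t => H t + H (-t)) (hpos.add hneg) ?_
    · have hi1 : IntervalIntegrable H MeasureTheory.volume 0 δ :=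
        ContinuousOn.intervalIntegrable (by rwa [Set.uIcc_of_le hδ.le])
      have hi2 : IntervalIntegrable (fun t => H (-t)) MeasureTheory.volume 0 δ :=
        ContinuousOn.intervalIntegrable (by rwa [Set.uIcc_of_le hδ.le])
      have hi3 : IntervalIntegrable H MeasureTheory.volume (-δ) 0 :=
        ContinuousOn.intervalIntegrable (by
          rw [Set.uIcc_of_le (by linarith)]
          exact hHc.mono (Set.Icc_subset_Icc le_rfl hδ.le))
      rw [intervalIntegral.integral_add hi1 hi2, intervalIntegral.integral_comp_neg, neg_zero,
        add_comm, intervalIntegral.integral_add_adjacent_intervals hi3 hi1] at key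
      have hval : (2 * g w₀) * (((κ * n) ^ (-1 / ((2 : ℕ) : ℝ)) *
          Real.Gamma (1 / ((2 : ℕ) : ℝ) + 1) : ℝ) : ℂ) =
          g w₀ * (Real.sqrt (Real.pi / (κ * n)) : ℂ) := by
        have : 2 * ((κ * n) ^ (-1 / ((2 : ℕ) : ℝ)) * Real.Gamma (1 / ((2 : ℕ) : ℝ) + 1)) =
            Real.sqrt (Real.pi / (κ * n)) := by
          have hg2 : Real.Gamma (1 / ((2 : ℕ) : ℝ) + 1) = 1 / 2 * Real.sqrt Real.pi := by
            rw [Real.Gamma_add_one (by norm_num)]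
            norm_num
            exact Real.Gamma_one_half_eq
          rw [hg2, Real.sqrt_div Real.pi_pos.le, Real.sqrt_eq_rpow (κ * n),
            show (-1 : ℝ) / ((2 : ℕ) : ℝ) = -(1 / 2) by norm_num, Real.rpow_neg (by positivity)]
          field_simp
        rw [← this]; push_cast; ring
      rw [hval] at key
      norm_num at key ⊢
      exact key
    · intro t ht
      have ha : |t| ≤ δ := by rw [abs_of_nonneg ht.1]; exact ht.2
      have k1 := hpt t ha
      have k2 := hpt (-t) (by rwa [abs_neg])
      have e3 : H t + H (-t) - 2 * g w₀ * (Real.exp (-(κ * n) * t ^ 2) : ℂ) =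
          (H t - (Real.exp (-(κ * n) * t ^ 2) : ℂ) * (g w₀ + g₁ * t + n * c * g w₀ * t ^ 3)) +
          (H (-t) - (Real.exp (-(κ * n) * (-t) ^ 2) : ℂ) *
            (g w₀ + g₁ * ((-t : ℝ) : ℂ) + n * c * g w₀ * ((-t : ℝ) : ℂ) ^ 3)) := by
        rw [neg_sq]; push_cast; ring
      simp only [e3]
      refine (norm_add_le _ _).trans ((add_le_add k1 k2).trans (le_of_eq ?_))
      simp only [Finset.sum_range_succ, Finset.sum_range_zero, neg_sq]
      norm_num
      ring

/-! ### The contour integrand in the coordinate $w=\log z$. -/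

noncomputable section

/-- The `n`-dependent factor of the contour integrand, in the coordinate `w = log z`. -/
def saddleBase (a l : ℝ) (w : ℂ) : ℂ :=
  Complex.exp ((a + 1) * w) * (1 - l * Complex.exp w) / (Complex.exp w - l)

/-- The `n`-independent factor of the contour integrand, in the coordinate `w = log z`. -/
def saddleWeight (α β l : ℝ) (w : ℂ) : ℂ :=
  Complex.exp ((α + 1) * w) * (1 - l * Complex.exp w) ^ (β : ℂ) / (Complex.exp w - l)

/-- The integrand of the contour integral for the scaled Jacobi polynomial. -/
def jacobiKernel (a α β l : ℝ) (n : ℕ) (w : ℂ) : ℂ :=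
  saddleBase a l w ^ n * saddleWeight α β l w

/-- The modulus of `saddleBase` on the branch cut. -/
def cutBase (a l s : ℝ) : ℝ :=
  Real.exp ((a + 1) * s) * (1 + l * Real.exp s) / (Real.exp s + l)

/-- The modulus of `saddleWeight` on the branch cut. -/
def cutWeight (α β l s : ℝ) : ℝ :=
  Real.exp ((α + 1) * s) * (1 + l * Real.exp s) ^ β / (Real.exp s + l)

/-- The contribution of the branch cut. -/
def cutIntegral (a α β l : ℝ) (n : ℕ) (s : ℝ) : ℝ :=
  ∫ t in Set.Iic s, cutBase a l t ^ n * cutWeight α β l t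

end

section kernel

variable {a α β l : ℝ}

theorem mul_exp_lt_one {l s : ℝ} (hl0 : 0 < l) (hs : s < -Real.log l) : l * Real.exp s < 1 := by
  have : Real.exp s < l⁻¹ := by
    rw [← Real.exp_log hl0, ← Real.exp_neg]
    exact Real.exp_lt_exp.2 hs
  calc l * Real.exp s < l * l⁻¹ := mul_lt_mul_of_pos_left this hl0
    _ = 1 := mul_inv_cancel₀ hl0.ne'

theorem norm_ofReal_mul_exp_lt_one (hl0 : 0 < l) {w : ℂ} (hw : w.re < -Real.log l) :
    ‖(l : ℂ) * Complex.exp w‖ < 1 := by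
  rw [norm_mul, Complex.norm_real, Real.norm_of_nonneg hl0.le, Complex.norm_exp]
  exact mul_exp_lt_one hl0 hw

theorem one_sub_mul_exp_mem_slitPlane (hl0 : 0 < l) {w : ℂ} (hw : w.re < -Real.log l) :
    1 - (l : ℂ) * Complex.exp w ∈ Complex.slitPlane := by
  refine Or.inl ?_
  have := (Complex.re_le_norm _).trans_lt (norm_ofReal_mul_exp_lt_one hl0 hw)
  simp only [Complex.sub_re, Complex.one_re]
  linarith

theorem one_sub_mul_exp_ne_zero (hl0 : 0 < l) {w : ℂ} (hw : w.re < -Real.log l) :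
    1 - (l : ℂ) * Complex.exp w ≠ 0 :=
  Complex.slitPlane_ne_zero (one_sub_mul_exp_mem_slitPlane hl0 hw)

theorem exp_sub_ne_zero_of_re (hl0 : 0 < l) {w : ℂ} (hw : Real.log l < w.re) :
    Complex.exp w - (l : ℂ) ≠ 0 := by
  intro h
  have h1 : ‖Complex.exp w‖ = l := by
    rw [sub_eq_zero.1 h, Complex.norm_real, Real.norm_of_nonneg hl0.le]
  rw [Complex.norm_exp, ← Real.exp_log hl0] at h1
  exact hw.ne' (Real.exp_injective (by simpa using h1))

theorem exp_sub_ne_zero_of_im (hl0 : 0 < l) {w : ℂ} (hw : |w.im| < 2 * Real.pi)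
    (hne : w ≠ (Real.log l : ℝ)) : Complex.exp w - (l : ℂ) ≠ 0 := by
  intro h
  have h1 : Complex.exp w = Complex.exp ((Real.log l : ℝ) : ℂ) := by
    rw [← Complex.ofReal_exp, Real.exp_log hl0, sub_eq_zero.1 h]
  obtain ⟨k, hk⟩ := Complex.exp_eq_exp_iff_exists_int.1 h1
  have him : w.im = k * (2 * Real.pi) := by
    rw [hk]; simp
  have hk0 : k = 0 := by
    by_contra hk0
    have : (1 : ℝ) ≤ |(k : ℝ)| := by exact_mod_cast Int.one_le_abs hk0
    rw [him, abs_mul, abs_of_pos Real.two_pi_pos] at hw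
    nlinarith [Real.two_pi_pos]
  apply hne
  rw [hk, hk0]
  simp

theorem differentiableAt_saddleBase {w : ℂ} (hne : Complex.exp w - (l : ℂ) ≠ 0) :
    DifferentiableAt ℂ (saddleBase a l) w := by
  unfold saddleBase
  fun_prop (disch := assumption)

theorem differentiableAt_saddleWeight {w : ℂ} (hl0 : 0 < l) (hw : w.re < -Real.log l)
    (hne : Complex.exp w - (l : ℂ) ≠ 0) : DifferentiableAt ℂ (saddleWeight α β l) w := by
  unfold saddleWeight
  have h : DifferentiableAt ℂ (fun w : ℂ => (1 - l * Complex.exp w) ^ (β : ℂ)) w :=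
    DifferentiableAt.cpow (by fun_prop) (by fun_prop) (one_sub_mul_exp_mem_slitPlane hl0 hw)
  exact (DifferentiableAt.mul (by fun_prop) h).div (by fun_prop) hne

theorem differentiableAt_jacobiKernel {w : ℂ} (n : ℕ) (hl0 : 0 < l) (hw : w.re < -Real.log l)
    (hne : Complex.exp w - (l : ℂ) ≠ 0) : DifferentiableAt ℂ (jacobiKernel a α β l n) w :=
  ((differentiableAt_saddleBase hne).pow n).mul (differentiableAt_saddleWeight hl0 hw hne)

theorem saddleBase_conj (w : ℂ) :
    saddleBase a l ((starRingEnd ℂ) w) = (starRingEnd ℂ) (saddleBase a l w) := by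
  simp only [saddleBase, map_div₀, map_mul, map_sub, map_add, map_one, ← Complex.exp_conj,
    Complex.conj_ofReal]

theorem saddleWeight_conj (hl0 : 0 < l) {w : ℂ} (hw : w.re < -Real.log l) :
    saddleWeight α β l ((starRingEnd ℂ) w) = (starRingEnd ℂ) (saddleWeight α β l w) := by
  have h := Complex.slitPlane_arg_ne_pi (one_sub_mul_exp_mem_slitPlane hl0 hw)
  have h1 := Complex.conj_cpow (1 - (l : ℂ) * Complex.exp w) (β : ℂ) h
  simp only [map_sub, map_one, map_mul, Complex.conj_ofReal, ← Complex.exp_conj] at h1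
  simp only [saddleWeight, map_div₀, map_mul, map_sub, map_add, map_one, ← Complex.exp_conj,
    Complex.conj_ofReal, h1]

theorem jacobiKernel_conj (n : ℕ) (hl0 : 0 < l) {w : ℂ} (hw : w.re < -Real.log l) :
    jacobiKernel a α β l n ((starRingEnd ℂ) w) =
      (starRingEnd ℂ) (jacobiKernel a α β l n w) := by
  simp [jacobiKernel, saddleBase_conj, saddleWeight_conj hl0 hw]

theorem jacobiKernel_ofReal_im (n : ℕ) (hl0 : 0 < l) {s : ℝ} (hs : s < -Real.log l) :
    (jacobiKernel a α β l n s).im = 0 := by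
  have := jacobiKernel_conj (a := a) (α := α) (β := β) n hl0 (w := (s : ℂ)) (by simpa using hs)
  rw [Complex.conj_ofReal] at this
  exact Complex.conj_eq_iff_im.1 this.symm

theorem saddleBase_add_pi_mul_I (s : ℝ) :
    saddleBase a l (s + Real.pi * Complex.I) =
      Complex.exp (a * Real.pi * Complex.I) * (cutBase a l s : ℂ) := by
  have h1 : Complex.exp (s + Real.pi * Complex.I) = -Complex.exp s := by
    rw [Complex.exp_add, Complex.exp_pi_mul_I]; ring
  have h2 : Complex.exp (((a : ℂ) + 1) * (s + Real.pi * Complex.I)) =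
      -(Complex.exp (a * Real.pi * Complex.I) * Complex.exp ((a + 1) * s)) := by
    rw [show ((a : ℂ) + 1) * (s + Real.pi * Complex.I) =
      a * Real.pi * Complex.I + (a + 1) * s + Real.pi * Complex.I by ring, Complex.exp_add,
      Complex.exp_pi_mul_I, Complex.exp_add]
    ring
  have h3 : -Complex.exp (s : ℂ) - l = -(Complex.exp s + l) := by ring
  rw [saddleBase, cutBase, h1, h2, h3]
  push_cast
  rw [div_neg]
  ring

theorem saddleWeight_add_pi_mul_I (hl0 : 0 < l) (s : ℝ) :
    saddleWeight α β l (s + Real.pi * Complex.I) =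
      Complex.exp (α * Real.pi * Complex.I) * (cutWeight α β l s : ℂ) := by
  have h1 : Complex.exp (s + Real.pi * Complex.I) = -Complex.exp s := by
    rw [Complex.exp_add, Complex.exp_pi_mul_I]; ring
  have h2 : Complex.exp (((α : ℂ) + 1) * (s + Real.pi * Complex.I)) =
      -(Complex.exp (α * Real.pi * Complex.I) * Complex.exp ((α + 1) * s)) := by
    rw [show ((α : ℂ) + 1) * (s + Real.pi * Complex.I) =
      α * Real.pi * Complex.I + (α + 1) * s + Real.pi * Complex.I by ring, Complex.exp_add,
      Complex.exp_pi_mul_I, Complex.exp_add]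
    ring
  have h3 : -Complex.exp (s : ℂ) - l = -(Complex.exp s + l) := by ring
  rw [saddleWeight, cutWeight, h1, h2, h3]
  push_cast
  rw [Complex.ofReal_cpow (by positivity), div_neg]
  push_cast
  rw [mul_neg, sub_neg_eq_add]
  ring

/-- On this edge $e^w=-e^s$, and the signs from numerator and denominator cancel. What remains is a
positive function times a constant phase; subtracting the conjugate edge turns the phase into the
sine of the cut term. -/
theorem jacobiKernel_add_pi_mul_I (n : ℕ) (hl0 : 0 < l) (s : ℝ) :
    jacobiKernel a α β l n (s + Real.pi * Complex.I) =
      Complex.exp ((a * n + α) * Real.pi * Complex.I) *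
        ((cutBase a l s ^ n * cutWeight α β l s : ℝ) : ℂ) := by
  rw [jacobiKernel, saddleBase_add_pi_mul_I, saddleWeight_add_pi_mul_I hl0, mul_pow,
    ← Complex.exp_nat_mul, show ((a : ℂ) * n + α) * Real.pi * Complex.I =
      n * (a * Real.pi * Complex.I) + α * Real.pi * Complex.I by ring, Complex.exp_add]
  push_cast
  ring

theorem cutBase_pos (hl0 : 0 < l) (s : ℝ) : 0 < cutBase a l s := by
  unfold cutBase; positivity

theorem cutWeight_pos (hl0 : 0 < l) (s : ℝ) : 0 < cutWeight α β l s := by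
  unfold cutWeight; positivity

theorem continuous_cutBase (hl0 : 0 < l) : Continuous (cutBase a l) := by
  unfold cutBase
  exact Continuous.div (by fun_prop) (by fun_prop) fun s => by positivity

theorem continuous_cutWeight (hl0 : 0 < l) : Continuous (cutWeight α β l) := by
  unfold cutWeight
  refine Continuous.div (Continuous.mul (by fun_prop) ?_) (by fun_prop) fun s => by positivity
  exact Continuous.rpow_const (by fun_prop) fun s => Or.inl (by positivity)

/-- The kernel decays exponentially to the left. -/
theorem exists_norm_jacobiKernel_le (a α β : ℝ) (hl0 : 0 < l) (n : ℕ) :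
    ∃ C M₀ : ℝ, ∀ w : ℂ, w.re ≤ M₀ →
      ‖jacobiKernel a α β l n w‖ ≤ C * Real.exp (((a + 1) * n + (α + 1)) * w.re) := by
  -- Once the exponentials $e^{(a+1)nw}$ and $e^{(\alpha+1)w}$ are split off, the kernel is a
  -- function of $z=e^w$ continuous at $z=0$, hence bounded near it.
  set B : ℂ → ℂ := fun z => ((1 - l * z) / (z - l)) ^ n * ((1 - l * z) ^ (β : ℂ) / (z - l)) with hB
  have hl : (0 : ℂ) - l ≠ 0 := by simpa using hl0.ne'
  have hcont : ContinuousAt B 0 := by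
    have h1 : ContinuousAt (fun z : ℂ => (1 - l * z) / (z - l)) 0 := by
      fun_prop (disch := assumption)
    have h2 : ContinuousAt (fun z : ℂ => (1 - (l : ℂ) * z) ^ (β : ℂ)) 0 :=
      ContinuousAt.cpow (by fun_prop) (by fun_prop) (by simp)
    have h3 : ContinuousAt (fun z : ℂ => z - (l : ℂ)) 0 := by fun_prop
    exact (h1.pow n).mul (h2.div h3 hl)
  obtain ⟨r, hr, hbd⟩ := Metric.continuousAt_iff.1 hcont 1 one_pos
  refine ⟨‖B 0‖ + 1, Real.log (r / 2), fun w hw => ?_⟩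
  have hz : ‖Complex.exp w‖ < r := by
    rw [Complex.norm_exp]
    calc Real.exp w.re ≤ Real.exp (Real.log (r / 2)) := Real.exp_le_exp.2 hw
      _ = r / 2 := Real.exp_log (by positivity)
      _ < r := by linarith
  have h1 : ‖B (Complex.exp w)‖ ≤ ‖B 0‖ + 1 := by
    have h2 := hbd (x := Complex.exp w) (by simpa using hz)
    rw [dist_eq_norm] at h2
    have h3 := norm_add_le (B 0) (B (Complex.exp w) - B 0)
    rw [add_sub_cancel] at h3
    linarith
  have h2 : jacobiKernel a α β l n w =
      B (Complex.exp w) * Complex.exp (((a + 1) * n + (α + 1)) * w) := by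
    rw [jacobiKernel, saddleBase, saddleWeight, hB, add_mul ((_ : ℂ) * n), Complex.exp_add,
      show ((a : ℂ) + 1) * n * w = n * ((a + 1) * w) by ring, Complex.exp_nat_mul]
    rw [mul_div_assoc, mul_div_assoc, mul_pow]
    ring
  rw [h2, norm_mul, Complex.norm_exp]
  have h3 : ((((a : ℂ) + 1) * n + (α + 1)) * w).re = ((a + 1) * n + (α + 1)) * w.re := by
    rw [show (((a : ℂ) + 1) * n + (α + 1)) = (((a + 1) * n + (α + 1) : ℝ) : ℂ) by push_cast; ring,
      Complex.re_ofReal_mul]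
  rw [h3]
  exact mul_le_mul_of_nonneg_right h1 (Real.exp_pos _).le

/-- Convergence at $-\infty$ is where $a>-1$ and $\alpha>-1$ enter: they make the exponent
$(a+1)n+\alpha+1$ positive. The majorant is the bound for the kernel read on
$\operatorname{Im}w=\pi$. -/
theorem integrableOn_cut (hα : -1 < α) (ha : -1 < a) (hl0 : 0 < l) (n : ℕ) (s : ℝ) :
    MeasureTheory.IntegrableOn (fun t => cutBase a l t ^ n * cutWeight α β l t) (Set.Iic s) := by
  obtain ⟨C, M₀, hC⟩ := exists_norm_jacobiKernel_le a α β hl0 n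
  have hcont : Continuous fun t => cutBase a l t ^ n * cutWeight α β l t :=
    ((continuous_cutBase hl0).pow n).mul (continuous_cutWeight hl0)
  have hγ : 0 < (a + 1) * n + (α + 1) := by
    have : 0 ≤ (a + 1) * n := mul_nonneg (by linarith) (Nat.cast_nonneg n)
    linarith
  have hleft : MeasureTheory.IntegrableOn (fun t => cutBase a l t ^ n * cutWeight α β l t)
      (Set.Iic (min M₀ s)) := by
    refine MeasureTheory.Integrable.mono' ((integrableOn_exp_mul_Iic hγ (min M₀ s)).const_mul C)
      hcont.aestronglyMeasurable ?_
    filter_upwards [MeasureTheory.ae_restrict_mem measurableSet_Iic] with t ht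
    have h1 := hC (t + Real.pi * Complex.I) (by simpa using (le_min_iff.1 ht).1)
    rw [jacobiKernel_add_pi_mul_I n hl0, norm_mul,
      show ((a : ℂ) * n + α) * Real.pi * Complex.I = (((a * n + α) * Real.pi : ℝ) : ℂ) * Complex.I by
        push_cast; ring, Complex.norm_exp_ofReal_mul_I, one_mul, Complex.norm_real] at h1
    simpa using h1
  rw [← Set.Iic_union_Ioc_eq_Iic (min_le_right M₀ s)]
  exact hleft.union ((hcont.integrableOn_Icc).mono_set Set.Ioc_subset_Icc_self)

end kernel

/-! ### The principal part at $\log l$ and its residue. -/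

theorem circleIntegral_sub_inv_eq_zero {c w : ℂ} {R : ℝ} (hR : 0 ≤ R)
    (hw : w ∉ Metric.closedBall c R) : (∮ z in C(c, R), (z - w)⁻¹) = 0 := by
  refine Complex.circleIntegral_eq_zero_of_differentiable_on_off_countable hR Set.countable_empty
    (fun z hz => ?_) (fun z hz => ?_)
  · have : z - w ≠ 0 := sub_ne_zero.2 fun h => hw (h ▸ hz)
    exact ContinuousAt.continuousWithinAt (by fun_prop (disch := assumption))
  · have : z - w ≠ 0 := sub_ne_zero.2 fun h => hw (h ▸ Metric.ball_subset_closedBall hz.1)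
    fun_prop (disch := assumption)

/-- The substitution $z=e^{s+i\varphi}$ makes this $-i\oint(z-l)^m\,dz$ over the circle of radius
$e^s$, so only a simple pole enclosed by the circle contributes. -/
theorem integral_exp_mul_exp_sub_zpow {l s : ℝ} (hl0 : 0 < l) (hs : s ≠ Real.log l) (m : ℤ) :
    ∫ φ in (-Real.pi)..Real.pi, Complex.exp (s + φ * Complex.I) *
      (Complex.exp (s + φ * Complex.I) - l) ^ m =
      if m = -1 ∧ Real.log l < s then 2 * (Real.pi : ℂ) else 0 := by
  have hper : Function.Periodic (fun φ : ℝ => Complex.exp (s + φ * Complex.I) *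
      (Complex.exp (s + φ * Complex.I) - l) ^ m) (2 * Real.pi) := by
    intro φ
    have : Complex.exp (s + ((φ + 2 * Real.pi : ℝ) : ℂ) * Complex.I) =
        Complex.exp (s + φ * Complex.I) := by
      rw [← Complex.exp_periodic (s + φ * Complex.I)]
      congr 1
      push_cast
      ring
    simp only [this]
  have h1 := hper.intervalIntegral_add_eq (-Real.pi) 0
  rw [show -Real.pi + 2 * Real.pi = Real.pi by ring, zero_add] at h1
  have hmap : ∀ φ : ℝ, circleMap 0 (Real.exp s) φ = Complex.exp (s + φ * Complex.I) := by
    intro φ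
    rw [circleMap_zero, Complex.ofReal_exp, ← Complex.exp_add]
  have h2 : (∮ z in C(0, Real.exp s), (z - (l : ℂ)) ^ m) = Complex.I *
      ∫ φ in (0 : ℝ)..(2 * Real.pi), Complex.exp (s + φ * Complex.I) *
        (Complex.exp (s + φ * Complex.I) - l) ^ m := by
    rw [circleIntegral, ← intervalIntegral.integral_const_mul]
    congr 1
    funext φ
    rw [deriv_circleMap, smul_eq_mul, hmap]
    ring
  rw [h1]
  apply mul_left_cancel₀ Complex.I_ne_zero
  rw [← h2]
  have hnl : ‖(l : ℂ)‖ = l := by rw [Complex.norm_real, Real.norm_of_nonneg hl0.le]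
  split_ifs with h
  · obtain ⟨rfl, hls⟩ := h
    simp only [zpow_neg_one]
    rw [circleIntegral.integral_sub_inv_of_mem_ball]
    · ring
    · rw [mem_ball_zero_iff, hnl]
      exact (Real.log_lt_iff_lt_exp hl0).1 hls
  · rw [mul_zero]
    by_cases hm : m = -1
    · subst hm
      have hls : s < Real.log l := lt_of_le_of_ne (not_lt.1 fun h' => h ⟨rfl, h'⟩) hs
      simp only [zpow_neg_one]
      refine circleIntegral_sub_inv_eq_zero (Real.exp_pos s).le ?_
      rw [mem_closedBall_zero_iff, hnl, not_le]
      exact (Real.lt_log_iff_exp_lt hl0).1 hls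
    · exact circleIntegral.integral_sub_zpow_of_ne hm _ _ _

noncomputable section

/-- Taylor coefficients at `0` of `(1 + x) ^ (n + A) * (1 - l ^ 2 x / (1 - l ^ 2)) ^ (n + β)`, before
the Cauchy product, with the normalizing constant of the kernel. -/
def kernelCoeff (A β l : ℝ) (n i j : ℕ) : ℝ :=
  l ^ (n + A) * (1 - l ^ 2) ^ (n + β) *
    (Ring.choose (n + A) i * (Ring.choose (n + β) j * (-l ^ 2 / (1 - l ^ 2)) ^ j))

/-- A Laurent polynomial in `exp w - l` with the principal part of the kernel at `log l`. -/
def kernelPrincipal (A β l : ℝ) (n : ℕ) (w : ℂ) : ℂ :=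
  ∑ i ∈ Finset.range (n + 1), ∑ j ∈ Finset.range (n + 1),
    (kernelCoeff A β l n i j / l ^ (i + j) : ℝ) *
      (Complex.exp w * (Complex.exp w - l) ^ ((i + j : ℤ) - (n + 1)))

end

/-- The residue is identified here. The diagonal $i+j=n$ picks out the coefficient of $\xi^n$ in
$(1+\xi)^{n+A}(1-\tfrac{l^2}{1-l^2}\xi)^{n+\beta}$, and for $x=1-2l^2$ one has $(x-1)/2=-l^2$ and
$(x+1)/2=1-l^2$. -/
theorem sum_kernelCoeff_eq {A β l : ℝ} (hl0 : 0 < l) (hl1 : l < 1) (n : ℕ) :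
    ∑ i ∈ Finset.range (n + 1), ∑ j ∈ Finset.range (n + 1),
      (if i + j = n then kernelCoeff A β l n i j / l ^ (i + j) else 0) =
      l ^ A * (1 - l ^ 2) ^ β * jacobiP n A β (1 - 2 * l ^ 2) := by
  have hr : 0 < 1 - l ^ 2 := by nlinarith
  rw [Finset.sum_comm, jacobiP, Finset.mul_sum]
  refine Finset.sum_congr rfl fun j hj => ?_
  have hjn : j ≤ n := Nat.lt_succ_iff.1 (Finset.mem_range.1 hj)
  rw [Finset.sum_eq_single (n - j)]
  · rw [if_pos (by omega), kernelCoeff, Nat.sub_add_cancel hjn, Real.rpow_add hl0, Real.rpow_add hr,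
      Real.rpow_natCast, Real.rpow_natCast, div_pow]
    obtain ⟨k, rfl⟩ := Nat.exists_eq_add_of_le hjn
    rw [Nat.add_sub_cancel_left, show (1 - 2 * l ^ 2 - 1) / 2 = -l ^ 2 by ring,
      show (1 - 2 * l ^ 2 + 1) / 2 = 1 - l ^ 2 by ring, pow_add (1 - l ^ 2)]
    field_simp
  · intro i _ hi
    rw [if_neg (by omega)]
  · intro h
    exact absurd (Finset.mem_range.2 (by omega)) h

theorem integral_kernelPrincipal {A β l s : ℝ} (hl0 : 0 < l) (hs : s ≠ Real.log l) (n : ℕ) :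
    ∫ φ in (-Real.pi)..Real.pi, kernelPrincipal A β l n (s + φ * Complex.I) =
      if Real.log l < s then
        2 * Real.pi * ((∑ i ∈ Finset.range (n + 1), ∑ j ∈ Finset.range (n + 1),
          (if i + j = n then kernelCoeff A β l n i j / l ^ (i + j) else 0) : ℝ) : ℂ) else 0 := by
  have hne : ∀ φ : ℝ, Complex.exp (s + φ * Complex.I) - l ≠ 0 := by
    intro φ h
    have h1 : ‖Complex.exp (s + φ * Complex.I)‖ = l := by
      rw [sub_eq_zero.1 h, Complex.norm_real, Real.norm_of_nonneg hl0.le]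
    rw [Complex.norm_exp] at h1
    apply hs
    rw [← h1, Real.log_exp]
    simp
  have hc : ∀ i j : ℕ, Continuous fun φ : ℝ =>
      ((kernelCoeff A β l n i j / l ^ (i + j) : ℝ) : ℂ) * (Complex.exp (s + φ * Complex.I) *
        (Complex.exp (s + φ * Complex.I) - l) ^ ((i + j : ℤ) - (n + 1))) := fun i j =>
    continuous_const.mul (Continuous.mul (by fun_prop)
      (Continuous.zpow₀ (by fun_prop) _ fun φ => Or.inl (hne φ)))
  unfold kernelPrincipal
  rw [intervalIntegral.integral_finsetSum fun i _ =>
    (continuous_finsetSum _ fun j _ => hc i j).intervalIntegrable _ _]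
  have : ∀ i ∈ Finset.range (n + 1), ∫ φ in (-Real.pi)..Real.pi, ∑ j ∈ Finset.range (n + 1),
      ((kernelCoeff A β l n i j / l ^ (i + j) : ℝ) : ℂ) * (Complex.exp (s + φ * Complex.I) *
        (Complex.exp (s + φ * Complex.I) - l) ^ ((i + j : ℤ) - (n + 1))) =
      ∑ j ∈ Finset.range (n + 1), if Real.log l < s then 2 * Real.pi *
        (((if i + j = n then kernelCoeff A β l n i j / l ^ (i + j) else 0) : ℝ) : ℂ) else 0 := by
    intro i _
    rw [intervalIntegral.integral_finsetSum fun j _ => (hc i j).intervalIntegrable _ _]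
    refine Finset.sum_congr rfl fun j _ => ?_
    rw [intervalIntegral.integral_const_mul, integral_exp_mul_exp_sub_zpow hl0 hs]
    have hiff : ((i + j : ℤ) - (n + 1) = -1) ↔ i + j = n := by omega
    simp only [hiff]
    by_cases h1 : i + j = n <;> by_cases h2 : Real.log l < s <;> simp [h1, h2, mul_comm]
  rw [Finset.sum_congr rfl this]
  split_ifs with h
  · push_cast
    simp only [Finset.mul_sum]
  · simp

/-- Being rational in $e^w$, the principal part contributes nothing from the two horizontal edges,
unlike the kernel. -/
theorem kernelPrincipal_periodic (A β l : ℝ) (n : ℕ) (s : ℝ) :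
    kernelPrincipal A β l n (s + (-Real.pi : ℝ) * Complex.I) =
      kernelPrincipal A β l n (s + Real.pi * Complex.I) := by
  have : Complex.exp (s + (-Real.pi : ℝ) * Complex.I) = Complex.exp (s + Real.pi * Complex.I) := by
    rw [← Complex.exp_periodic (s + (-Real.pi : ℝ) * Complex.I)]
    congr 1
    push_cast
    ring
  simp only [kernelPrincipal, this]

theorem kernelPrincipal_eq {A β l : ℝ} (hl0 : 0 < l) (n : ℕ) {w : ℂ}
    (hne : Complex.exp w - l ≠ 0) :
    kernelPrincipal A β l n w = Complex.exp w * (l ^ (n + A) * (1 - l ^ 2) ^ (n + β) : ℝ) *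
      ((binomialSeries ℂ ((n + A : ℝ) : ℂ)).partialSum (n + 1) (Complex.exp (w - Real.log l) - 1) *
      (binomialSeries ℂ ((n + β : ℝ) : ℂ)).partialSum (n + 1)
        ((-l ^ 2 / (1 - l ^ 2) : ℝ) * (Complex.exp (w - Real.log l) - 1))) /
      (Complex.exp w - l) ^ (n + 1) := by
  have hl : (l : ℂ) ≠ 0 := by exact_mod_cast hl0.ne'
  have hξ : Complex.exp (w - Real.log l) - 1 = (Complex.exp w - l) / l := by
    rw [Complex.exp_sub, ← Complex.ofReal_exp, Real.exp_log hl0]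
    field_simp
  rw [hξ]
  simp only [FormalMultilinearSeries.partialSum, binomialSeries_apply, List.ofFn_const,
    List.prod_replicate, kernelPrincipal, smul_eq_mul]
  rw [Finset.sum_mul_sum, Finset.mul_sum, Finset.sum_div]
  refine Finset.sum_congr rfl fun i _ => ?_
  rw [Finset.mul_sum, Finset.sum_div]
  refine Finset.sum_congr rfl fun j _ => ?_
  rw [zpow_sub₀ hne, kernelCoeff]
  have e1 : (Complex.exp w - l) ^ ((i : ℤ) + j) = (Complex.exp w - l) ^ (i + j) := by
    exact_mod_cast zpow_natCast (Complex.exp w - l) (i + j)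
  have e2 : (Complex.exp w - l) ^ ((n : ℤ) + 1) = (Complex.exp w - l) ^ (n + 1) := by
    exact_mod_cast zpow_natCast (Complex.exp w - l) (n + 1)
  rw [e1, e2, ← Complex.ofReal_choose, ← Complex.ofReal_choose]
  push_cast
  rw [mul_pow, div_pow (Complex.exp w - l), div_pow (Complex.exp w - l), pow_add (Complex.exp w - (l : ℂ)) i j, pow_add (l : ℂ) i j]
  field_simp

/-- With $e^w=l(1+\xi)$ one gets $1-le^w=(1-l^2)\bigl(1-\tfrac{l^2}{1-l^2}\xi\bigr)$. Near $\log l$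
the principal powers factor accordingly, because $|\operatorname{Im}w|<\pi$ and the constants $l$
and $1-l^2$ are positive. -/
theorem jacobiKernel_eventually_eq {a α β l : ℝ} (hl0 : 0 < l) (hl1 : l < 1) (n : ℕ) :
    ∀ᶠ w in nhds ((Real.log l : ℝ) : ℂ), jacobiKernel a α β l n w =
      Complex.exp w * (l ^ (n + (a * n + α)) * (1 - l ^ 2) ^ (n + β) : ℝ) *
      ((1 + (Complex.exp (w - Real.log l) - 1)) ^ ((n + (a * n + α) : ℝ) : ℂ) *
      (1 + (-l ^ 2 / (1 - l ^ 2) : ℝ) * (Complex.exp (w - Real.log l) - 1)) ^ ((n + β : ℝ) : ℂ)) /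
      (Complex.exp w - l) ^ (n + 1) := by
  have hr : 0 < 1 - l ^ 2 := by nlinarith
  have hrc : (1 : ℂ) - l ^ 2 ≠ 0 := by exact_mod_cast hr.ne'
  have hlog : Real.log l < 0 := Real.log_neg hl0 hl1
  have hnear : ∀ᶠ w in nhds ((Real.log l : ℝ) : ℂ), |w.im| < Real.pi ∧ w.re < -Real.log l := by
    refine Filter.Eventually.and ?_ ?_
    · have : ContinuousAt (fun w : ℂ => |w.im|) ((Real.log l : ℝ) : ℂ) := by fun_prop
      exact this.eventually_lt continuousAt_const (by simpa using Real.pi_pos)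
    · have : ContinuousAt (fun w : ℂ => w.re) ((Real.log l : ℝ) : ℂ) := by fun_prop
      exact this.eventually_lt continuousAt_const (by simpa using by linarith)
  filter_upwards [hnear] with w hw
  have hlexp : (l : ℂ) * Complex.exp (w - Real.log l) = Complex.exp w := by
    rw [Complex.exp_sub, ← Complex.ofReal_exp, Real.exp_log hl0]
    have hl : (l : ℂ) ≠ 0 := by exact_mod_cast hl0.ne'
    field_simp
  have hY : 1 - (l : ℂ) * Complex.exp w = ((1 - l ^ 2 : ℝ) : ℂ) *
      (1 + (-l ^ 2 / (1 - l ^ 2) : ℝ) * (Complex.exp (w - Real.log l) - 1)) := by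
    rw [← hlexp]
    push_cast
    field_simp
    ring
  set Y := 1 + ((-l ^ 2 / (1 - l ^ 2) : ℝ) : ℂ) * (Complex.exp (w - Real.log l) - 1) with hYd
  have hY0 : Y ≠ 0 := by
    intro h
    exact one_sub_mul_exp_ne_zero hl0 hw.2 (by rw [hY, h, mul_zero])
  have e1 : (1 + (Complex.exp (w - Real.log l) - 1)) ^ ((n + (a * n + α) : ℝ) : ℂ) =
      Complex.exp ((w - Real.log l) * ((n + (a * n + α) : ℝ) : ℂ)) := by
    rw [add_sub_cancel, Complex.cpow_def_of_ne_zero (Complex.exp_ne_zero _), Complex.log_exp]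
    · simpa using (abs_lt.1 hw.1).1
    · simpa using (abs_lt.1 hw.1).2.le
  have e2 : ((l ^ (n + (a * n + α)) : ℝ) : ℂ) =
      Complex.exp (Real.log l * ((n + (a * n + α) : ℝ) : ℂ)) := by
    rw [Real.rpow_def_of_pos hl0]
    push_cast
    ring_nf
  have e3 : (((1 - l ^ 2) ^ (n + β) : ℝ) : ℂ) * Y ^ ((n + β : ℝ) : ℂ) =
      (1 - (l : ℂ) * Complex.exp w) ^ n * (1 - (l : ℂ) * Complex.exp w) ^ (β : ℂ) := by
    have hrY : ((1 - l ^ 2 : ℝ) : ℂ) * Y ≠ 0 := mul_ne_zero (by exact_mod_cast hr.ne') hY0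
    rw [hY, ← Complex.cpow_natCast, ← Complex.cpow_add _ _ hrY, Complex.cpow_def_of_ne_zero hrY,
      Complex.cpow_def_of_ne_zero hY0, Complex.log_ofReal_mul hr hY0, Real.rpow_def_of_pos hr,
      Complex.ofReal_exp, ← Complex.exp_add]
    push_cast
    ring_nf
  have e4 : Complex.exp (((a : ℂ) + 1) * w) ^ n * Complex.exp ((α + 1) * w) =
      Complex.exp w * (((l ^ (n + (a * n + α)) : ℝ) : ℂ) *
        (1 + (Complex.exp (w - Real.log l) - 1)) ^ ((n + (a * n + α) : ℝ) : ℂ)) := by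
    rw [e1, e2, ← Complex.exp_nat_mul, ← Complex.exp_add, ← Complex.exp_add, ← Complex.exp_add]
    push_cast
    ring_nf
  rw [jacobiKernel, saddleBase, saddleWeight, div_pow, div_mul_div_comm, mul_pow, ← pow_succ]
  congr 1
  rw [mul_mul_mul_comm, e4, ← e3]
  push_cast
  ring

/-- Truncating each factor separately is enough and avoids the Cauchy product; the surplus terms of
high total degree give nonnegative powers of $e^w-l$ in the principal part and have no residue. -/
theorem one_add_cpow_mul_sub_partialSum_isBigO (s r q : ℂ) (n : ℕ) :
    (fun x : ℂ => (1 + x) ^ s * (1 + q * x) ^ r -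
      (binomialSeries ℂ s).partialSum n x * (binomialSeries ℂ r).partialSum n (q * x))
      =O[nhds 0] fun x => ‖x‖ ^ n := by
  have h1 := (Complex.one_add_cpow_hasFPowerSeriesAt_zero (a := s)).isBigO_sub_partialSum_pow n
  have h2 := (Complex.one_add_cpow_hasFPowerSeriesAt_zero (a := r)).isBigO_sub_partialSum_pow n
  simp only [zero_add] at h1 h2
  have hq : Tendsto (fun x : ℂ => q * x) (nhds 0) (nhds 0) := by
    have : Continuous fun x : ℂ => q * x := by fun_prop
    simpa using this.tendsto 0
  have h3 : (fun x : ℂ => (1 + q * x) ^ r - (binomialSeries ℂ r).partialSum n (q * x))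
      =O[nhds 0] fun x => ‖x‖ ^ n := by
    refine (h2.comp_tendsto hq).trans (IsBigO.of_bound (‖q‖ ^ n) (Eventually.of_forall fun x => ?_))
    simp [mul_pow]
  have hb1 : (fun x : ℂ => (1 + q * x) ^ r) =O[nhds 0] fun _ => (1 : ℝ) := by
    have : ContinuousAt (fun x : ℂ => (1 + q * x) ^ r) 0 :=
      ContinuousAt.cpow (by fun_prop) (by fun_prop) (by simp)
    exact this.tendsto.isBigO_one ℝ
  have hb2 : (fun x : ℂ => (binomialSeries ℂ s).partialSum n x) =O[nhds 0] fun _ => (1 : ℝ) :=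
    ((binomialSeries ℂ s).partialSum_continuous n).continuousAt.tendsto.isBigO_one ℝ
  have h4 := h1.mul hb1
  have h5 := hb2.mul h3
  simp only [mul_one, one_mul] at h4 h5
  refine (h4.add h5).congr_left fun x => ?_
  ring

/-- The truncation error is $O(|\xi|^{n+1})$, and it is divided by $(e^w-l)^{n+1}=(l\xi)^{n+1}$. -/
theorem jacobiKernel_sub_principal_isBigO {a α β l : ℝ} (hl0 : 0 < l) (hl1 : l < 1) (n : ℕ) :
    (fun w => jacobiKernel a α β l n w - kernelPrincipal (a * n + α) β l n w)
      =O[nhdsWithin ((Real.log l : ℝ) : ℂ) {((Real.log l : ℝ) : ℂ)}ᶜ] fun _ => (1 : ℝ) := by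
  set c : ℂ := ((Real.log l : ℝ) : ℂ) with hc
  have hl : (l : ℂ) ≠ 0 := by exact_mod_cast hl0.ne'
  have hξ : Tendsto (fun w => Complex.exp (w - c) - 1) (nhdsWithin c {c}ᶜ) (nhds 0) := by
    have : Continuous fun w => Complex.exp (w - c) - 1 := by fun_prop
    have h := this.tendsto c
    simp only [sub_self, Complex.exp_zero] at h
    exact h.mono_left nhdsWithin_le_nhds
  have hT := (one_add_cpow_mul_sub_partialSum_isBigO ((n + (a * n + α) : ℝ) : ℂ) ((n + β : ℝ) : ℂ)
    ((-l ^ 2 / (1 - l ^ 2) : ℝ) : ℂ) (n + 1)).comp_tendsto hξ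
  have hb : (fun w => Complex.exp w * ((l ^ (n + (a * n + α)) * (1 - l ^ 2) ^ (n + β) : ℝ) : ℂ))
      =O[nhdsWithin c {c}ᶜ] fun _ => (1 : ℝ) := by
    have : Continuous fun w => Complex.exp w *
      ((l ^ (n + (a * n + α)) * (1 - l ^ 2) ^ (n + β) : ℝ) : ℂ) := by fun_prop
    exact ((this.tendsto c).mono_left nhdsWithin_le_nhds).isBigO_one ℝ
  have hne : ∀ᶠ w in nhdsWithin c {c}ᶜ, Complex.exp w - (l : ℂ) ≠ 0 := by
    have h1 : ∀ᶠ w : ℂ in nhdsWithin c {c}ᶜ, |w.im| < 2 * Real.pi := by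
      have : ContinuousAt (fun w : ℂ => |w.im|) c := by fun_prop
      exact nhdsWithin_le_nhds (this.eventually_lt continuousAt_const
        (by simpa [hc] using Real.pi_pos))
    filter_upwards [h1, self_mem_nhdsWithin] with w hw hw'
    exact exp_sub_ne_zero_of_im hl0 hw hw'
  have hinv : (fun w => ((Complex.exp w - (l : ℂ)) ^ (n + 1))⁻¹) =O[nhdsWithin c {c}ᶜ]
      fun w => (‖Complex.exp (w - c) - 1‖ ^ (n + 1))⁻¹ := by
    refine IsBigO.of_bound ((l ^ (n + 1))⁻¹) (Eventually.of_forall fun w => le_of_eq ?_)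
    have : Complex.exp w - (l : ℂ) = l * (Complex.exp (w - c) - 1) := by
      rw [Complex.exp_sub, hc, ← Complex.ofReal_exp, Real.exp_log hl0]
      field_simp
    rw [this, norm_inv, norm_pow, norm_mul, Complex.norm_real, Real.norm_of_nonneg hl0.le, mul_pow,
      mul_inv, norm_inv, norm_pow, norm_norm]
  have hprod := (hb.mul hT).mul hinv
  refine (hprod.congr' ?_ EventuallyEq.rfl).trans ?_
  · filter_upwards [hne, nhdsWithin_le_nhds (jacobiKernel_eventually_eq (a := a) (α := α) (β := β)
      hl0 hl1 n)] with w hw hw'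
    rw [hw', kernelPrincipal_eq hl0 n hw]
    simp only [Function.comp]
    ring
  · refine IsBigO.of_bound 1 (Eventually.of_forall fun w => ?_)
    simp only [Function.comp, one_mul, norm_mul, norm_inv, norm_pow, norm_norm, norm_one]
    exact mul_inv_le_one

theorem differentiableAt_kernelPrincipal {A β l : ℝ} (n : ℕ) {w : ℂ}
    (hne : Complex.exp w - (l : ℂ) ≠ 0) : DifferentiableAt ℂ (kernelPrincipal A β l n) w := by
  unfold kernelPrincipal
  refine DifferentiableAt.fun_sum fun i _ => DifferentiableAt.fun_sum fun j _ => ?_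
  refine DifferentiableAt.const_mul (DifferentiableAt.mul (by fun_prop) ?_) _
  exact DifferentiableAt.zpow (by fun_prop) (Or.inl hne)

/-- The difference of the kernel and its principal part extends holomorphically across `log l`. -/
theorem exists_holomorphic_extension {a α β l : ℝ} (hl0 : 0 < l) (hl1 : l < 1) (n : ℕ) :
    ∃ R : ℂ → ℂ, DifferentiableOn ℂ R {w : ℂ | w.re < -Real.log l ∧ |w.im| < 2 * Real.pi} ∧
      ∀ w : ℂ, w ≠ ((Real.log l : ℝ) : ℂ) →
        R w = jacobiKernel a α β l n w - kernelPrincipal (a * n + α) β l n w := by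
  set c : ℂ := ((Real.log l : ℝ) : ℂ) with hc
  have hlog : Real.log l < 0 := Real.log_neg hl0 hl1
  have hopen : IsOpen {w : ℂ | w.re < -Real.log l ∧ |w.im| < 2 * Real.pi} := by
    have h1 : IsOpen {w : ℂ | w.re < -Real.log l} := isOpen_lt (by fun_prop) continuous_const
    have h2 : IsOpen {w : ℂ | |w.im| < 2 * Real.pi} := isOpen_lt (by fun_prop) continuous_const
    exact h1.inter h2
  refine ⟨_, Complex.differentiableOn_update_limUnder_of_isLittleO (c := c)
    (f := fun w => jacobiKernel a α β l n w - kernelPrincipal (a * n + α) β l n w)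
    (hopen.mem_nhds ?_) (fun w hw => ?_) ?_, fun w hw => by simp [hw]⟩
  · simp only [hc, Set.mem_ofPred_eq, Complex.ofReal_re, Complex.ofReal_im, abs_zero]
    exact ⟨by linarith, by positivity⟩
  · have hne := exp_sub_ne_zero_of_im hl0 hw.1.2 hw.2
    exact ((differentiableAt_jacobiKernel n hl0 hw.1.1 hne).sub
      (differentiableAt_kernelPrincipal n hne)).differentiableWithinAt
  -- Riemann's removable singularity theorem: boundedness near $\log l$ suffices, and the arbitrary
  -- value of the kernel at that point is subtracted as a constant.
  · refine IsBoundedUnder.isLittleO_sub_self_inv (f := fun w => (jacobiKernel a α β l n w -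
      kernelPrincipal (a * n + α) β l n w) - (jacobiKernel a α β l n c -
      kernelPrincipal (a * n + α) β l n c)) ?_
    exact ((jacobiKernel_sub_principal_isBigO hl0 hl1 n).sub
      (isBigO_const_const _ one_ne_zero _)).isBoundedUnder_le

/-! ### Cauchy's theorem on the rectangle and the half contour. -/

/-- Cauchy's theorem is applied to the holomorphic remainder. Subtracting the principal part costs
$2\pi Q_n$ on the right side only, since the circle $|z|=e^t$ does not enclose $l$. The kernel's
values on the horizontal edges are conjugate, so their difference is the sine term. -/
theorem rectangle_identity {a α β l : ℝ} (hl0 : 0 < l) (hl1 : l < 1) (n : ℕ) {s t : ℝ}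
    (hs : Real.log l < s) (hs' : s < -Real.log l) (ht : t < Real.log l) :
    Complex.I * ((∫ φ in (-Real.pi)..Real.pi, jacobiKernel a α β l n (s + φ * Complex.I)) -
      2 * Real.pi * (scaledJacobi a α β l n : ℂ)) -
    Complex.I * (∫ φ in (-Real.pi)..Real.pi, jacobiKernel a α β l n (t + φ * Complex.I)) -
    2 * Complex.I * Real.sin (Real.pi * (a * n + α)) *
      ((∫ x in t..s, cutBase a l x ^ n * cutWeight α β l x : ℝ) : ℂ) = 0 := by
  obtain ⟨R, hRd, hR⟩ := exists_holomorphic_extension (a := a) (α := α) (β := β) hl0 hl1 n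
  have hpi := Real.pi_pos
  have hts : t ≤ s := by linarith
  have hrect := Complex.integral_boundary_rect_eq_zero_of_differentiableOn R
    (⟨t, -Real.pi⟩ : ℂ) (⟨s, Real.pi⟩ : ℂ) (hRd.mono ?_)
  · simp only at hrect
    have hkv : ∀ x : ℝ, x < -Real.log l → x ≠ Real.log l → Continuous fun φ : ℝ =>
        jacobiKernel a α β l n (x + φ * Complex.I) := by
      intro x hx hx'
      rw [continuous_iff_continuousAt]
      intro φ
      have hne : Complex.exp (x + φ * Complex.I) - l ≠ 0 := by
        intro h
        have h1 : ‖Complex.exp (x + φ * Complex.I)‖ = l := by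
          rw [sub_eq_zero.1 h, Complex.norm_real, Real.norm_of_nonneg hl0.le]
        rw [Complex.norm_exp] at h1
        apply hx'
        rw [← h1, Real.log_exp]
        simp
      have := (differentiableAt_jacobiKernel (a := a) (α := α) (β := β) n hl0
        (w := x + φ * Complex.I) (by simpa using hx) hne).continuousAt
      exact ContinuousAt.comp (f := fun φ : ℝ => (x : ℂ) + φ * Complex.I) this (by fun_prop)
    have hvert : ∀ x : ℝ, x < -Real.log l → x ≠ Real.log l →
        ∫ φ in (-Real.pi)..Real.pi, R (x + φ * Complex.I) =
        (∫ φ in (-Real.pi)..Real.pi, jacobiKernel a α β l n (x + φ * Complex.I)) -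
        if Real.log l < x then 2 * Real.pi * (scaledJacobi a α β l n : ℂ) else 0 := by
      intro x hx hx'
      have hne : ∀ φ : ℝ, (x : ℂ) + φ * Complex.I ≠ ((Real.log l : ℝ) : ℂ) := by
        intro φ h
        apply hx'
        simpa using congrArg Complex.re h
      have hPc : Continuous fun φ : ℝ => kernelPrincipal (a * n + α) β l n (x + φ * Complex.I) := by
        rw [continuous_iff_continuousAt]
        intro φ
        have hne : Complex.exp (x + φ * Complex.I) - l ≠ 0 := by
          intro h
          have h1 : ‖Complex.exp (x + φ * Complex.I)‖ = l := by
            rw [sub_eq_zero.1 h, Complex.norm_real, Real.norm_of_nonneg hl0.le]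
          rw [Complex.norm_exp] at h1
          apply hx'
          rw [← h1, Real.log_exp]
          simp
        exact ContinuousAt.comp (f := fun φ : ℝ => (x : ℂ) + φ * Complex.I)
          (differentiableAt_kernelPrincipal n hne).continuousAt (by fun_prop)
      have hcoef : (scaledJacobi a α β l n : ℂ) =
          ((∑ i ∈ Finset.range (n + 1), ∑ j ∈ Finset.range (n + 1),
          (if i + j = n then kernelCoeff (a * n + α) β l n i j / l ^ (i + j) else 0) : ℝ) : ℂ) := by
        rw [sum_kernelCoeff_eq hl0 hl1, scaledJacobi, varJacobi]
      rw [hcoef, ← integral_kernelPrincipal hl0 hx', ← intervalIntegral.integral_sub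
        ((hkv x hx hx').intervalIntegrable _ _) (hPc.intervalIntegrable _ _)]
      exact intervalIntegral.integral_congr fun φ _ => hR _ (hne φ)
    have hne : ∀ x y : ℝ, y ≠ 0 → (x : ℂ) + y * Complex.I ≠ ((Real.log l : ℝ) : ℂ) := by
      intro x y hy h
      apply hy
      simpa using congrArg Complex.im h
    have hhor : (∫ x in t..s, R (x + (-Real.pi : ℝ) * Complex.I)) -
        (∫ x in t..s, R (x + Real.pi * Complex.I)) =
        -(2 * Complex.I * Real.sin (Real.pi * (a * n + α)) *
        ((∫ x in t..s, cutBase a l x ^ n * cutWeight α β l x : ℝ) : ℂ)) := by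
      have hRc : ∀ y : ℝ, |y| < 2 * Real.pi → y ≠ 0 →
          ContinuousOn (fun x : ℝ => R (x + y * Complex.I)) (Set.uIcc t s) := by
        intro y hy hy0 x hx
        rw [Set.uIcc_of_le hts] at hx
        refine ContinuousWithinAt.comp (t := {w : ℂ | w.re < -Real.log l ∧ |w.im| < 2 * Real.pi})
          (f := fun x : ℝ => (x : ℂ) + y * Complex.I) (hRd.continuousOn _ ?_)
          (by fun_prop) ?_
        · exact ⟨by simpa using hx.2.trans_lt hs', by simpa using hy⟩
        · intro x' hx'
          rw [Set.uIcc_of_le hts] at hx'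
          exact ⟨by simpa using hx'.2.trans_lt hs', by simpa using hy⟩
      rw [← intervalIntegral.integral_sub
        (hRc _ (by rw [abs_neg, abs_of_pos hpi]; linarith) (by linarith)).intervalIntegrable
        (hRc _ (by rw [abs_of_pos hpi]; linarith) hpi.ne').intervalIntegrable,
        ← intervalIntegral.integral_ofReal, ← intervalIntegral.integral_const_mul,
        ← intervalIntegral.integral_neg]
      refine intervalIntegral.integral_congr_ae (Eventually.of_forall fun x hx => ?_)
      rw [Set.uIoc_of_le hts] at hx
      rw [hR _ (hne _ _ (by linarith)), hR _ (hne _ _ hpi.ne'), kernelPrincipal_periodic,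
        jacobiKernel_add_pi_mul_I n hl0]
      have hconj : (x : ℂ) + (-Real.pi : ℝ) * Complex.I =
          (starRingEnd ℂ) (x + Real.pi * Complex.I) := by
        simp
      rw [hconj, jacobiKernel_conj n hl0 (by simpa using hx.2.trans_lt hs'),
        jacobiKernel_add_pi_mul_I n hl0, map_mul, ← Complex.exp_conj, Complex.conj_ofReal]
      have h1 : (starRingEnd ℂ) ((a * n + α) * Real.pi * Complex.I) =
          ((-(Real.pi * (a * n + α)) : ℝ) : ℂ) * Complex.I := by
        simp
        ring
      have h2 : ((a : ℂ) * n + α) * Real.pi * Complex.I =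
          ((Real.pi * (a * n + α) : ℝ) : ℂ) * Complex.I := by
        push_cast; ring
      rw [h1, h2, Complex.exp_mul_I, Complex.exp_mul_I, ← Complex.ofReal_cos, ← Complex.ofReal_sin,
        ← Complex.ofReal_cos, ← Complex.ofReal_sin, Real.cos_neg, Real.sin_neg]
      push_cast
      ring
    rw [hhor, hvert s hs' hs.ne', hvert t (by linarith) ht.ne, if_pos hs, if_neg ht.not_gt,
      smul_eq_mul, smul_eq_mul, sub_zero] at hrect
    linear_combination hrect
  · intro w hw
    rw [Complex.mem_reProdIm] at hw
    simp only [Set.uIcc_of_le hts, Set.uIcc_of_le (neg_le_self hpi.le)] at hw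
    refine ⟨hw.1.2.trans_lt hs', ?_⟩
    rw [abs_lt]
    constructor <;> linarith [hw.2.1, hw.2.2]

/-- Let $t\to-\infty$ in the rectangle: the left side vanishes by the exponential decay of the
kernel, and the integral along the cut converges. -/
theorem vertical_integral_representation {a α β l : ℝ} (hα : -1 < α) (ha : -1 < a)
    (hl0 : 0 < l) (hl1 : l < 1) (n : ℕ) {s : ℝ} (hs : Real.log l < s) (hs' : s < -Real.log l) :
    ∫ φ in (-Real.pi)..Real.pi, jacobiKernel a α β l n (s + φ * Complex.I) =
      2 * ((Real.pi * scaledJacobi a α β l n +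
        Real.sin (Real.pi * (a * n + α)) * cutIntegral a α β l n s : ℝ) : ℂ) := by
  have hγ : 0 < (a + 1) * n + (α + 1) := by
    have : 0 ≤ (a + 1) * n := mul_nonneg (by linarith) (Nat.cast_nonneg n)
    linarith
  have hcut := MeasureTheory.intervalIntegral_tendsto_integral_Iic s
    (integrableOn_cut (β := β) hα ha hl0 n s) tendsto_id
  have hcut' : Tendsto (fun t : ℝ => ((∫ x in t..s, cutBase a l x ^ n * cutWeight α β l x : ℝ) : ℂ))
      atBot (nhds (cutIntegral a α β l n s : ℂ)) :=
    (Complex.continuous_ofReal.tendsto _).comp hcut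
  have hleft : Tendsto (fun t : ℝ => ∫ φ in (-Real.pi)..Real.pi,
      jacobiKernel a α β l n (t + φ * Complex.I)) atBot (nhds 0) := by
    obtain ⟨C, M₀, hC⟩ := exists_norm_jacobiKernel_le a α β hl0 n
    refine squeeze_zero_norm' (a := fun t : ℝ => C * Real.exp (((a + 1) * n + (α + 1)) * t) *
      |Real.pi - -Real.pi|) ?_ ?_
    · filter_upwards [eventually_le_atBot M₀] with t ht
      refine intervalIntegral.norm_integral_le_of_norm_le_const fun φ _ => ?_
      simpa using hC (t + φ * Complex.I) (by simpa using ht)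
    · have h1 : Tendsto (fun t : ℝ => Real.exp (((a + 1) * n + (α + 1)) * t)) atBot (nhds 0) :=
        Real.tendsto_exp_atBot.comp (tendsto_id.const_mul_atBot hγ)
      simpa using (h1.const_mul C).mul_const |Real.pi - -Real.pi|
  have hlim := ((tendsto_const_nhds (x := Complex.I * ((∫ φ in (-Real.pi)..Real.pi,
    jacobiKernel a α β l n (s + φ * Complex.I)) - 2 * Real.pi * (scaledJacobi a α β l n : ℂ)))).sub
    (hleft.const_mul Complex.I)).sub
    (hcut'.const_mul (2 * Complex.I * Real.sin (Real.pi * (a * n + α))))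
  have hzero := tendsto_nhds_unique (hlim.congr' ?_) (tendsto_const_nhds (x := (0 : ℂ)))
  · apply mul_left_cancel₀ Complex.I_ne_zero
    push_cast at hzero ⊢
    linear_combination hzero
  · filter_upwards [eventually_lt_atBot (Real.log l)] with t ht
    exact rectangle_identity hl0 hl1 n hs hs' ht

theorem isOpen_abs_re_lt (r : ℝ) : IsOpen {w : ℂ | |w.re| < r} :=
  isOpen_lt (by fun_prop) continuous_const

theorem convex_abs_re_lt (r : ℝ) : Convex ℝ {w : ℂ | |w.re| < r} := by
  have : {w : ℂ | |w.re| < r} = Complex.reLm ⁻¹' (Set.Ioo (-r) r) := by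
    ext w
    simp [abs_lt]
  rw [this]
  exact (convex_Ioo _ _).linear_preimage _

/-- The strip is convex, so a global primitive exists; endpoint differences of the primitive then
replace homotopies of contours. -/
theorem exists_primitive_of_differentiableOn_strip {f : ℂ → ℂ} {r : ℝ}
    (hf : DifferentiableOn ℂ f {w : ℂ | |w.re| < r}) (w₀ : ℂ) :
    ∃ F : ℂ → ℂ, F w₀ = 0 ∧ ∀ w : ℂ, |w.re| < r → HasDerivAt F (f w) w := by
  obtain ⟨F, hF⟩ := (convex_abs_re_lt r).exists_forall_hasDerivWithinAt hf
  refine ⟨fun w => F w - F w₀, sub_self _, fun w hw => ?_⟩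
  exact ((hF w hw).hasDerivAt ((isOpen_abs_re_lt r).mem_nhds hw)).sub_const _

theorem exp_sub_ne_zero_of_abs_re {l : ℝ} (hl0 : 0 < l) {w : ℂ} (hw : |w.re| < -Real.log l) :
    Complex.exp w - (l : ℂ) ≠ 0 :=
  exp_sub_ne_zero_of_re hl0 (by linarith [(abs_lt.1 hw).1])

/-- The scaled Jacobi polynomial in terms of a primitive of the kernel on a vertical strip. -/
theorem exists_primitive_representation {a α β l : ℝ} (hα : -1 < α) (ha : -1 < a)
    (hl0 : 0 < l) (hl1 : l < 1) (n : ℕ) :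
    ∃ Φ : ℂ → ℂ, (∀ w : ℂ, |w.re| < -Real.log l → HasDerivAt Φ (jacobiKernel a α β l n w) w) ∧
      (∀ s : ℝ, |s| < -Real.log l → (Φ s).im = 0) ∧
      ∀ s : ℝ, |s| < -Real.log l → Real.pi * scaledJacobi a α β l n =
        (Φ (s + Real.pi * Complex.I)).im -
          Real.sin (Real.pi * (a * n + α)) * cutIntegral a α β l n s := by
  have hd : DifferentiableOn ℂ (jacobiKernel a α β l n) {w : ℂ | |w.re| < -Real.log l} :=
    fun w hw => (differentiableAt_jacobiKernel n hl0 (abs_lt.1 hw).2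
      (exp_sub_ne_zero_of_abs_re hl0 hw)).differentiableWithinAt
  obtain ⟨Φ, hΦ0, hΦ⟩ := exists_primitive_of_differentiableOn_strip hd 0
  have hlog : Real.log l < 0 := Real.log_neg hl0 hl1
  have him : ∀ s : ℝ, |s| < -Real.log l → (Φ s).im = 0 := by
    have hder : ∀ s ∈ Set.Ioo (Real.log l) (-Real.log l),
        HasDerivAt (fun s : ℝ => (Φ s).im) 0 s := by
      intro s hs
      have h1 := (hΦ s (by rw [Complex.ofReal_re, abs_lt]; constructor <;> linarith [hs.1, hs.2]))
      have h2 := h1.comp_ofReal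
      have h3 := (Complex.imCLM.hasFDerivAt.comp_hasDerivAt s h2)
      rw [Complex.imCLM_apply, jacobiKernel_ofReal_im n hl0 hs.2] at h3
      exact h3
    intro s hs
    have hconst := (convex_Ioo (Real.log l) (-Real.log l)).is_const_of_fderivWithin_eq_zero
      (𝕜 := ℝ) (f := fun s : ℝ => (Φ s).im)
      (fun x hx => (hder x hx).differentiableAt.differentiableWithinAt) (fun x hx => by
        rw [fderivWithin_of_isOpen isOpen_Ioo hx]
        ext
        simpa using (hder x hx).deriv)
      (x := s) (y := 0) ⟨by linarith [(abs_lt.1 hs).1], (abs_lt.1 hs).2⟩ ⟨hlog, by linarith⟩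
    rw [hconst]
    simp [hΦ0]
  refine ⟨Φ, hΦ, him, fun s hs => ?_⟩
  have hs1 : Real.log l < s := by linarith [(abs_lt.1 hs).1]
  have hs2 := (abs_lt.1 hs).2
  have hrep := vertical_integral_representation (β := β) hα ha hl0 hl1 n hs1 hs2
  have hline : ∀ φ : ℝ, HasDerivAt (fun φ : ℝ => -Complex.I * Φ (s + φ * Complex.I))
      (jacobiKernel a α β l n (s + φ * Complex.I)) φ := by
    intro φ
    have h1 : HasDerivAt (fun z : ℂ => (s : ℂ) + z * Complex.I) (1 * Complex.I) (φ : ℂ) :=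
      ((hasDerivAt_id _).mul_const _).const_add _
    have h2 := (hΦ (s + φ * Complex.I) (by simpa using hs)).comp (φ : ℂ) h1
    have h3 := (h2.comp_ofReal).const_mul (-Complex.I)
    have h4 : -Complex.I * (jacobiKernel a α β l n (s + φ * Complex.I) * (1 * Complex.I)) =
        jacobiKernel a α β l n (s + φ * Complex.I) := by
      linear_combination (-jacobiKernel a α β l n (s + φ * Complex.I)) * Complex.I_sq
    rw [h4] at h3
    exact h3
  have hkc : Continuous fun φ : ℝ => jacobiKernel a α β l n (s + φ * Complex.I) := by
    rw [continuous_iff_continuousAt]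
    intro φ
    exact ContinuousAt.comp (f := fun φ : ℝ => (s : ℂ) + φ * Complex.I)
      (differentiableAt_jacobiKernel n hl0 (w := s + φ * Complex.I) (by simpa using hs2)
      (exp_sub_ne_zero_of_abs_re hl0 (by simpa using hs))).continuousAt (by fun_prop)
  have hhalf : ∫ φ in (0 : ℝ)..Real.pi, jacobiKernel a α β l n (s + φ * Complex.I) =
      -Complex.I * Φ (s + Real.pi * Complex.I) - -Complex.I * Φ s := by
    rw [intervalIntegral.integral_eq_sub_of_hasDerivAt (fun φ _ => hline φ)
      (hkc.intervalIntegrable _ _)]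
    simp
  -- The lower half of the line is conjugate to the upper half. The full integral is thus twice the
  -- real part of the upper one, which is $2\operatorname{Im}\Phi(s+\pi i)$ because $\Phi$ is real
  -- at $s$.
  have hneg : ∫ φ in (-Real.pi)..0, jacobiKernel a α β l n (s + φ * Complex.I) =
      (starRingEnd ℂ) (∫ φ in (0 : ℝ)..Real.pi, jacobiKernel a α β l n (s + φ * Complex.I)) := by
    rw [← intervalIntegral.intervalIntegral_conj]
    have hflip := intervalIntegral.integral_comp_neg (a := 0) (b := Real.pi)
      fun φ : ℝ => jacobiKernel a α β l n (s + φ * Complex.I)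
    rw [neg_zero] at hflip
    rw [← hflip]
    refine intervalIntegral.integral_congr fun φ _ => ?_
    rw [← jacobiKernel_conj n hl0 (by simpa using hs2)]
    simp
  rw [← intervalIntegral.integral_add_adjacent_intervals (hkc.intervalIntegrable _ 0)
    (hkc.intervalIntegrable _ _), hneg, hhalf] at hrep
  have hre := congrArg Complex.re hrep
  simp only [Complex.add_re, Complex.conj_re, Complex.sub_re, Complex.mul_re, Complex.neg_re,
    Complex.neg_im, Complex.I_re, Complex.I_im, Complex.ofReal_re, him s hs] at hre
  norm_num at hre
  linarith

/-! ### Monotonicity of the modulus on vertical lines and on the cut. -/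

section modulus

variable {a α β l : ℝ}

theorem norm_saddleBase_sq (a : ℝ) (l s φ : ℝ) :
    ‖saddleBase a l (s + φ * Complex.I)‖ ^ 2 = Real.exp ((a + 1) * s) ^ 2 *
      ((1 + l ^ 2 * Real.exp s ^ 2 - 2 * l * Real.exp s * Real.cos φ) /
        (Real.exp s ^ 2 + l ^ 2 - 2 * l * Real.exp s * Real.cos φ)) := by
  have hexp : Complex.exp (s + φ * Complex.I) =
      ⟨Real.exp s * Real.cos φ, Real.exp s * Real.sin φ⟩ := by
    apply Complex.ext <;> simp [Complex.exp_re, Complex.exp_im]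
  have h1 : ‖Complex.exp (((a : ℂ) + 1) * (s + φ * Complex.I))‖ = Real.exp ((a + 1) * s) := by
    rw [Complex.norm_exp]
    congr 1
    simp
  have hsc := Real.sin_sq_add_cos_sq φ
  have h2 : ‖1 - (l : ℂ) * Complex.exp (s + φ * Complex.I)‖ ^ 2 =
      1 + l ^ 2 * Real.exp s ^ 2 - 2 * l * Real.exp s * Real.cos φ := by
    rw [← Complex.normSq_eq_norm_sq, Complex.normSq_apply, hexp]
    simp
    linear_combination (l ^ 2 * Real.exp s ^ 2) * hsc
  have h3 : ‖Complex.exp (s + φ * Complex.I) - (l : ℂ)‖ ^ 2 =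
      Real.exp s ^ 2 + l ^ 2 - 2 * l * Real.exp s * Real.cos φ := by
    rw [← Complex.normSq_eq_norm_sq, Complex.normSq_apply, hexp]
    simp
    linear_combination (Real.exp s ^ 2) * hsc
  rw [saddleBase, norm_div, norm_mul, div_pow, mul_pow, h1, h2, h3, mul_div_assoc]

theorem sq_add_sq_sub_pos {l r c : ℝ} (hl0 : 0 < l) (hr : l < r) (hc : c ≤ 1) :
    0 < r ^ 2 + l ^ 2 - 2 * l * r * c := by
  have h1 : 0 < (r - l) ^ 2 := by
    have : 0 < r - l := by linarith
    positivity
  nlinarith [mul_nonneg (mul_pos hl0 (hl0.trans hr)).le (sub_nonneg.2 hc)]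

/-- Left of the unit circle, the modulus of `saddleBase` on a vertical line increases with the
cosine of the angle. -/
theorem norm_saddleBase_le_of_neg (a : ℝ) (hl0 : 0 < l) (hl1 : l < 1) {s φ₁ φ₂ : ℝ}
    (hs : Real.log l < s) (hs0 : s ≤ 0) (hc : Real.cos φ₁ ≤ Real.cos φ₂) :
    ‖saddleBase a l (s + φ₁ * Complex.I)‖ ≤ ‖saddleBase a l (s + φ₂ * Complex.I)‖ := by
  refine le_of_sq_le_sq ?_ (norm_nonneg _)
  rw [norm_saddleBase_sq, norm_saddleBase_sq]
  refine mul_le_mul_of_nonneg_left ?_ (by positivity)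
  have hr : l < Real.exp s := (Real.log_lt_iff_lt_exp hl0).1 hs
  have hr1 : Real.exp s ≤ 1 := Real.exp_le_one_iff.2 hs0
  set r := Real.exp s with hrd
  have hr0 : 0 < r := Real.exp_pos s
  rw [div_le_div_iff₀ (sq_add_sq_sub_pos hl0 hr (Real.cos_le_one _))
    (sq_add_sq_sub_pos hl0 hr (Real.cos_le_one _))]
  -- This product is exactly the difference of the two cross-multiplied sides, because
  -- $(1+l^2r^2)-(r^2+l^2)=(1-r^2)(1-l^2)$.
  have h1 : 0 ≤ 2 * l * r * ((1 - r ^ 2) * (1 - l ^ 2)) * (Real.cos φ₂ - Real.cos φ₁) := by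
    have e1 : 0 ≤ 1 - r ^ 2 := by nlinarith
    have e2 : 0 ≤ 1 - l ^ 2 := by nlinarith
    have e3 := sub_nonneg.2 hc
    positivity
  nlinarith

/-- Right of the unit circle, the modulus of `saddleBase` on a vertical line decreases with the
cosine of the angle. -/
theorem norm_saddleBase_le_of_pos (a : ℝ) (hl0 : 0 < l) (hl1 : l < 1) {s φ₁ φ₂ : ℝ}
    (hs0 : 0 ≤ s) (hc : Real.cos φ₂ ≤ Real.cos φ₁) :
    ‖saddleBase a l (s + φ₁ * Complex.I)‖ ≤ ‖saddleBase a l (s + φ₂ * Complex.I)‖ := by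
  refine le_of_sq_le_sq ?_ (norm_nonneg _)
  rw [norm_saddleBase_sq, norm_saddleBase_sq]
  refine mul_le_mul_of_nonneg_left ?_ (by positivity)
  have hr1 : 1 ≤ Real.exp s := Real.one_le_exp hs0
  have hr : l < Real.exp s := hl1.trans_le hr1
  set r := Real.exp s with hrd
  have hr0 : 0 < r := Real.exp_pos s
  rw [div_le_div_iff₀ (sq_add_sq_sub_pos hl0 hr (Real.cos_le_one _))
    (sq_add_sq_sub_pos hl0 hr (Real.cos_le_one _))]
  have h1 : 0 ≤ 2 * l * r * ((r ^ 2 - 1) * (1 - l ^ 2)) * (Real.cos φ₁ - Real.cos φ₂) := by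
    have e1 : 0 ≤ r ^ 2 - 1 := by nlinarith
    have e2 : 0 ≤ 1 - l ^ 2 := by nlinarith
    have e3 := sub_nonneg.2 hc
    positivity
  nlinarith

theorem norm_saddleBase_mul_I (a : ℝ) (hl0 : 0 < l) (hl1 : l < 1) (φ : ℝ) :
    ‖saddleBase a l (φ * Complex.I)‖ = 1 := by
  have h := norm_saddleBase_sq a l 0 φ
  have h2 := sq_add_sq_sub_pos hl0 hl1 (Real.cos_le_one φ)
  rw [Complex.ofReal_zero, zero_add] at h
  have h3 : ‖saddleBase a l (φ * Complex.I)‖ ^ 2 = 1 := by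
    rw [h]
    simp only [mul_zero, Real.exp_zero, one_pow, one_mul, mul_one] at h2 ⊢
    exact div_self h2.ne'
  exact (pow_eq_one_iff_of_nonneg (norm_nonneg _) two_ne_zero).1 h3

theorem norm_saddleBase_add_pi_mul_I (hl0 : 0 < l) (s : ℝ) :
    ‖saddleBase a l (s + Real.pi * Complex.I)‖ = cutBase a l s := by
  rw [saddleBase_add_pi_mul_I, norm_mul, show (a : ℂ) * Real.pi * Complex.I =
    ((a * Real.pi : ℝ) : ℂ) * Complex.I by push_cast; ring, Complex.norm_exp_ofReal_mul_I, one_mul,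
    Complex.norm_real, Real.norm_of_nonneg (cutBase_pos hl0 s).le]

theorem cutBase_zero (hl0 : 0 < l) : cutBase a l 0 = 1 := by
  simp only [cutBase, mul_zero, Real.exp_zero, mul_one, one_mul]
  exact div_self (by positivity)

theorem hasDerivAt_cutBase (hl0 : 0 < l) (s : ℝ) :
    HasDerivAt (cutBase a l) (cutBase a l s * (a + 1 + l * Real.exp s / (1 + l * Real.exp s) -
      Real.exp s / (Real.exp s + l))) s := by
  have hd : Real.exp s + l ≠ 0 := by positivity
  have hn : 1 + l * Real.exp s ≠ 0 := by positivity
  have h1 : HasDerivAt (fun s : ℝ => Real.exp ((a + 1) * s))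
      (Real.exp ((a + 1) * s) * ((a + 1) * 1)) s := ((hasDerivAt_id s).const_mul (a + 1)).exp
  have h2 : HasDerivAt (fun s : ℝ => 1 + l * Real.exp s) (l * Real.exp s) s :=
    ((Real.hasDerivAt_exp s).const_mul l).const_add 1
  have h3 : HasDerivAt (fun s : ℝ => Real.exp s + l) (Real.exp s) s :=
    (Real.hasDerivAt_exp s).add_const l
  refine ((h1.mul h2).div h3 hd).congr_deriv ?_
  simp only [cutBase, Pi.mul_apply]
  field_simp

/-- With $r=e^s$ the logarithmic derivative is $a+\tfrac{2l}{1+l}$ plus a positive multiple of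
$(1-r)^2$. It is therefore positive for $r<1$ even at the lower transition value itself. -/
theorem strictMonoOn_cutBase (hl0 : 0 < l) (hl1 : l < 1) (ha : -(2 * l / (1 + l)) ≤ a) :
    StrictMonoOn (cutBase a l) (Set.Iic 0) := by
  refine strictMonoOn_of_deriv_pos (convex_Iic 0) (continuous_cutBase hl0).continuousOn ?_
  intro s hs
  rw [interior_Iic] at hs
  rw [(hasDerivAt_cutBase hl0 s).deriv]
  refine mul_pos (cutBase_pos hl0 s) ?_
  have hr1 : Real.exp s < 1 := (Real.exp_lt_exp.2 hs).trans_eq Real.exp_zero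
  set r := Real.exp s with hr
  have hr0 : 0 < r := Real.exp_pos s
  have h1 : l * r / (1 + l * r) - r / (r + l) + 1 - 2 * l / (1 + l) =
      l * (1 - l) * (1 - r) ^ 2 / ((1 + l * r) * (r + l) * (1 + l)) := by
    field_simp
    ring
  have h2 : 0 < l * (1 - l) * (1 - r) ^ 2 / ((1 + l * r) * (r + l) * (1 + l)) := by
    have e1 : 0 < 1 - l := by linarith
    have e2 : 0 < 1 - r := by linarith
    positivity
  linarith

theorem saddleBase_zero (a : ℝ) (hl1 : l < 1) : saddleBase a l 0 = 1 := by
  simp only [saddleBase, mul_zero, Complex.exp_zero, mul_one, one_mul]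
  refine div_self ?_
  rw [sub_ne_zero]
  exact_mod_cast hl1.ne'

end modulus

/-! ### The exponent near a point of the strip, and bounds for increments and for the cut term. -/

noncomputable section

/-- The logarithmic derivative of `saddleBase`. -/
def saddleLogDeriv (a l : ℝ) (w : ℂ) : ℂ :=
  a + 1 - l * Complex.exp w / (1 - l * Complex.exp w) - Complex.exp w / (Complex.exp w - l)

/-- The derivative of `saddleLogDeriv`. -/
def saddleLogDeriv₂ (l : ℝ) (w : ℂ) : ℂ :=
  l * Complex.exp w / (Complex.exp w - l) ^ 2 - l * Complex.exp w / (1 - l * Complex.exp w) ^ 2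

/-- The second derivative of `saddleLogDeriv`. -/
def saddleLogDeriv₃ (l : ℝ) (w : ℂ) : ℂ :=
  -(l * Complex.exp w * (Complex.exp w + l)) / (Complex.exp w - l) ^ 3 -
    l * Complex.exp w * (1 + l * Complex.exp w) / (1 - l * Complex.exp w) ^ 3

end

section exponent

variable {a α β l : ℝ}

theorem hasDerivAt_saddleBase {w : ℂ} (h1 : 1 - (l : ℂ) * Complex.exp w ≠ 0)
    (h2 : Complex.exp w - (l : ℂ) ≠ 0) :
    HasDerivAt (saddleBase a l) (saddleBase a l w * saddleLogDeriv a l w) w := by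
  have e1 : HasDerivAt (fun w : ℂ => Complex.exp (((a : ℂ) + 1) * w))
      (Complex.exp ((a + 1) * w) * ((a + 1) * 1)) w :=
    ((hasDerivAt_id w).const_mul ((a : ℂ) + 1)).cexp
  have e2 : HasDerivAt (fun w : ℂ => 1 - (l : ℂ) * Complex.exp w) (-(l * Complex.exp w)) w :=
    ((Complex.hasDerivAt_exp w).const_mul (l : ℂ)).const_sub 1
  have e3 : HasDerivAt (fun w : ℂ => Complex.exp w - (l : ℂ)) (Complex.exp w) w :=
    (Complex.hasDerivAt_exp w).sub_const _
  refine ((e1.mul e2).div e3 h2).congr_deriv ?_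
  simp only [saddleBase, saddleLogDeriv, Pi.mul_apply]
  field_simp
  ring

theorem hasDerivAt_saddleLogDeriv {w : ℂ} (h1 : 1 - (l : ℂ) * Complex.exp w ≠ 0)
    (h2 : Complex.exp w - (l : ℂ) ≠ 0) :
    HasDerivAt (saddleLogDeriv a l) (saddleLogDeriv₂ l w) w := by
  have e0 := Complex.hasDerivAt_exp w
  have e1 : HasDerivAt (fun w : ℂ => (l : ℂ) * Complex.exp w) (l * Complex.exp w) w :=
    e0.const_mul (l : ℂ)
  have e2 : HasDerivAt (fun w : ℂ => 1 - (l : ℂ) * Complex.exp w) (-(l * Complex.exp w)) w :=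
    e1.const_sub 1
  have e3 : HasDerivAt (fun w : ℂ => Complex.exp w - (l : ℂ)) (Complex.exp w) w := e0.sub_const _
  refine (((e1.div e2 h1).const_sub ((a : ℂ) + 1)).sub (e0.div e3 h2)).congr_deriv ?_
  simp only [saddleLogDeriv₂]
  field_simp
  ring

theorem hasDerivAt_saddleLogDeriv₂ {w : ℂ} (h1 : 1 - (l : ℂ) * Complex.exp w ≠ 0)
    (h2 : Complex.exp w - (l : ℂ) ≠ 0) :
    HasDerivAt (saddleLogDeriv₂ l) (saddleLogDeriv₃ l w) w := by
  have e0 := Complex.hasDerivAt_exp w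
  have e1 : HasDerivAt (fun w : ℂ => (l : ℂ) * Complex.exp w) (l * Complex.exp w) w :=
    e0.const_mul (l : ℂ)
  have e2 : HasDerivAt (fun w : ℂ => 1 - (l : ℂ) * Complex.exp w) (-(l * Complex.exp w)) w :=
    e1.const_sub 1
  have e3 : HasDerivAt (fun w : ℂ => Complex.exp w - (l : ℂ)) (Complex.exp w) w := e0.sub_const _
  refine ((e1.div (e3.pow 2) (pow_ne_zero 2 h2)).sub
    (e1.div (e2.pow 2) (pow_ne_zero 2 h1))).congr_deriv ?_
  simp only [saddleLogDeriv₃, Pi.pow_apply]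
  field_simp
  push_cast
  ring

/-- Near any point of the strip, `saddleBase` is the exponential of an analytic function. -/
theorem exists_local_exponent (a : ℝ) (hl0 : 0 < l) {w₀ : ℂ} (hw₀ : |w₀.re| < -Real.log l) :
    ∃ F : ℂ → ℂ, AnalyticAt ℂ F w₀ ∧ F w₀ = 0 ∧ iteratedDeriv 1 F w₀ = saddleLogDeriv a l w₀ ∧
      iteratedDeriv 2 F w₀ = saddleLogDeriv₂ l w₀ ∧ iteratedDeriv 3 F w₀ = saddleLogDeriv₃ l w₀ ∧
      ∀ w : ℂ, |w.re| < -Real.log l →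
        saddleBase a l w = saddleBase a l w₀ * Complex.exp (F w) := by
  have hn1 : ∀ w : ℂ, |w.re| < -Real.log l → 1 - (l : ℂ) * Complex.exp w ≠ 0 := fun w hw =>
    one_sub_mul_exp_ne_zero hl0 (abs_lt.1 hw).2
  have hn2 : ∀ w : ℂ, |w.re| < -Real.log l → Complex.exp w - (l : ℂ) ≠ 0 := fun w hw =>
    exp_sub_ne_zero_of_abs_re hl0 hw
  have hS := isOpen_abs_re_lt (-Real.log l)
  -- Integrating the logarithmic derivative avoids choosing a branch of the logarithm: $G e^{-F}$
  -- has zero derivative on the convex strip, hence is constant.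
  obtain ⟨F, hF0, hF⟩ := exists_primitive_of_differentiableOn_strip
    (f := saddleLogDeriv a l) (r := -Real.log l) (fun w hw =>
      (hasDerivAt_saddleLogDeriv (hn1 w hw) (hn2 w hw)).differentiableAt.differentiableWithinAt) w₀
  have hd1 : ∀ w : ℂ, |w.re| < -Real.log l → iteratedDeriv 1 F w = saddleLogDeriv a l w := by
    intro w hw
    rw [iteratedDeriv_one]
    exact (hF w hw).deriv
  have hd2 : ∀ w : ℂ, |w.re| < -Real.log l → iteratedDeriv 2 F w = saddleLogDeriv₂ l w := by
    intro w hw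
    rw [iteratedDeriv_succ]
    have : iteratedDeriv 1 F =ᶠ[nhds w] saddleLogDeriv a l := by
      filter_upwards [hS.mem_nhds hw] with z hz using hd1 z hz
    rw [this.deriv_eq]
    exact (hasDerivAt_saddleLogDeriv (hn1 w hw) (hn2 w hw)).deriv
  have hd3 : ∀ w : ℂ, |w.re| < -Real.log l → iteratedDeriv 3 F w = saddleLogDeriv₃ l w := by
    intro w hw
    rw [iteratedDeriv_succ]
    have : iteratedDeriv 2 F =ᶠ[nhds w] saddleLogDeriv₂ l := by
      filter_upwards [hS.mem_nhds hw] with z hz using hd2 z hz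
    rw [this.deriv_eq]
    exact (hasDerivAt_saddleLogDeriv₂ (hn1 w hw) (hn2 w hw)).deriv
  refine ⟨F, ?_, hF0, hd1 w₀ hw₀, hd2 w₀ hw₀, hd3 w₀ hw₀, fun w hw => ?_⟩
  · exact DifferentiableOn.analyticAt (s := {w : ℂ | |w.re| < -Real.log l})
      (fun w hw => (hF w hw).differentiableAt.differentiableWithinAt) (hS.mem_nhds hw₀)
  · have hder : ∀ z ∈ {w : ℂ | |w.re| < -Real.log l},
        HasDerivWithinAt (fun z => saddleBase a l z * Complex.exp (-F z)) 0
          {w : ℂ | |w.re| < -Real.log l} z := by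
      intro z hz
      have h := (hasDerivAt_saddleBase (a := a) (hn1 z hz) (hn2 z hz)).mul (hF z hz).neg.cexp
      refine (h.congr_deriv ?_).hasDerivWithinAt
      simp only [Pi.neg_apply]
      ring
    have hconst := (convex_abs_re_lt (-Real.log l)).norm_image_sub_le_of_norm_hasDerivWithin_le
      (C := 0) hder (fun z _ => by simp) hw₀ hw
    rw [zero_mul, norm_le_zero_iff, sub_eq_zero, hF0] at hconst
    rw [neg_zero, Complex.exp_zero, mul_one] at hconst
    rw [← hconst, mul_assoc, ← Complex.exp_add, neg_add_cancel, Complex.exp_zero, mul_one]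

theorem analyticAt_saddleWeight (hl0 : 0 < l) {w₀ : ℂ} (hw₀ : |w₀.re| < -Real.log l) :
    AnalyticAt ℂ (saddleWeight α β l) w₀ :=
  DifferentiableOn.analyticAt (s := {w : ℂ | |w.re| < -Real.log l})
    (fun _ hw => (differentiableAt_saddleWeight hl0 (abs_lt.1 hw).2
      (exp_sub_ne_zero_of_abs_re hl0 hw)).differentiableWithinAt)
    ((isOpen_abs_re_lt _).mem_nhds hw₀)

/-- Increments along a vertical line of a primitive of the kernel. -/
theorem exists_vertical_increment_le (a α β : ℝ) (hl0 : 0 < l) {s : ℝ} (hs : |s| < -Real.log l) :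
    ∃ W : ℝ, 0 < W ∧ ∀ (n : ℕ) (Φ : ℂ → ℂ),
      (∀ w : ℂ, |w.re| < -Real.log l → HasDerivAt Φ (jacobiKernel a α β l n w) w) →
      ∀ φ₁ φ₂ : ℝ, 0 ≤ φ₁ → φ₁ ≤ φ₂ → φ₂ ≤ Real.pi → ∀ ρ : ℝ,
        (∀ φ ∈ Set.Icc φ₁ φ₂, ‖saddleBase a l (s + φ * Complex.I)‖ ≤ ρ) →
        ‖Φ (s + φ₂ * Complex.I) - Φ (s + φ₁ * Complex.I)‖ ≤ W * ρ ^ n := by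
  have hre : ∀ φ : ℝ, |((s : ℂ) + φ * Complex.I).re| < -Real.log l := fun φ => by simpa using hs
  have hcont : ContinuousOn (fun φ : ℝ => saddleWeight α β l (s + φ * Complex.I))
      (Set.Icc 0 Real.pi) := fun φ _ => by
    have h := (analyticAt_saddleWeight (α := α) (β := β) hl0 (hre φ)).continuousAt
    exact (ContinuousAt.comp (f := fun φ : ℝ => (s : ℂ) + φ * Complex.I) h
      (by fun_prop)).continuousWithinAt
  obtain ⟨W, hW⟩ := isCompact_Icc.exists_bound_of_continuousOn hcont
  have hW0 : 0 ≤ W := (norm_nonneg _).trans (hW 0 ⟨le_rfl, Real.pi_pos.le⟩)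
  refine ⟨(W + 1) * Real.pi, by positivity, fun n Φ hΦ φ₁ φ₂ h0 h12 hpi ρ hρ => ?_⟩
  have hρ0 : 0 ≤ ρ := (norm_nonneg _).trans (hρ φ₁ ⟨le_rfl, h12⟩)
  have hder : ∀ φ ∈ Set.Icc φ₁ φ₂, HasDerivWithinAt (fun φ : ℝ => Φ (s + φ * Complex.I))
      (jacobiKernel a α β l n (s + φ * Complex.I) * (1 * Complex.I)) (Set.Icc φ₁ φ₂) φ := by
    intro φ _
    have h1 : HasDerivAt (fun z : ℂ => (s : ℂ) + z * Complex.I) (1 * Complex.I) (φ : ℂ) :=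
      ((hasDerivAt_id _).mul_const _).const_add _
    exact (((hΦ _ (hre φ)).comp (φ : ℂ) h1).comp_ofReal).hasDerivWithinAt
  have hbd := (convex_Icc φ₁ φ₂).norm_image_sub_le_of_norm_hasDerivWithin_le
    (C := ρ ^ n * (W + 1)) hder (fun φ hφ => by
      rw [one_mul, norm_mul, Complex.norm_I, mul_one, jacobiKernel, norm_mul, norm_pow]
      refine mul_le_mul (pow_le_pow_left₀ (norm_nonneg _) (hρ φ hφ) n) ?_ (norm_nonneg _)
        (by positivity)
      exact (hW φ ⟨h0.trans hφ.1, hφ.2.trans hpi⟩).trans (by linarith))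
    (Set.left_mem_Icc.2 h12) (Set.right_mem_Icc.2 h12)
  refine hbd.trans ?_
  rw [Real.norm_of_nonneg (by linarith)]
  calc ρ ^ n * (W + 1) * (φ₂ - φ₁) ≤ ρ ^ n * (W + 1) * Real.pi :=
        mul_le_mul_of_nonneg_left (by linarith) (by positivity)
    _ = _ := by ring

theorem cutIntegral_nonneg (a α β : ℝ) (hl0 : 0 < l) (n : ℕ) (s : ℝ) :
    0 ≤ cutIntegral a α β l n s :=
  MeasureTheory.setIntegral_nonneg measurableSet_Iic fun t _ =>
    (mul_pos (pow_pos (cutBase_pos hl0 t) n) (cutWeight_pos hl0 t)).le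

/-- The $n$-th power is bounded pointwise by $\rho^n$, leaving the integral with $n=0$ as a constant
independent of $n$. -/
theorem cutIntegral_le (hα : -1 < α) (ha : -1 < a) (hl0 : 0 < l) {s ρ : ℝ}
    (hρ : ∀ t ≤ s, cutBase a l t ≤ ρ) (n : ℕ) :
    cutIntegral a α β l n s ≤ ρ ^ n * cutIntegral a α β l 0 s := by
  have h0 := integrableOn_cut (β := β) hα ha hl0 0 s
  simp only [pow_zero, one_mul] at h0
  simp only [cutIntegral, pow_zero, one_mul]
  rw [← MeasureTheory.integral_const_mul]
  refine MeasureTheory.setIntegral_mono_on (integrableOn_cut hα ha hl0 n s) (h0.const_mul _)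
    measurableSet_Iic fun t ht => ?_
  exact mul_le_mul_of_nonneg_right (pow_le_pow_left₀ (cutBase_pos hl0 t).le (hρ t ht) n)
    (cutWeight_pos hl0 t).le

end exponent

/-! ### The exponential ranges outside the two transition points. -/

theorem HasDerivAt.eventually_slope_pos {f : ℝ → ℝ} {f' x : ℝ} (h : HasDerivAt f f' x)
    (hf : 0 < f') : ∀ᶠ y in nhdsWithin x {x}ᶜ, 0 < (f y - f x) / (y - x) := by
  filter_upwards [h.tendsto_slope.eventually (lt_mem_nhds hf)] with y hy
  rwa [slope_def_field] at hy

theorem HasDerivAt.eventually_left_lt {f : ℝ → ℝ} {f' x : ℝ} (h : HasDerivAt f f' x)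
    (hf : 0 < f') : ∀ᶠ y in nhdsWithin x (Set.Iio x), f y < f x := by
  have hle : nhdsWithin x (Set.Iio x) ≤ nhdsWithin x {x}ᶜ :=
    nhdsWithin_mono x fun y hy => (Set.mem_Iio.1 hy).ne
  filter_upwards [hle (h.eventually_slope_pos hf), self_mem_nhdsWithin] with y hy hyx
  rcases div_pos_iff.1 hy with h1 | h1
  · linarith [Set.mem_Iio.1 hyx]
  · linarith

theorem HasDerivAt.eventually_right_gt {f : ℝ → ℝ} {f' x : ℝ} (h : HasDerivAt f f' x)
    (hf : 0 < f') : ∀ᶠ y in nhdsWithin x (Set.Ioi x), f x < f y := by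
  have hle : nhdsWithin x (Set.Ioi x) ≤ nhdsWithin x {x}ᶜ :=
    nhdsWithin_mono x fun y hy => (Set.mem_Ioi.1 hy).ne'
  filter_upwards [hle (h.eventually_slope_pos hf), self_mem_nhdsWithin] with y hy hyx
  rcases div_pos_iff.1 hy with h1 | h1
  · linarith
  · linarith [Set.mem_Ioi.1 hyx]

section

variable {a α β l : ℝ}

/-- This derivative changes sign precisely at the upper transition value. Above it, moving slightly
left from $0$ along the real axis brings the base below modulus $1$. -/
theorem hasDerivAt_re_saddleBase_zero (a : ℝ) (hl1 : l < 1) :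
    HasDerivAt (fun s : ℝ => (saddleBase a l s).re) (a - 2 * l / (1 - l)) 0 := by
  have h1l : (1 : ℂ) - l ≠ 0 := by
    rw [sub_ne_zero]
    exact_mod_cast hl1.ne'
  have h := hasDerivAt_saddleBase (a := a) (l := l) (w := 0) (by simpa using h1l)
    (by simpa using h1l)
  have h2 := Complex.reCLM.hasFDerivAt.comp_hasDerivAt (0 : ℝ)
    (HasDerivAt.comp_ofReal (z := (0 : ℝ)) (by simpa using h))
  refine h2.congr_deriv ?_
  have h1l' : (1 : ℝ) - l ≠ 0 := by linarith
  have : saddleBase a l 0 * saddleLogDeriv a l 0 = ((a - 2 * l / (1 - l) : ℝ) : ℂ) := by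
    rw [saddleBase_zero a hl1, saddleLogDeriv]
    push_cast
    simp only [Complex.exp_zero]
    field_simp
    ring
  simp only [this, Complex.reCLM_apply, Complex.ofReal_re]

theorem exists_norm_saddleBase_neg_lt_one (hl0 : 0 < l) (hl1 : l < 1)
    (ha : 2 * l / (1 - l) < a) :
    ∃ s : ℝ, s < 0 ∧ Real.log l < s ∧ ‖saddleBase a l (s : ℂ)‖ < 1 := by
  have hlog : Real.log l < 0 := Real.log_neg hl0 hl1
  have hd := hasDerivAt_re_saddleBase_zero a hl1
  have h1 := hd.eventually_left_lt (by linarith)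
  have h2 : ∀ᶠ s : ℝ in nhdsWithin (0 : ℝ) (Set.Iio 0), 0 < (saddleBase a l s).re := by
    have h0 : (0 : ℝ) < (saddleBase a l ((0 : ℝ) : ℂ)).re := by simp [saddleBase_zero a hl1]
    exact nhdsWithin_le_nhds (hd.continuousAt.eventually (lt_mem_nhds h0))
  have h3 : ∀ᶠ s in nhdsWithin (0 : ℝ) (Set.Iio 0), Real.log l < s :=
    nhdsWithin_le_nhds (lt_mem_nhds hlog)
  obtain ⟨s, hs1, hs2, hs3, hs0⟩ := (h1.and (h2.and (h3.and self_mem_nhdsWithin))).exists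
  refine ⟨s, hs0, hs3, ?_⟩
  have him : (saddleBase a l s).im = 0 := by
    have := saddleBase_conj (a := a) (l := l) (s : ℂ)
    rw [Complex.conj_ofReal] at this
    exact Complex.conj_eq_iff_im.1 this.symm
  have hre : saddleBase a l s = ((saddleBase a l s).re : ℂ) := Complex.ext rfl (by simpa using him)
  rw [hre, Complex.norm_real, Real.norm_of_nonneg hs2.le]
  simpa [saddleBase_zero a hl1] using hs1

/-- Exponential decay above the upper transition point. -/
theorem scaledJacobi_exp_decay_of_upper_lt (hα : -1 < α) (β : ℝ) (ha : -1 < a) (hl0 : 0 < l)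
    (hl1 : l < 1) (hal : 2 * l / (1 - l) < a) :
    ∃ C ρ : ℝ, 0 < C ∧ 0 < ρ ∧ ρ < 1 ∧ ∀ n : ℕ, |scaledJacobi a α β l n| ≤ C * ρ ^ n := by
  obtain ⟨s, hs0, hsl, hs1⟩ := exists_norm_saddleBase_neg_lt_one hl0 hl1 hal
  have hsL : |s| < -Real.log l := by rw [abs_of_neg hs0]; linarith
  obtain ⟨W, hW, hWb⟩ := exists_vertical_increment_le a α β hl0 hsL
  have hal' : -(2 * l / (1 + l)) ≤ a := by
    have h1 : 0 < 2 * l / (1 + l) := by positivity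
    have h2 : 0 < 2 * l / (1 - l) := div_pos (by linarith) (by linarith)
    linarith
  have hmono := strictMonoOn_cutBase hl0 hl1 hal'
  have hcut1 : cutBase a l s < 1 := by
    rw [← cutBase_zero (a := a) hl0]
    exact hmono hs0.le (Set.mem_Iic.2 le_rfl) hs0
  set ρ := max ‖saddleBase a l s‖ (cutBase a l s) with hρ
  have hρ0 : 0 < ρ := lt_max_of_lt_right (cutBase_pos hl0 s)
  have hK0 := cutIntegral_nonneg a α β hl0 0 s
  refine ⟨(W + cutIntegral a α β l 0 s) / Real.pi, ρ, by positivity, hρ0, max_lt hs1 hcut1,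
    fun n => ?_⟩
  obtain ⟨Φ, hΦ, hΦ0, hrep⟩ := exists_primitive_representation (β := β) hα ha hl0 hl1 n
  -- Left of the imaginary axis the maximum over a vertical line is attained at its real point,
  -- where the cosine is $1$.
  have h1 := hWb n Φ hΦ 0 Real.pi le_rfl Real.pi_pos.le le_rfl ρ (fun φ _ => by
    refine le_trans ?_ (le_max_left _ _)
    have := norm_saddleBase_le_of_neg a hl0 hl1 (φ₁ := φ) (φ₂ := 0) hsl hs0.le
      (by rw [Real.cos_zero]; exact Real.cos_le_one φ)
    simpa using this)
  have h2 : |(Φ (s + Real.pi * Complex.I)).im| ≤ W * ρ ^ n := by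
    have h3 := Complex.abs_im_le_norm (Φ (s + Real.pi * Complex.I) - Φ (s + (0 : ℝ) * Complex.I))
    have h4 : (Φ (s + (0 : ℝ) * Complex.I)).im = 0 := by simpa using hΦ0 s hsL
    rw [Complex.sub_im, h4, sub_zero] at h3
    exact h3.trans h1
  have h3 := cutIntegral_le (β := β) hα ha hl0 (s := s) (ρ := ρ) (fun t ht =>
    (hmono.monotoneOn (Set.mem_Iic.2 (ht.trans hs0.le)) hs0.le ht).trans (le_max_right _ _)) n
  have h4 := cutIntegral_nonneg a α β hl0 n s
  have h5 : |Real.sin (Real.pi * (a * n + α)) * cutIntegral a α β l n s| ≤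
      ρ ^ n * cutIntegral a α β l 0 s := by
    rw [abs_mul, abs_of_nonneg h4]
    exact (mul_le_of_le_one_left h4 (Real.abs_sin_le_one _)).trans h3
  have h6 : Real.pi * |scaledJacobi a α β l n| ≤ (W + cutIntegral a α β l 0 s) * ρ ^ n := by
    rw [show Real.pi * |scaledJacobi a α β l n| = |Real.pi * scaledJacobi a α β l n| by
      rw [abs_mul, abs_of_pos Real.pi_pos], hrep s hsL]
    refine (abs_sub _ _).trans ?_
    linarith
  rw [div_mul_eq_mul_div, le_div_iff₀ Real.pi_pos]
  linarith

theorem hasDerivAt_cutBase_zero (a : ℝ) (hl0 : 0 < l) :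
    HasDerivAt (cutBase a l) (a + 2 * l / (1 + l)) 0 := by
  refine (hasDerivAt_cutBase hl0 0).congr_deriv ?_
  rw [cutBase_zero hl0, Real.exp_zero]
  field_simp
  ring

/-- Below the lower transition point the scaled Jacobi polynomial agrees, up to an exponentially
small error, with the contribution of the branch cut, which grows exponentially. -/
theorem scaledJacobi_of_lt_lower (hα : -1 < α) (β : ℝ) (ha : -1 < a) (hl0 : 0 < l)
    (hl1 : l < 1) (hal : a < -(2 * l / (1 + l))) :
    ∃ (c C κ ρ : ℝ) (K : ℕ → ℝ), 0 < c ∧ 0 < C ∧ 1 < κ ∧ 0 < ρ ∧ ρ < 1 ∧ ∀ n : ℕ,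
      c * κ ^ n ≤ K n ∧
      |scaledJacobi a α β l n + Real.sin (Real.pi * (a * n + α)) * K n| ≤ C * ρ ^ n := by
  have hlog : Real.log l < 0 := Real.log_neg hl0 hl1
  have hd := (hasDerivAt_cutBase_zero a hl0).neg
  have hpos : 0 < -(a + 2 * l / (1 + l)) := by linarith
  have hsmall : ∀ᶠ s in nhdsWithin (0 : ℝ) (Set.Ioi 0), s < -Real.log l :=
    nhdsWithin_le_nhds (gt_mem_nhds (by linarith))
  -- The modulus on the cut now decreases through $1$ at $0$. A point $s>0$ with value below $1$
  -- carries the vertical contour, while $v<0$ with value above $1$ makes the cut integral grow.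
  obtain ⟨s, hs1, hsL', hs0⟩ := ((hd.eventually_right_gt hpos).and
    (hsmall.and self_mem_nhdsWithin)).exists
  obtain ⟨v, hv1, hv0⟩ := ((hd.eventually_left_lt hpos).and self_mem_nhdsWithin).exists
  have hs0 : 0 < s := hs0
  have hv0 : v < 0 := hv0
  simp only [Pi.neg_apply, cutBase_zero hl0, neg_lt_neg_iff] at hs1 hv1
  have hsL : |s| < -Real.log l := by rwa [abs_of_pos hs0]
  -- By continuity the value stays above this intermediate $\kappa$ on an interval $(u,v]$, which
  -- alone forces the growth rate $\kappa^n$.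
  obtain ⟨κ, hκ1, hκ2⟩ := exists_between hv1
  obtain ⟨δ, hδ, hball⟩ := Metric.eventually_nhds_iff.1
    ((continuous_cutBase (a := a) hl0).continuousAt.eventually (lt_mem_nhds hκ2))
  set u := v - δ / 2 with hu
  have huv : u < v := by rw [hu]; linarith
  have hlow : ∀ t ∈ Set.Ioc u v, κ ≤ cutBase a l t := fun t ht =>
    (hball (by rw [Real.dist_eq, abs_lt]; constructor <;> linarith [ht.1, ht.2])).le
  have hwc := continuous_cutWeight (α := α) (β := β) hl0
  set c := ∫ t in u..v, cutWeight α β l t with hc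
  have hcpos : 0 < c := intervalIntegral.intervalIntegral_pos_of_pos (hwc.intervalIntegrable _ _)
    (fun t => cutWeight_pos hl0 t) huv
  obtain ⟨W, hW, hWb⟩ := exists_vertical_increment_le a α β hl0 hsL
  have hpi := Real.pi_pos
  refine ⟨c / Real.pi, W / Real.pi, κ, cutBase a l s, fun n => cutIntegral a α β l n s / Real.pi,
    by positivity, by positivity, hκ1, cutBase_pos hl0 s, hs1, fun n => ⟨?_, ?_⟩⟩
  · rw [div_mul_eq_mul_div]
    refine div_le_div_of_nonneg_right ?_ hpi.le
    rw [hc, intervalIntegral.integral_of_le huv.le, mul_comm, ← MeasureTheory.integral_const_mul]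
    have hint := integrableOn_cut (β := β) hα ha hl0 n s
    have hsub : Set.Ioc u v ⊆ Set.Iic s := fun t ht => Set.mem_Iic.2 (by linarith [ht.2])
    refine (MeasureTheory.setIntegral_mono_on ?_ (hint.mono_set hsub) measurableSet_Ioc
      fun t ht => ?_).trans (MeasureTheory.setIntegral_mono_set hint
        (Eventually.of_forall fun t => ?_) hsub.eventuallyLE)
    · exact ((hwc.integrableOn_Icc).mono_set Set.Ioc_subset_Icc_self).const_mul _
    · exact mul_le_mul_of_nonneg_right (pow_le_pow_left₀ (by linarith) (hlow t ht) n)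
        (cutWeight_pos hl0 t).le
    · exact (mul_pos (pow_pos (cutBase_pos hl0 t) n) (cutWeight_pos hl0 t)).le
  · obtain ⟨Φ, hΦ, hΦ0, hrep⟩ := exists_primitive_representation (β := β) hα ha hl0 hl1 n
    have h1 := hWb n Φ hΦ 0 Real.pi le_rfl hpi.le le_rfl (cutBase a l s) (fun φ _ => by
      rw [← norm_saddleBase_add_pi_mul_I hl0]
      exact norm_saddleBase_le_of_pos a hl0 hl1 hs0.le
        (by rw [Real.cos_pi]; exact Real.neg_one_le_cos φ))
    have h3 := (Complex.abs_im_le_norm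
      (Φ (s + Real.pi * Complex.I) - Φ (s + (0 : ℝ) * Complex.I))).trans h1
    have h4 : (Φ (s + (0 : ℝ) * Complex.I)).im = 0 := by simpa using hΦ0 s hsL
    rw [Complex.sub_im, h4, sub_zero] at h3
    have h5 : scaledJacobi a α β l n + Real.sin (Real.pi * (a * n + α)) *
        (cutIntegral a α β l n s / Real.pi) = (Φ (s + Real.pi * Complex.I)).im / Real.pi := by
      field_simp
      linarith [hrep s hsL]
    rw [h5, abs_div, abs_of_pos hpi, div_mul_eq_mul_div]
    exact div_le_div_of_nonneg_right h3 hpi.le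

/-- Reduce to the nearest integer, where $|x|\le 1/2$, and apply Jordan's inequality. -/
theorem two_mul_le_abs_sin_pi_mul {x d : ℝ} (h : ∀ m : ℤ, d ≤ |x - m|) :
    2 * d ≤ |Real.sin (Real.pi * x)| := by
  have h1 := h (round x)
  have h2 := abs_sub_round x
  have h3 : |Real.sin (Real.pi * x)| = |Real.sin (Real.pi * (x - round x))| := by
    rw [show Real.pi * (x - round x) = Real.pi * x - (round x : ℤ) * Real.pi by ring,
      Real.sin_sub_int_mul_pi, abs_mul, abs_neg_one_zpow, one_mul]
  have h4 := Real.mul_abs_le_abs_sin (x := Real.pi * (x - round x)) (by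
    rw [abs_mul, abs_of_pos Real.pi_pos]
    nlinarith [Real.pi_pos])
  rw [h3]
  refine le_trans ?_ h4
  rw [abs_mul, abs_of_pos Real.pi_pos]
  have : 2 / Real.pi * (Real.pi * |x - round x|) = 2 * |x - round x| := by
    field_simp
  rw [this]
  linarith

theorem scaledJacobi_growth (hα : -1 < α) (β : ℝ) (ha : -1 < a) (hl0 : 0 < l)
    (hl1 : l < 1) (hal : a < -(2 * l / (1 + l))) :
    (∃ C ρ : ℝ, 0 < C ∧ 0 < ρ ∧ ρ < 1 ∧
      ∀ n : ℕ, (∃ m : ℤ, a * n + α = m) → |scaledJacobi a α β l n| ≤ C * ρ ^ n) ∧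
    (∃ c C κ ρ : ℝ, 0 < c ∧ 0 < C ∧ 1 < κ ∧ 0 < ρ ∧ ρ < 1 ∧
      ∀ n : ℕ, c * κ ^ n * |Real.sin (Real.pi * (a * n + α))| - C * ρ ^ n
        ≤ |scaledJacobi a α β l n|) ∧
    (∃ σ κ : ℝ, 0 < σ ∧ σ < 1 ∧ 1 < κ ∧
      ∀ᶠ n : ℕ in atTop, (∀ m : ℤ, σ ^ n ≤ |a * n + α - m|) →
        κ ^ n ≤ |scaledJacobi a α β l n|) := by
  obtain ⟨c, C, κ, ρ, K, hc, hC, hκ, hρ0, hρ1, hK⟩ := scaledJacobi_of_lt_lower hα β ha hl0 hl1 hal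
  have hlow : ∀ n : ℕ, c * κ ^ n * |Real.sin (Real.pi * (a * n + α))| - C * ρ ^ n
      ≤ |scaledJacobi a α β l n| := by
    intro n
    obtain ⟨h1, h2⟩ := hK n
    have hK0 : 0 ≤ K n := le_trans (by positivity) h1
    have h3 := abs_sub_abs_le_abs_sub (Real.sin (Real.pi * (a * n + α)) * K n)
      (-scaledJacobi a α β l n)
    rw [abs_mul, abs_of_nonneg hK0, abs_neg, sub_neg_eq_add,
      add_comm (_ * K n)] at h3
    have h4 := mul_le_mul_of_nonneg_right h1 (abs_nonneg (Real.sin (Real.pi * (a * n + α))))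
    linarith
  refine ⟨⟨C, ρ, hC, hρ0, hρ1, fun n ⟨m, hm⟩ => ?_⟩,
    ⟨c, C, κ, ρ, hc, hC, hκ, hρ0, hρ1, hlow⟩, ?_⟩
  · have h1 := (hK n).2
    rwa [hm, mul_comm Real.pi, Real.sin_int_mul_pi, zero_mul, add_zero] at h1
  -- With $\sigma=\tau^{-1}$ and $\kappa=\tau^3$, the main term is at least $2c\tau^{2n}$. For large
  -- $n$ one half of it dominates $\tau^n$ and the other half dominates $C$.
  · set τ := κ ^ (1 / 3 : ℝ) with hτ
    have hτ1 : 1 < τ := Real.one_lt_rpow hκ (by norm_num)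
    have hτ3 : τ ^ 3 = κ := by
      rw [hτ, ← Real.rpow_natCast, ← Real.rpow_mul (by linarith)]
      norm_num
    have hτ0 : 0 < τ := by linarith
    refine ⟨τ⁻¹, τ, by positivity, inv_lt_one_of_one_lt₀ hτ1, hτ1, ?_⟩
    filter_upwards [(tendsto_pow_atTop_atTop_of_one_lt hτ1).eventually_ge_atTop (1 / c),
      (tendsto_pow_atTop_atTop_of_one_lt hτ1).eventually_ge_atTop (C / c),
      (tendsto_pow_atTop_atTop_of_one_lt hτ1).eventually_ge_atTop 1] with n h1 h2 h3 hdist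
    refine le_trans ?_ (hlow n)
    have h4 := two_mul_le_abs_sin_pi_mul hdist
    have h5 : c * κ ^ n * (2 * τ⁻¹ ^ n) = 2 * c * (τ ^ n * τ ^ n) := by
      rw [← hτ3, ← pow_mul, mul_comm 3 n, pow_mul, inv_pow]
      field_simp
    have h6 := mul_le_mul_of_nonneg_left h4 (by positivity : 0 ≤ c * κ ^ n)
    rw [h5] at h6
    have h7 : C * ρ ^ n ≤ C := mul_le_of_le_one_right hC.le (pow_le_one₀ hρ0.le hρ1.le)
    rw [div_le_iff₀ hc] at h1 h2
    have h8 : 1 * (τ ^ n) ≤ τ ^ n * c * τ ^ n := mul_le_mul_of_nonneg_right h1 (by positivity)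
    have h9 : C * 1 ≤ τ ^ n * c * τ ^ n := mul_le_mul h2 h3 zero_le_one (by positivity)
    linarith

end

/-! ### Saddle contributions to increments of the primitive, and return to the unscaled polynomial.
-/

section

variable {a α β l : ℝ}

theorem exists_segment_in_strip {w₀ d : ℂ} {L : ℝ} (hw₀ : |w₀.re| < L) (hd : ‖d‖ = 1) :
    ∃ δ : ℝ, 0 < δ ∧ ∀ t : ℝ, |t| ≤ δ → |(w₀ + t * d).re| < L := by
  refine ⟨(L - |w₀.re|) / 2, by linarith, fun t ht => ?_⟩
  have h1 : |(t * d : ℂ).re| ≤ |t| := by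
    refine (Complex.abs_re_le_norm _).trans (le_of_eq ?_)
    rw [norm_mul, hd, mul_one, Complex.norm_real, Real.norm_eq_abs]
  rw [Complex.add_re]
  linarith [abs_add_le w₀.re (t * d : ℂ).re]

theorem primitive_sub_eq_integral {f Φ : ℂ → ℂ} {w₀ d : ℂ} {L u v : ℝ} (huv : u ≤ v)
    (hf : DifferentiableOn ℂ f {w : ℂ | |w.re| < L})
    (hΦ : ∀ w : ℂ, |w.re| < L → HasDerivAt Φ (f w) w)
    (hs : ∀ t ∈ Set.Icc u v, |(w₀ + t * d).re| < L) :
    Φ (w₀ + v * d) - Φ (w₀ + u * d) = d * ∫ t in u..v, f (w₀ + t * d) := by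
  have hline : ∀ t ∈ Set.uIcc u v, HasDerivAt (fun t : ℝ => Φ (w₀ + t * d))
      (f (w₀ + t * d) * (1 * d)) t := by
    intro t ht
    rw [Set.uIcc_of_le huv] at ht
    have h1 : HasDerivAt (fun z : ℂ => w₀ + z * d) (1 * d) (t : ℂ) :=
      ((hasDerivAt_id _).mul_const _).const_add _
    exact ((hΦ _ (hs t ht)).comp (t : ℂ) h1).comp_ofReal
  have hcont : ContinuousOn (fun t : ℝ => f (w₀ + t * d) * (1 * d)) (Set.uIcc u v) := by
    refine ContinuousOn.mul (fun t ht => ?_) continuousOn_const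
    rw [Set.uIcc_of_le huv] at ht
    have h := (hf.differentiableAt ((isOpen_abs_re_lt L).mem_nhds (hs t ht))).continuousAt
    exact (ContinuousAt.comp (f := fun t : ℝ => w₀ + t * d) h (by fun_prop)).continuousWithinAt
  rw [← intervalIntegral.integral_eq_sub_of_hasDerivAt hline hcont.intervalIntegrable, one_mul,
    intervalIntegral.integral_mul_const, mul_comm]

theorem differentiableOn_jacobiKernel (a α β : ℝ) (hl0 : 0 < l) (n : ℕ) :
    DifferentiableOn ℂ (jacobiKernel a α β l n) {w : ℂ | |w.re| < -Real.log l} :=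
  fun _ hw => (differentiableAt_jacobiKernel n hl0 (abs_lt.1 hw).2
    (exp_sub_ne_zero_of_abs_re hl0 hw)).differentiableWithinAt

theorem norm_saddleBase_lt_one_of_exponent {w₀ w x : ℂ} (h : saddleBase a l w =
    saddleBase a l w₀ * Complex.exp x) (h1 : ‖saddleBase a l w₀‖ = 1) (hx : x.re < 0) :
    ‖saddleBase a l w‖ < 1 := by
  rw [h, norm_mul, h1, one_mul, Complex.norm_exp]
  exact (Real.exp_lt_exp.2 hx).trans_eq Real.exp_zero

/-- Increment of a primitive of the kernel along a descent ray from a double saddle point. -/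
theorem exists_kernel_cubic_ray (a α β : ℝ) (hl0 : 0 < l) {w₀ d : ℂ} {κ : ℝ}
    (hw₀ : |w₀.re| < -Real.log l) (hd : ‖d‖ = 1) (hκ : 0 < κ) (hb : ‖saddleBase a l w₀‖ = 1)
    (h1 : saddleLogDeriv a l w₀ = 0) (h2 : saddleLogDeriv₂ l w₀ = 0)
    (h3 : saddleLogDeriv₃ l w₀ / 6 * d ^ 3 = -κ) :
    ∃ δ₀ : ℝ, 0 < δ₀ ∧ ∀ δ : ℝ, 0 < δ → δ ≤ δ₀ →
      |(w₀ + δ * d).re| < -Real.log l ∧ ‖saddleBase a l (w₀ + δ * d)‖ < 1 ∧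
      ∃ C : ℝ, ∀ n : ℕ, 1 ≤ n → ∀ Φ : ℂ → ℂ,
        (∀ w : ℂ, |w.re| < -Real.log l → HasDerivAt Φ (jacobiKernel a α β l n w) w) →
        ‖Φ (w₀ + δ * d) - Φ w₀ - d * (jacobiKernel a α β l n w₀ *
          (((κ * n) ^ (-1 / 3 : ℝ) * Real.Gamma (1 / 3 + 1) : ℝ) : ℂ))‖ ≤
          C * (n : ℝ) ^ (-2 / 3 : ℝ) := by
  obtain ⟨F, hFa, hF0, hF1, hF2, hF3, hF⟩ := exists_local_exponent a hl0 hw₀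
  obtain ⟨δ₁, hδ₁, hs⟩ := exists_cubic_saddle_ray hFa (analyticAt_saddleWeight (α := α) (β := β)
    hl0 hw₀) hd hκ hF0 (hF1.trans h1) (hF2.trans h2) (by rw [hF3, h3])
  obtain ⟨δ₂, hδ₂, hstrip⟩ := exists_segment_in_strip hw₀ hd
  refine ⟨min δ₁ δ₂, lt_min hδ₁ hδ₂, fun δ hδ hle => ?_⟩
  obtain ⟨hre, C, hC⟩ := hs δ hδ (hle.trans (min_le_left _ _))
  have hin : ∀ t ∈ Set.Icc 0 δ, |(w₀ + t * d).re| < -Real.log l := fun t ht =>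
    hstrip t (by rw [abs_of_nonneg ht.1]; exact ht.2.trans (hle.trans (min_le_right _ _)))
  have hδin := hin δ (Set.right_mem_Icc.2 hδ.le)
  refine ⟨hδin, norm_saddleBase_lt_one_of_exponent (hF _ hδin) hb ?_, C, fun n hn Φ hΦ => ?_⟩
  · have h4 : 0 < κ / 2 * δ ^ 3 := by positivity
    linarith [hre δ (Set.right_mem_Icc.2 hδ.le)]
  · have h5 := primitive_sub_eq_integral hδ.le (differentiableOn_jacobiKernel a α β hl0 n) hΦ hin
    rw [Complex.ofReal_zero, zero_mul, add_zero] at h5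
    have h6 : ∫ t in (0 : ℝ)..δ, jacobiKernel a α β l n (w₀ + t * d) = saddleBase a l w₀ ^ n *
        ∫ t in (0 : ℝ)..δ, Complex.exp (n * F (w₀ + t * d)) * saddleWeight α β l (w₀ + t * d) := by
      rw [← intervalIntegral.integral_const_mul]
      refine intervalIntegral.integral_congr fun t ht => ?_
      rw [Set.uIcc_of_le hδ.le] at ht
      simp only [jacobiKernel]
      rw [hF _ (hin t ht), mul_pow, ← Complex.exp_nat_mul, mul_assoc]
    rw [h5, h6, jacobiKernel, ← mul_sub, mul_assoc (saddleBase a l w₀ ^ n), ← mul_sub, norm_mul, hd,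
      one_mul, norm_mul, norm_pow, hb, one_pow, one_mul]
    exact hC n hn

/-- Increment of a primitive of the kernel along a segment of steepest descent through a simple
saddle point. -/
theorem exists_kernel_quadratic_segment (a α β : ℝ) (hl0 : 0 < l) {w₀ d : ℂ} {κ : ℝ}
    (hw₀ : |w₀.re| < -Real.log l) (hd : ‖d‖ = 1) (hκ : 0 < κ) (hb : ‖saddleBase a l w₀‖ = 1)
    (h1 : saddleLogDeriv a l w₀ = 0) (h2 : saddleLogDeriv₂ l w₀ / 2 * d ^ 2 = -κ) :
    ∃ δ₀ : ℝ, 0 < δ₀ ∧ ∀ δ : ℝ, 0 < δ → δ ≤ δ₀ →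
      (|(w₀ + δ * d).re| < -Real.log l ∧ |(w₀ + (-δ : ℝ) * d).re| < -Real.log l) ∧
      (‖saddleBase a l (w₀ + δ * d)‖ < 1 ∧ ‖saddleBase a l (w₀ + (-δ : ℝ) * d)‖ < 1) ∧
      ∃ C : ℝ, ∀ n : ℕ, 1 ≤ n → ∀ Φ : ℂ → ℂ,
        (∀ w : ℂ, |w.re| < -Real.log l → HasDerivAt Φ (jacobiKernel a α β l n w) w) →
        ‖Φ (w₀ + δ * d) - Φ (w₀ + (-δ : ℝ) * d) - d * (jacobiKernel a α β l n w₀ *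
          (Real.sqrt (Real.pi / (κ * n)) : ℂ))‖ ≤ C * (n : ℝ) ^ (-3 / 2 : ℝ) := by
  obtain ⟨F, hFa, hF0, hF1, hF2, -, hF⟩ := exists_local_exponent a hl0 hw₀
  obtain ⟨δ₁, hδ₁, hs⟩ := exists_quadratic_saddle_segment hFa (analyticAt_saddleWeight (α := α)
    (β := β) hl0 hw₀) hd hκ hF0 (hF1.trans h1) (by rw [hF2, h2])
  obtain ⟨δ₂, hδ₂, hstrip⟩ := exists_segment_in_strip hw₀ hd
  refine ⟨min δ₁ δ₂, lt_min hδ₁ hδ₂, fun δ hδ hle => ?_⟩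
  obtain ⟨hre, C, hC⟩ := hs δ hδ (hle.trans (min_le_left _ _))
  have hδδ : -δ ≤ δ := by linarith
  have hin : ∀ t ∈ Set.Icc (-δ) δ, |(w₀ + t * d).re| < -Real.log l := fun t ht =>
    hstrip t ((abs_le.2 ht).trans (hle.trans (min_le_right _ _)))
  have hr := Set.right_mem_Icc.2 hδδ
  have hl := Set.left_mem_Icc.2 hδδ
  have h4 : 0 < κ / 2 * δ ^ 2 := by positivity
  refine ⟨⟨hin δ hr, hin _ hl⟩, ⟨norm_saddleBase_lt_one_of_exponent (hF _ (hin δ hr)) hb ?_,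
    norm_saddleBase_lt_one_of_exponent (hF _ (hin _ hl)) hb ?_⟩, C, fun n hn Φ hΦ => ?_⟩
  · linarith [hre δ hr]
  · have := hre _ hl
    rw [neg_sq] at this
    linarith
  · have h5 := primitive_sub_eq_integral hδδ (differentiableOn_jacobiKernel a α β hl0 n) hΦ hin
    have h6 : ∫ t in (-δ)..δ, jacobiKernel a α β l n (w₀ + t * d) = saddleBase a l w₀ ^ n *
        ∫ t in (-δ)..δ, Complex.exp (n * F (w₀ + t * d)) * saddleWeight α β l (w₀ + t * d) := by
      rw [← intervalIntegral.integral_const_mul]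
      refine intervalIntegral.integral_congr fun t ht => ?_
      rw [Set.uIcc_of_le hδδ] at ht
      simp only [jacobiKernel]
      rw [hF _ (hin t ht), mul_pow, ← Complex.exp_nat_mul, mul_assoc]
    rw [h5, h6, jacobiKernel, ← mul_sub, mul_assoc (saddleBase a l w₀ ^ n), ← mul_sub, norm_mul, hd,
      one_mul, norm_mul, norm_pow, hb, one_pow, one_mul]
    exact hC n hn

/-- Exponentially small terms need only be compared with $n^{-2/3}$ and $n^{-3/2}$, so boundedness
of $n^2\rho^n$ is enough. -/
theorem exists_pow_le_mul_rpow {ρ p : ℝ} (hρ0 : 0 ≤ ρ) (hρ1 : ρ < 1) (hp : p ≤ 2) :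
    ∃ C : ℝ, 0 ≤ C ∧ ∀ n : ℕ, 1 ≤ n → ρ ^ n ≤ C * (n : ℝ) ^ (-p) := by
  have h := tendsto_pow_const_mul_const_pow_of_abs_lt_one 2 (r := ρ) (by rwa [abs_of_nonneg hρ0])
  obtain ⟨C, hC⟩ := h.bddAbove_range
  have hC' : ∀ n : ℕ, (n : ℝ) ^ 2 * ρ ^ n ≤ C := fun n => hC ⟨n, rfl⟩
  have hC0 : 0 ≤ C := by simpa using hC' 0
  refine ⟨C, hC0, fun n hn => ?_⟩
  have hn0 : (0 : ℝ) < n := by exact_mod_cast hn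
  have hn1 : (1 : ℝ) ≤ n := by exact_mod_cast hn
  have h1 : (n : ℝ) ^ (-2 : ℝ) ≤ (n : ℝ) ^ (-p) :=
    Real.rpow_le_rpow_of_exponent_le hn1 (by linarith)
  refine le_trans ?_ (mul_le_mul_of_nonneg_left h1 hC0)
  rw [Real.rpow_neg hn0.le, ← div_eq_mul_inv, le_div_iff₀ (by positivity)]
  have := hC' n
  norm_cast at this ⊢
  linarith

/-- The branch cut contribution is exponentially small left of the unit circle. -/
theorem exists_cutIntegral_le (hα : -1 < α) (β : ℝ) (ha : -1 < a) (hl0 : 0 < l) (hl1 : l < 1)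
    (hal : -(2 * l / (1 + l)) ≤ a) {s p : ℝ} (hs : s < 0) (hp : p ≤ 2) :
    ∃ C : ℝ, ∀ n : ℕ, 1 ≤ n → ∀ x : ℝ,
      |Real.sin x * cutIntegral a α β l n s| ≤ C * (n : ℝ) ^ (-p) := by
  have hmono := strictMonoOn_cutBase hl0 hl1 hal
  have hcut1 : cutBase a l s < 1 := by
    rw [← cutBase_zero (a := a) hl0]
    exact hmono hs.le (Set.mem_Iic.2 le_rfl) hs
  obtain ⟨C, hC0, hC⟩ := exists_pow_le_mul_rpow (cutBase_pos hl0 s).le hcut1 hp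
  refine ⟨C * cutIntegral a α β l 0 s, fun n hn x => ?_⟩
  have h3 := cutIntegral_le (β := β) hα ha hl0 (s := s) (fun t ht =>
    hmono.monotoneOn (Set.mem_Iic.2 (ht.trans hs.le)) hs.le ht) n
  have h4 := cutIntegral_nonneg a α β hl0 n s
  have h5 := mul_le_mul_of_nonneg_right (hC n hn) (cutIntegral_nonneg a α β hl0 0 s)
  rw [abs_mul, abs_of_nonneg h4]
  have h6 := mul_le_of_le_one_left h4 (Real.abs_sin_le_one x)
  linarith

/-- Vertical increments of a primitive of the kernel are exponentially small on segments where
`saddleBase` is bounded away from the unit circle. -/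
theorem exists_vertical_increment_le_rpow (a α β : ℝ) (hl0 : 0 < l) {s ρ p : ℝ}
    (hs : |s| < -Real.log l) (hρ0 : 0 ≤ ρ) (hρ1 : ρ < 1) (hp : p ≤ 2) :
    ∃ C : ℝ, ∀ n : ℕ, 1 ≤ n → ∀ Φ : ℂ → ℂ,
      (∀ w : ℂ, |w.re| < -Real.log l → HasDerivAt Φ (jacobiKernel a α β l n w) w) →
      ∀ φ₁ φ₂ : ℝ, 0 ≤ φ₁ → φ₁ ≤ φ₂ → φ₂ ≤ Real.pi →
        (∀ φ ∈ Set.Icc φ₁ φ₂, ‖saddleBase a l (s + φ * Complex.I)‖ ≤ ρ) →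
        |(Φ (s + φ₂ * Complex.I)).im - (Φ (s + φ₁ * Complex.I)).im| ≤ C * (n : ℝ) ^ (-p) := by
  obtain ⟨W, hW, hWb⟩ := exists_vertical_increment_le a α β hl0 hs
  obtain ⟨C, hC0, hC⟩ := exists_pow_le_mul_rpow hρ0 hρ1 hp
  refine ⟨W * C, fun n hn Φ hΦ φ₁ φ₂ h0 h12 hpi hb => ?_⟩
  rw [← Complex.sub_im]
  refine (Complex.abs_im_le_norm _).trans ((hWb n Φ hΦ φ₁ φ₂ h0 h12 hpi ρ hb).trans ?_)
  rw [mul_assoc]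
  exact mul_le_mul_of_nonneg_left (hC n hn) hW.le

theorem varJacobi_eq (a α β : ℝ) (hl0 : 0 < l) (hl1 : l < 1) (n : ℕ) :
    varJacobi a α β l n =
      l ^ (-(a * n + α)) * (1 - l ^ 2) ^ (-β) * scaledJacobi a α β l n := by
  have hr : 0 < 1 - l ^ 2 := by nlinarith
  rw [scaledJacobi, Real.rpow_neg hl0.le, Real.rpow_neg hr.le]
  have h1 := (Real.rpow_pos_of_pos hl0 (a * n + α)).ne'
  have h2 := (Real.rpow_pos_of_pos hr β).ne'
  field_simp

/-- Transfer of an asymptotic estimate from the scaled to the unscaled Jacobi polynomial. -/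
theorem varJacobi_sub_isBigO {T lead err : ℕ → ℝ} {C c p : ℝ} (hl0 : 0 < l) (hl1 : l < 1)
    (hc : 0 < c) (hT : ∀ n : ℕ, 1 ≤ n → |scaledJacobi a α β l n - T n| ≤ C * (n : ℝ) ^ (-p))
    (hlead : ∀ n : ℕ, 1 ≤ n → lead n = l ^ (-(a * n + α)) * (1 - l ^ 2) ^ (-β) * T n)
    (herr : ∀ n : ℕ, 1 ≤ n →
      err n = l ^ (-(a * n + α)) * (1 - l ^ 2) ^ (-β) * (c * (n : ℝ) ^ (-p))) :
    (fun n : ℕ => varJacobi a α β l n - lead n) =O[atTop] err := by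
  have hr : 0 < 1 - l ^ 2 := by nlinarith
  refine IsBigO.of_bound (C / c) ?_
  filter_upwards [eventually_ge_atTop 1] with n hn
  have hpos : 0 < l ^ (-(a * n + α)) * (1 - l ^ 2) ^ (-β) :=
    mul_pos (Real.rpow_pos_of_pos hl0 _) (Real.rpow_pos_of_pos hr _)
  have hn0 : (0 : ℝ) < n := by exact_mod_cast hn
  have hnp := Real.rpow_pos_of_pos hn0 (-p)
  have hposr : 0 ≤ l ^ (-(a * n + α)) * (1 - l ^ 2) ^ (-β) * (c * (n : ℝ) ^ (-p)) :=
    mul_nonneg hpos.le (mul_pos hc hnp).le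
  rw [varJacobi_eq a α β hl0 hl1, hlead n hn, herr n hn, ← mul_sub, norm_mul,
    Real.norm_of_nonneg hpos.le, Real.norm_of_nonneg hposr, Real.norm_eq_abs]
  refine (mul_le_mul_of_nonneg_left (hT n hn) hpos.le).trans (le_of_eq ?_)
  field_simp

end

/-! ### The upper transition point. -/

section

variable {a α β l : ℝ}

/-- The scaled Jacobi polynomial at the upper transition point. -/
theorem scaledJacobi_upper_transition (hα : -1 < α) (β : ℝ) (ha : -1 < a) (hl0 : 0 < l)
    (hl1 : l < 1) (hal : a = 2 * l / (1 - l)) :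
    ∃ C : ℝ, ∀ n : ℕ, 1 ≤ n →
      |scaledJacobi a α β l n - Real.sqrt 3 / 2 * (1 - l) ^ (β - 1) / Real.pi *
        ((l * (1 + l) / (3 * (1 - l) ^ 3) * n) ^ (-1 / 3 : ℝ) * Real.Gamma (1 / 3 + 1))| ≤
        C * (n : ℝ) ^ (-(2 / 3) : ℝ) := by
  have h1l : 0 < 1 - l := by linarith
  have h1lc : (1 : ℂ) - l ≠ 0 := by exact_mod_cast h1l.ne'
  have hlog : Real.log l < 0 := Real.log_neg hl0 hl1
  have hpi := Real.pi_pos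
  set κ := l * (1 + l) / (3 * (1 - l) ^ 3) with hκ
  have hκ0 : 0 < κ := by positivity
  -- The cubic coefficient at the double saddle $0$ is $-\kappa$, so descent rays are the cube roots
  -- of unity. This one, $e^{2\pi i/3}$, leads into the upper half plane left of the imaginary axis.
  set d : ℂ := ⟨-1 / 2, Real.sqrt 3 / 2⟩ with hd
  have h3 : Real.sqrt 3 ^ 2 = 3 := Real.sq_sqrt (by norm_num)
  have hd3 : d ^ 3 = 1 := by
    apply Complex.ext <;> simp only [hd, pow_succ, pow_zero, one_mul, Complex.mul_re,
      Complex.mul_im, Complex.one_re, Complex.one_im]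
    · linear_combination (3 / 8) * h3
    · linear_combination (-Real.sqrt 3 / 8) * h3
  have hd1 : ‖d‖ = 1 := by
    have : ‖d‖ ^ 3 = 1 := by rw [← norm_pow, hd3, norm_one]
    exact (pow_eq_one_iff_of_nonneg (norm_nonneg _) (by norm_num)).1 this
  have hw0 : |(0 : ℂ).re| < -Real.log l := by simpa using hlog
  obtain ⟨δ₀, hδ₀, hray⟩ := exists_kernel_cubic_ray a α β hl0 (w₀ := 0) (d := d) (κ := κ) hw0 hd1
    hκ0 (by rw [saddleBase_zero a hl1, norm_one])
    (by
      simp only [saddleLogDeriv, Complex.exp_zero, mul_one]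
      rw [hal]
      push_cast
      field_simp
      ring)
    (by
      simp only [saddleLogDeriv₂, Complex.exp_zero, mul_one, sub_self])
    (by
      simp only [saddleLogDeriv₃, Complex.exp_zero, mul_one, hd3, hκ]
      push_cast
      field_simp
      ring)
  -- The cap at $1$ keeps the end of the ray below $\operatorname{Im}w=\pi$.
  obtain ⟨hin, hb1, C, hC⟩ := hray (min δ₀ 1) (lt_min hδ₀ one_pos) (min_le_left _ _)
  set δ := min δ₀ 1 with hδ
  have hδ0 : 0 < δ := lt_min hδ₀ one_pos
  have hδ1 : δ ≤ 1 := min_le_right _ _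
  set s := -(δ / 2) with hs
  set φ := δ * (Real.sqrt 3 / 2) with hφ
  have hs3 : Real.sqrt 3 ≤ 2 := by
    rw [Real.sqrt_le_left (by norm_num)]
    norm_num
  have hs0 : s < 0 := by rw [hs]; linarith
  have hφ0 : 0 ≤ φ := by positivity
  have hφpi : φ ≤ Real.pi := by
    have : δ * (Real.sqrt 3 / 2) ≤ 1 * 1 := mul_le_mul hδ1 (by linarith) (by positivity) one_pos.le
    linarith [Real.pi_gt_three]
  have hcorner : (0 : ℂ) + δ * d = s + φ * Complex.I := by
    rw [zero_add, hs, hφ]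
    apply Complex.ext <;> simp [hd]
    ring
  rw [hcorner] at hin hb1 hC
  have hsL : |s| < -Real.log l := by simpa using hin
  obtain ⟨C₂, hC₂⟩ := exists_vertical_increment_le_rpow a α β hl0 (p := 2 / 3) hsL (norm_nonneg _)
    hb1 (by norm_num)
  obtain ⟨C₃, hC₃⟩ := exists_cutIntegral_le (p := 2 / 3) hα β ha hl0 hl1 (by
    have h1 : 0 < 2 * l / (1 + l) := by positivity
    have h2 : 0 < 2 * l / (1 - l) := by positivity
    linarith) hs0 (by norm_num)
  refine ⟨(C + C₂ + C₃) / Real.pi, fun n hn => ?_⟩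
  obtain ⟨Φ, hΦ, hΦ0, hrep⟩ := exists_primitive_representation (β := β) hα ha hl0 hl1 n
  have e1 := (Complex.abs_im_le_norm _).trans (hC n hn Φ hΦ)
  -- Going up from the corner the cosine decreases, so the modulus is largest at the corner, where
  -- it is already below $1$.
  have e2 := hC₂ n hn Φ hΦ φ Real.pi hφ0 hφpi le_rfl (fun ψ hψ =>
    norm_saddleBase_le_of_neg a hl0 hl1 (by linarith [(abs_lt.1 hsL).1]) hs0.le
      (Real.cos_le_cos_of_nonneg_of_le_pi hφ0 hψ.2 hψ.1))
  have e3 := hC₃ n hn (Real.pi * (a * n + α))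
  have e4 := hrep s hsL
  have e5 : (Φ 0).im = 0 := by simpa using hΦ0 0 (by simpa using hlog)
  set X := (κ * n) ^ (-1 / 3 : ℝ) * Real.Gamma (1 / 3 + 1) with hX
  have hker : jacobiKernel a α β l n 0 = (((1 - l) ^ (β - 1) : ℝ) : ℂ) := by
    rw [jacobiKernel, saddleBase_zero a hl1, one_pow, one_mul, saddleWeight, Real.rpow_sub_one h1l.ne',
      Complex.ofReal_div, Complex.ofReal_cpow h1l.le]
    simp
  have e6 : (d * (jacobiKernel a α β l n 0 * (X : ℂ))).im =
      Real.sqrt 3 / 2 * (1 - l) ^ (β - 1) * X := by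
    rw [hker, ← Complex.ofReal_mul, mul_comm, Complex.im_ofReal_mul, hd]
    ring
  rw [Complex.sub_im, Complex.sub_im, e5, e6, sub_zero, show (-2 / 3 : ℝ) = -(2 / 3) by norm_num] at e1
  have e7 : scaledJacobi a α β l n - Real.sqrt 3 / 2 * (1 - l) ^ (β - 1) / Real.pi * X =
      (((Φ (s + φ * Complex.I)).im - Real.sqrt 3 / 2 * (1 - l) ^ (β - 1) * X) +
      ((Φ (s + Real.pi * Complex.I)).im - (Φ (s + φ * Complex.I)).im) -
      Real.sin (Real.pi * (a * n + α)) * cutIntegral a α β l n s) / Real.pi := by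
    rw [eq_div_iff hpi.ne', sub_mul, mul_comm _ Real.pi, e4]
    field_simp
    ring
  rw [e7, abs_div, abs_of_pos hpi, div_mul_eq_mul_div (C + C₂ + C₃)]
  refine div_le_div_of_nonneg_right ?_ hpi.le
  refine (abs_sub _ _).trans ((add_le_add ((abs_add_le _ _).trans (add_le_add e1 e2)) e3).trans
    (le_of_eq ?_))
  ring

theorem rpow_neg_one_third_cubic {l n : ℝ} (hn : 0 < n) {u v : ℝ} (hl0 : 0 < l) (hu : 0 < u)
    (hv : 0 < v) :
    (l * u / (3 * v ^ 3) * n) ^ (-1 / 3 : ℝ) =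
      3 ^ (1 / 3 : ℝ) * v / (n ^ (1 / 3 : ℝ) * l ^ (1 / 3 : ℝ) * u ^ (1 / 3 : ℝ)) := by
  have hv3 : (v ^ 3) ^ (1 / 3 : ℝ) = v := by
    rw [← Real.rpow_natCast, ← Real.rpow_mul hv.le]
    norm_num
  rw [show (-1 / 3 : ℝ) = -(1 / 3) by norm_num, Real.rpow_neg (by positivity),
    Real.mul_rpow (by positivity) hn.le, Real.div_rpow (by positivity) (by positivity),
    Real.mul_rpow hl0.le hu.le, Real.mul_rpow (by norm_num) (by positivity), hv3, inv_eq_one_div]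
  field_simp

theorem gamma_one_third_add_one : Real.Gamma (1 / 3 + 1) = Real.Gamma (1 / 3) / 3 := by
  rw [Real.Gamma_add_one (by norm_num)]
  ring

/-- Laplace's method produces $\Gamma(1/3)$, whereas the upper transition formula is written with
$\Gamma(2/3)$; the reflection formula converts one into the other. -/
theorem gamma_one_third_mul_gamma_two_thirds :
    Real.sqrt 3 * (Real.Gamma (1 / 3) * Real.Gamma (2 / 3)) = 2 * Real.pi := by
  have h := Real.Gamma_mul_Gamma_one_sub (1 / 3)
  rw [show (1 : ℝ) - 1 / 3 = 2 / 3 by norm_num, show Real.pi * (1 / 3) = Real.pi / 3 by ring,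
    Real.sin_pi_div_three] at h
  rw [h]
  field_simp

theorem three_rpow_one_third_mul : (3 : ℝ) ^ (1 / 3 : ℝ) * 3 ^ (2 / 3 : ℝ) = 3 := by
  rw [← Real.rpow_add (by norm_num)]
  norm_num

/-- Asymptotics at the upper transition point. -/
theorem varJacobi_upper_transition (hα : -1 < α) (β : ℝ) (ha : -1 < a) (hl0 : 0 < l)
    (hl1 : l < 1) (hal : a = 2 * l / (1 - l)) :
    (fun n : ℕ => varJacobi a α β l n - upperLead a α β l n)
        =O[atTop] fun n : ℕ => upperLead a α β l n * (n : ℝ) ^ (-(1 / 3) : ℝ) := by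
  obtain ⟨C, hC⟩ := scaledJacobi_upper_transition hα β ha hl0 hl1 hal
  have h1l : 0 < 1 - l := by linarith
  have h1l' : 0 < 1 + l := by linarith
  have hG := Real.Gamma_pos_of_pos (s := 2 / 3) (by norm_num)
  set c := (1 - l) ^ β /
    (3 ^ (2 / 3 : ℝ) * Real.Gamma (2 / 3) * l ^ (1 / 3 : ℝ) * (1 + l) ^ (1 / 3 : ℝ)) with hc
  have hc0 : 0 < c := by positivity
  have hlead : ∀ n : ℕ, 1 ≤ n → upperLead a α β l n =
      l ^ (-(a * n + α)) * (1 - l ^ 2) ^ (-β) * (c * (n : ℝ) ^ (-(1 / 3) : ℝ)) := by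
    intro n hn
    have hn0 : (0 : ℝ) < n := by exact_mod_cast hn
    have e1 : (1 - l ^ 2) ^ (-β) = ((1 - l) ^ β)⁻¹ * (1 + l) ^ (-β) := by
      rw [show 1 - l ^ 2 = (1 - l) * (1 + l) by ring, Real.mul_rpow h1l.le h1l'.le,
        Real.rpow_neg h1l.le]
    rw [upperLead, e1, hc, Real.rpow_neg hn0.le, show -(a * (n : ℝ)) - α = -(a * n + α) by ring]
    have := (Real.rpow_pos_of_pos h1l β).ne'
    field_simp
  refine varJacobi_sub_isBigO hl0 hl1 hc0 hC (fun n hn => ?_) (fun n hn => ?_)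
  · have hn0 : (0 : ℝ) < n := by exact_mod_cast hn
    rw [hlead n hn]
    congr 1
    rw [rpow_neg_one_third_cubic hn0 hl0 h1l' h1l, gamma_one_third_add_one, hc,
      Real.rpow_neg hn0.le, Real.rpow_sub_one h1l.ne']
    have h3 := three_rpow_one_third_mul
    have hg := gamma_one_third_mul_gamma_two_thirds
    have hp := Real.pi_pos
    field_simp
    linear_combination (-(Real.sqrt 3 * (Real.Gamma (1 / 3) * Real.Gamma (2 / 3)))) * h3 - 3 * hg
  · have hn0 : (0 : ℝ) < n := by exact_mod_cast hn
    rw [hlead n hn, mul_assoc, mul_assoc c, ← Real.rpow_add hn0]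
    norm_num

end

/-! ### The lower transition point. -/

section

variable {a α β l : ℝ}

/-- The scaled Jacobi polynomial at the lower transition point. -/
theorem scaledJacobi_lower_transition (hα : -1 < α) (β : ℝ) (ha : -1 < a) (hl0 : 0 < l)
    (hl1 : l < 1) (hal : a = -(2 * l / (1 + l))) :
    ∃ C : ℝ, ∀ n : ℕ, 1 ≤ n →
      |scaledJacobi a α β l n - (1 + l) ^ (β - 1) / Real.pi *
        ((l * (1 - l) / (3 * (1 + l) ^ 3) * n) ^ (-1 / 3 : ℝ) * Real.Gamma (1 / 3 + 1)) *
        lowerOsc a α n| ≤ C * (n : ℝ) ^ (-(2 / 3) : ℝ) := by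
  have h1l : 0 < 1 - l := by linarith
  have h1l' : 0 < 1 + l := by linarith
  have h1lc : (1 : ℂ) + l ≠ 0 := by exact_mod_cast h1l'.ne'
  have hlog : Real.log l < 0 := Real.log_neg hl0 hl1
  have hpi := Real.pi_pos
  set κ := l * (1 - l) / (3 * (1 + l) ^ 3) with hκ
  have hκ0 : 0 < κ := by positivity
  have h3 : Real.sqrt 3 ^ 2 = 3 := Real.sq_sqrt (by norm_num)
  -- At the double saddle $\pi i$ the cubic coefficient is $+\kappa$, so descent rays are the cube
  -- roots of $-1$. The contour arrives along the ray $e^{-i\pi/3}$, traversed backwards, and leaves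
  -- along $-1$ on the line $\operatorname{Im}w=\pi$.
  set d : ℂ := ⟨1 / 2, -(Real.sqrt 3 / 2)⟩ with hd
  have hd3 : d ^ 3 = -1 := by
    apply Complex.ext <;> simp only [hd, pow_succ, pow_zero, one_mul, Complex.mul_re,
      Complex.mul_im, Complex.neg_re, Complex.neg_im, Complex.one_re, Complex.one_im]
    · linear_combination (-3 / 8) * h3
    · linear_combination (Real.sqrt 3 / 8) * h3
  have hd1 : ‖d‖ = 1 := by
    have : ‖d‖ ^ 3 = 1 := by rw [← norm_pow, hd3, norm_neg, norm_one]
    exact (pow_eq_one_iff_of_nonneg (norm_nonneg _) (by norm_num)).1 this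
  set w₀ : ℂ := Real.pi * Complex.I with hw₀
  have hwexp : Complex.exp w₀ = -1 := Complex.exp_pi_mul_I
  have hw0 : |w₀.re| < -Real.log l := by simpa [hw₀] using hlog
  have hne : (-1 : ℂ) - l ≠ 0 := by
    rw [show (-1 : ℂ) - l = -(1 + l) by ring]
    exact neg_ne_zero.2 h1lc
  have hb : ‖saddleBase a l w₀‖ = 1 := norm_saddleBase_mul_I a hl0 hl1 Real.pi
  have hD1 : saddleLogDeriv a l w₀ = 0 := by
    simp only [saddleLogDeriv, hwexp, mul_neg, mul_one, sub_neg_eq_add]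
    rw [hal, show (-1 : ℂ) - l = -(1 + l) by ring]
    push_cast
    field_simp
    ring
  have hD2 : saddleLogDeriv₂ l w₀ = 0 := by
    simp only [saddleLogDeriv₂, hwexp, mul_neg, mul_one, sub_neg_eq_add]
    rw [show (-1 : ℂ) - l = -(1 + l) by ring, neg_sq, sub_self]
  have hD3 : saddleLogDeriv₃ l w₀ / 6 = κ := by
    simp only [saddleLogDeriv₃, hwexp, mul_neg, mul_one, sub_neg_eq_add, hκ]
    rw [show (-1 : ℂ) - l = -(1 + l) by ring]
    push_cast
    field_simp
    ring
  obtain ⟨δ₁, hδ₁, hray₁⟩ := exists_kernel_cubic_ray a α β hl0 (d := d) (κ := κ) hw0 hd1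
    hκ0 hb hD1 hD2 (by rw [hD3, hd3]; ring)
  obtain ⟨δ₂, hδ₂, hray₂⟩ := exists_kernel_cubic_ray a α β hl0 (d := -1) (κ := κ) hw0 (by simp)
    hκ0 hb hD1 hD2 (by rw [hD3]; ring)
  set δ := min (min δ₁ δ₂) 1 with hδ
  have hδ0 : 0 < δ := lt_min (lt_min hδ₁ hδ₂) one_pos
  have hδ1 : δ ≤ 1 := min_le_right _ _
  obtain ⟨hin, hb1, C, hC⟩ := hray₁ δ hδ0 ((min_le_left _ _).trans (min_le_left _ _))
  obtain ⟨hin', -, C', hC'⟩ := hray₂ δ hδ0 ((min_le_left _ _).trans (min_le_right _ _))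
  set s := δ / 2 with hs
  set φ := Real.pi - δ * (Real.sqrt 3 / 2) with hφ
  have hs3 : Real.sqrt 3 ≤ 2 := by
    rw [Real.sqrt_le_left (by norm_num)]
    norm_num
  have hs0 : 0 < s := by rw [hs]; linarith
  have hφpi : φ ≤ Real.pi := by
    have : 0 ≤ δ * (Real.sqrt 3 / 2) := by positivity
    linarith
  have hφ0 : 0 ≤ φ := by
    have : δ * (Real.sqrt 3 / 2) ≤ 1 * 1 := mul_le_mul hδ1 (by linarith) (by positivity) one_pos.le
    linarith [Real.pi_gt_three]
  have hcorner : w₀ + δ * d = s + φ * Complex.I := by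
    rw [hs, hφ, hw₀]
    apply Complex.ext <;> simp [hd]
    · ring
    · ring
  have hcorner' : w₀ + δ * (-1) = (-δ : ℝ) + Real.pi * Complex.I := by
    rw [hw₀]
    push_cast
    ring
  rw [hcorner] at hin hb1 hC
  rw [hcorner'] at hin' hC'
  have hsL : |s| < -Real.log l := by simpa using hin
  have hsL' : |-δ| < -Real.log l := by simpa using hin'
  obtain ⟨C₂, hC₂⟩ := exists_vertical_increment_le_rpow a α β hl0 (p := 2 / 3) hsL (norm_nonneg _)
    hb1 (by norm_num)
  obtain ⟨C₃, hC₃⟩ := exists_cutIntegral_le (p := 2 / 3) hα β ha hl0 hl1 hal.ge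
    (neg_neg_of_pos hδ0) (by norm_num)
  refine ⟨(C + C' + C₂ + C₃) / Real.pi, fun n hn => ?_⟩
  obtain ⟨Φ, hΦ, hΦ0, hrep⟩ := exists_primitive_representation (β := β) hα ha hl0 hl1 n
  have e1 := (Complex.abs_im_le_norm _).trans (hC n hn Φ hΦ)
  have e1' := (Complex.abs_im_le_norm _).trans (hC' n hn Φ hΦ)
  have e2 := hC₂ n hn Φ hΦ 0 φ le_rfl hφ0 hφpi (fun ψ hψ =>
    norm_saddleBase_le_of_pos a hl0 hl1 hs0.le
      (Real.cos_le_cos_of_nonneg_of_le_pi hψ.1 hφpi hψ.2))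
  have e3 := hC₃ n hn (Real.pi * (a * n + α))
  have e4 := hrep (-δ) hsL'
  have e5 : (Φ (s + (0 : ℝ) * Complex.I)).im = 0 := by simpa using hΦ0 s hsL
  set X := (κ * n) ^ (-1 / 3 : ℝ) * Real.Gamma (1 / 3 + 1) with hX
  set θ := (a * n + α) * Real.pi with hθ
  have hker : jacobiKernel a α β l n w₀ * (X : ℂ) =
      ((((1 + l) ^ (β - 1)) * X : ℝ) : ℂ) * Complex.exp (θ * Complex.I) := by
    have h := jacobiKernel_add_pi_mul_I (a := a) (α := α) (β := β) n hl0 0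
    rw [Complex.ofReal_zero, zero_add, cutBase_zero hl0, one_pow, one_mul] at h
    rw [hw₀, h, cutWeight, Real.rpow_sub_one h1l'.ne', hθ]
    push_cast
    simp only [mul_zero, Real.exp_zero, mul_one, one_mul, Complex.exp_zero]
    ring
  have e6 : (d * (jacobiKernel a α β l n w₀ * (X : ℂ))).im = (1 + l) ^ (β - 1) * X *
      (Real.sin θ / 2 - Real.sqrt 3 / 2 * Real.cos θ) := by
    rw [hker, mul_left_comm, Complex.im_ofReal_mul, Complex.mul_im, Complex.exp_ofReal_mul_I_re,
      Complex.exp_ofReal_mul_I_im, hd]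
    ring
  have e6' : (-1 * (jacobiKernel a α β l n w₀ * (X : ℂ))).im = -((1 + l) ^ (β - 1) * X *
      Real.sin θ) := by
    rw [hker, neg_one_mul, Complex.neg_im, Complex.im_ofReal_mul, Complex.exp_ofReal_mul_I_im]
  rw [Complex.sub_im, Complex.sub_im, e6, show (-2 / 3 : ℝ) = -(2 / 3) by norm_num] at e1
  rw [Complex.sub_im, Complex.sub_im, e6', show (-2 / 3 : ℝ) = -(2 / 3) by norm_num] at e1'
  rw [e5, sub_zero] at e2
  -- The outgoing ray minus the incoming one gives
  -- $-\sin\theta-\tfrac12\sin\theta+\tfrac{\sqrt3}{2}\cos\theta$, which is the oscillating factor.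
  have e7 : scaledJacobi a α β l n - (1 + l) ^ (β - 1) / Real.pi * X * lowerOsc a α n =
      ((((Φ ((-δ : ℝ) + Real.pi * Complex.I)).im - (Φ w₀).im - -((1 + l) ^ (β - 1) * X *
        Real.sin θ)) -
      ((Φ (s + φ * Complex.I)).im - (Φ w₀).im - (1 + l) ^ (β - 1) * X *
        (Real.sin θ / 2 - Real.sqrt 3 / 2 * Real.cos θ)) + (Φ (s + φ * Complex.I)).im) -
      Real.sin (Real.pi * (a * n + α)) * cutIntegral a α β l n (-δ)) / Real.pi := by
    rw [eq_div_iff hpi.ne', sub_mul, mul_comm _ Real.pi, e4, lowerOsc, ← hθ]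
    field_simp
    linear_combination (Real.sin θ * (1 + l) ^ (β - 1) * X) * h3
  rw [e7, abs_div, abs_of_pos hpi, div_mul_eq_mul_div (C + C' + C₂ + C₃)]
  refine div_le_div_of_nonneg_right ?_ hpi.le
  refine (abs_sub _ _).trans ((add_le_add ((abs_add_le _ _).trans (add_le_add ((abs_sub _ _).trans
    (add_le_add e1' e1)) e2)) e3).trans (le_of_eq ?_))
  ring

/-- Asymptotics at the lower transition point. -/
theorem varJacobi_lower_transition (hα : -1 < α) (β : ℝ) (ha : -1 < a) (hl0 : 0 < l)
    (hl1 : l < 1) (hal : a = -(2 * l / (1 + l))) :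
    (fun n : ℕ => varJacobi a α β l n - lowerAmp a α β l n * lowerOsc a α n)
        =O[atTop] fun n : ℕ => lowerAmp a α β l n * (n : ℝ) ^ (-(1 / 3) : ℝ) := by
  obtain ⟨C, hC⟩ := scaledJacobi_lower_transition hα β ha hl0 hl1 hal
  have h1l : 0 < 1 - l := by linarith
  have h1l' : 0 < 1 + l := by linarith
  have hG := Real.Gamma_pos_of_pos (s := 1 / 3) (by norm_num)
  have hpi := Real.pi_pos
  set c := Real.Gamma (1 / 3) * (1 + l) ^ β /
    (3 ^ (2 / 3 : ℝ) * Real.pi * l ^ (1 / 3 : ℝ) * (1 - l) ^ (1 / 3 : ℝ)) with hc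
  have hc0 : 0 < c := by positivity
  have hlead : ∀ n : ℕ, 1 ≤ n → lowerAmp a α β l n =
      l ^ (-(a * n + α)) * (1 - l ^ 2) ^ (-β) * (c * (n : ℝ) ^ (-(1 / 3) : ℝ)) := by
    intro n hn
    have hn0 : (0 : ℝ) < n := by exact_mod_cast hn
    have e1 : (1 - l ^ 2) ^ (-β) = (1 - l) ^ (-β) * ((1 + l) ^ β)⁻¹ := by
      rw [show 1 - l ^ 2 = (1 - l) * (1 + l) by ring, Real.mul_rpow h1l.le h1l'.le,
        Real.rpow_neg h1l'.le]
    rw [lowerAmp, e1, hc, Real.rpow_neg hn0.le, show -α - a * (n : ℝ) = -(a * n + α) by ring]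
    have := (Real.rpow_pos_of_pos h1l' β).ne'
    field_simp
  refine varJacobi_sub_isBigO hl0 hl1 hc0 hC (fun n hn => ?_) (fun n hn => ?_)
  · have hn0 : (0 : ℝ) < n := by exact_mod_cast hn
    rw [hlead n hn, mul_assoc]
    congr 1
    congr 1
    rw [rpow_neg_one_third_cubic hn0 hl0 h1l h1l', gamma_one_third_add_one, hc,
      Real.rpow_neg hn0.le, Real.rpow_sub_one h1l'.ne']
    have h3 := three_rpow_one_third_mul
    field_simp
    linear_combination (-1 : ℝ) * h3
  · have hn0 : (0 : ℝ) < n := by exact_mod_cast hn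
    rw [hlead n hn, mul_assoc, mul_assoc c, ← Real.rpow_add hn0]
    norm_num

end

/-! ### The oscillatory range. -/

section

variable {a α β l : ℝ}

/-- The two linear factors vanish at the transition values and are both positive strictly between
them; this places the saddle off the real axis and also supplies the radicand of the amplitude. -/
theorem one_sub_statRe_sq (ha : -1 < a) (hl0 : 0 < l) :
    (2 * l * (a + 1)) ^ 2 * (1 - statRe a l ^ 2) =
      (1 - l ^ 2) * ((a + 2) * l + a) * ((a + 2) * l - a) := by
  have h1 : a + 1 ≠ 0 := by linarith
  rw [statRe]
  field_simp
  ring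

theorem one_add_sq_sub_statRe (ha : -1 < a) (hl0 : 0 < l) :
    1 + l ^ 2 - 2 * l * statRe a l = (1 - l ^ 2) / (a + 1) := by
  have h1 : a + 1 ≠ 0 := by linarith
  rw [statRe]
  field_simp
  ring

theorem statRe_sq_lt_one (ha : -1 < a) (hl0 : 0 < l) (hl1 : l < 1)
    (h1 : -(2 * l / (1 + l)) < a) (h2 : a < 2 * l / (1 - l)) : statRe a l ^ 2 < 1 := by
  have e1 : 0 < (a + 2) * l + a := by
    rw [← neg_div, div_lt_iff₀ (by linarith)] at h1
    linarith
  have e2 : 0 < (a + 2) * l - a := by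
    rw [lt_div_iff₀ (by linarith)] at h2
    linarith
  have e3 : 0 < 1 - l ^ 2 := by nlinarith
  have e4 : 0 < (2 * l * (a + 1)) ^ 2 * (1 - statRe a l ^ 2) := by
    rw [one_sub_statRe_sq ha hl0]
    positivity
  linarith [pos_of_mul_pos_right e4 (sq_nonneg _)]

theorem zPlus_re : (zPlus a l).re = statRe a l := by simp [zPlus]

theorem zPlus_im : (zPlus a l).im = Real.sqrt (1 - statRe a l ^ 2) := by simp [zPlus]

theorem norm_zPlus (h : statRe a l ^ 2 < 1) : ‖zPlus a l‖ = 1 := by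
  have e : ‖zPlus a l‖ ^ 2 = 1 := by
    rw [Complex.sq_norm, Complex.normSq_apply, zPlus_re, zPlus_im,
      Real.mul_self_sqrt (by linarith)]
    ring
  exact (pow_eq_one_iff_of_nonneg (norm_nonneg _) two_ne_zero).1 e

theorem exp_phiPlus_mul_I (h : statRe a l ^ 2 < 1) :
    Complex.exp (phiPlus a l * Complex.I) = zPlus a l := by
  have e := Complex.norm_mul_exp_arg_mul_I (zPlus a l)
  rwa [norm_zPlus h, Complex.ofReal_one, one_mul] at e

theorem phiPlus_mem_Ioo (h : statRe a l ^ 2 < 1) : phiPlus a l ∈ Set.Ioo 0 Real.pi := by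
  have him : 0 < (zPlus a l).im := by
    rw [zPlus_im]
    exact Real.sqrt_pos.2 (by linarith)
  refine ⟨lt_of_le_of_ne (Complex.arg_nonneg_iff.2 him.le) fun h0 => him.ne' ?_,
    Complex.arg_lt_pi_iff.2 (Or.inr him.ne')⟩
  exact (Complex.arg_eq_zero_iff.1 h0.symm).2

/-- The quadratic equation of the saddle points. -/
theorem zPlus_quadratic (h : statRe a l ^ 2 < 1) :
    zPlus a l ^ 2 = 2 * statRe a l * zPlus a l - 1 := by
  have hs : Real.sqrt (1 - statRe a l ^ 2) ^ 2 = 1 - statRe a l ^ 2 := Real.sq_sqrt (by linarith)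
  apply Complex.ext
  · rw [sq, Complex.mul_re, Complex.sub_re, mul_assoc, Complex.mul_re, Complex.mul_re, zPlus_re,
      zPlus_im]
    simp only [Complex.re_ofNat, Complex.im_ofNat, Complex.ofReal_re, Complex.ofReal_im,
      Complex.one_re]
    linear_combination -hs
  · rw [sq, Complex.mul_im, Complex.sub_im, mul_assoc, Complex.mul_im, Complex.mul_im,
      Complex.mul_re, zPlus_re, zPlus_im]
    simp only [Complex.re_ofNat, Complex.im_ofNat, Complex.ofReal_re, Complex.ofReal_im,
      Complex.one_im]
    ring

/-- This is the saddle equation cleared of denominators: the vanishing logarithmic derivative reads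
$a+1=z(1-l^2)/((1-lz)(z-l))$. -/
theorem one_sub_mul_zPlus_mul (ha : -1 < a) (hl0 : 0 < l) (h : statRe a l ^ 2 < 1) :
    (1 - l * zPlus a l) * (zPlus a l - l) = zPlus a l * (((1 - l ^ 2) / (a + 1) : ℝ) : ℂ) := by
  rw [← one_add_sq_sub_statRe ha hl0]
  push_cast
  linear_combination (-(l : ℂ)) * zPlus_quadratic h

theorem norm_one_sub_mul_zPlus_sq (ha : -1 < a) (hl0 : 0 < l) (h : statRe a l ^ 2 < 1) :
    ‖1 - l * zPlus a l‖ ^ 2 = (1 - l ^ 2) / (a + 1) := by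
  have hs := Real.mul_self_sqrt (show 0 ≤ 1 - statRe a l ^ 2 by linarith)
  rw [← one_add_sq_sub_statRe ha hl0, Complex.sq_norm, Complex.normSq_apply]
  simp only [Complex.sub_re, Complex.sub_im, Complex.one_re, Complex.one_im,
    Complex.re_ofReal_mul, Complex.im_ofReal_mul, zPlus_re, zPlus_im]
  linear_combination l ^ 2 * hs

theorem zPlus_ne_zero (h : statRe a l ^ 2 < 1) : zPlus a l ≠ 0 := by
  rw [← norm_ne_zero_iff, norm_zPlus h]
  exact one_ne_zero

theorem one_sub_zPlus_sq (h : statRe a l ^ 2 < 1) :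
    1 - zPlus a l ^ 2 = -(2 * Real.sqrt (1 - statRe a l ^ 2) * Complex.I * zPlus a l) := by
  have e : zPlus a l = statRe a l + Complex.I * Real.sqrt (1 - statRe a l ^ 2) := rfl
  linear_combination zPlus_quadratic h - 2 * zPlus a l * e

theorem one_sub_mul_zPlus_ne_zero (ha : -1 < a) (hl0 : 0 < l) (hl1 : l < 1)
    (h : statRe a l ^ 2 < 1) : 1 - l * zPlus a l ≠ 0 ∧ zPlus a l - l ≠ 0 := by
  have h1 : 0 < a + 1 := by linarith
  have h2 : 0 < 1 - l ^ 2 := by nlinarith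
  have hN : (((1 - l ^ 2) / (a + 1) : ℝ) : ℂ) ≠ 0 := by exact_mod_cast (div_pos h2 h1).ne'
  have := mul_ne_zero (zPlus_ne_zero h) hN
  rw [← one_sub_mul_zPlus_mul ha hl0 h] at this
  exact mul_ne_zero_iff.1 this

theorem saddleLogDeriv_phiPlus (ha : -1 < a) (hl0 : 0 < l) (hl1 : l < 1)
    (h : statRe a l ^ 2 < 1) : saddleLogDeriv a l (phiPlus a l * Complex.I) = 0 := by
  obtain ⟨h1, h2⟩ := one_sub_mul_zPlus_ne_zero ha hl0 hl1 h
  have h3 : (a : ℂ) + 1 ≠ 0 := by exact_mod_cast (show a + 1 ≠ 0 by linarith)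
  have hm := one_sub_mul_zPlus_mul ha hl0 h
  push_cast at hm
  rw [mul_div_assoc', eq_div_iff h3] at hm
  rw [saddleLogDeriv, exp_phiPlus_mul_I h]
  field_simp
  linear_combination hm

/-- The fractions combine to $lz(1-l^2)(1-z^2)/((1-lz)(z-l))^2$, and $1-z_+^2$ is an imaginary
multiple of $z_+$. The value is purely imaginary, so the descent direction is independent of the
parameters. -/
theorem saddleLogDeriv₂_phiPlus (ha : -1 < a) (hl0 : 0 < l) (hl1 : l < 1)
    (h : statRe a l ^ 2 < 1) : saddleLogDeriv₂ l (phiPlus a l * Complex.I) =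
      -(2 * ((l * Real.sqrt (1 - statRe a l ^ 2) * (a + 1) ^ 2 / (1 - l ^ 2) : ℝ) : ℂ) *
        Complex.I) := by
  obtain ⟨h1, h2⟩ := one_sub_mul_zPlus_ne_zero ha hl0 hl1 h
  have h3 : (a : ℂ) + 1 ≠ 0 := by exact_mod_cast (show a + 1 ≠ 0 by linarith)
  have h4 : (1 : ℂ) - l ^ 2 ≠ 0 := by exact_mod_cast (show (1 : ℝ) - l ^ 2 ≠ 0 by nlinarith)
  have h5 := zPlus_ne_zero h
  have hm := one_sub_mul_zPlus_mul ha hl0 h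
  push_cast at hm
  have hq := one_sub_zPlus_sq h
  rw [saddleLogDeriv₂, exp_phiPlus_mul_I h, div_sub_div _ _ (pow_ne_zero 2 h2) (pow_ne_zero 2 h1),
    ← mul_pow, mul_comm (zPlus a l - l), hm]
  push_cast
  rw [div_eq_iff (by positivity)]
  field_simp
  linear_combination (l * (1 - (l : ℂ) ^ 2)) * hq

/-- The base is unimodular on the imaginary axis, and since $\varphi_+$ is the principal argument
the principal power agrees with $e^{(a+1)i\varphi_+}$. Reducing the argument modulo $2\pi$ is
harmless after exponentiation. -/
theorem saddleBase_phiPlus (hl0 : 0 < l) (hl1 : l < 1) (h : statRe a l ^ 2 < 1) :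
    saddleBase a l (phiPlus a l * Complex.I) =
      Complex.exp (phaseH a l (phiPlus a l) * Complex.I) := by
  have hφ := phiPlus_mem_Ioo h
  have e1 : zPlus a l ^ ((a : ℂ) + 1) =
      Complex.exp ((a + 1) * (phiPlus a l * Complex.I)) := by
    rw [Complex.cpow_def_of_ne_zero (zPlus_ne_zero h), Complex.log, norm_zPlus h, Real.log_one,
      Complex.ofReal_zero, zero_add, mul_comm]
    rfl
  have e2 : phaseH a l (phiPlus a l) = (saddleBase a l (phiPlus a l * Complex.I)).arg := by
    rw [phaseH, mul_comm Complex.I, exp_phiPlus_mul_I h, saddleBase, exp_phiPlus_mul_I h, e1]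
  have e := Complex.norm_mul_exp_arg_mul_I (saddleBase a l (phiPlus a l * Complex.I))
  rw [norm_saddleBase_mul_I a hl0 hl1, Complex.ofReal_one, one_mul, ← e2] at e
  exact e.symm

/-- The weight equals the base times $e^{(\alpha-a)w}(1-lz)^{\beta-1}$. The extra copy of the base
is why the phase carries $n+1$ rather than $n$. -/
theorem saddleWeight_phiPlus (ha : -1 < a) (hl0 : 0 < l) (hl1 : l < 1)
    (h : statRe a l ^ 2 < 1) : saddleWeight α β l (phiPlus a l * Complex.I) =
      ((‖1 - l * zPlus a l‖ ^ (β - 1) : ℝ) : ℂ) * Complex.exp ((phaseH a l (phiPlus a l) +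
        (α - a) * phiPlus a l + (β - 1) * psiAngle a l) * Complex.I) := by
  obtain ⟨h1, h2⟩ := one_sub_mul_zPlus_ne_zero ha hl0 hl1 h
  have e1 : (1 - l * zPlus a l) ^ (β : ℂ) = (1 - l * zPlus a l) *
      (((‖1 - l * zPlus a l‖ ^ (β - 1) : ℝ) : ℂ) *
        Complex.exp ((β - 1) * psiAngle a l * Complex.I)) := by
    have hn := norm_pos_iff.2 h1
    conv_lhs => rw [show (β : ℂ) = (β - 1) + 1 by ring, Complex.cpow_add _ _ h1, Complex.cpow_one]
    rw [mul_comm, Complex.cpow_def_of_ne_zero h1, Complex.log, ← psiAngle, Real.rpow_def_of_pos hn,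
      Complex.ofReal_exp, ← Complex.exp_add]
    push_cast
    congr 2
    ring
  have e2 : saddleWeight α β l (phiPlus a l * Complex.I) =
      saddleBase a l (phiPlus a l * Complex.I) *
        Complex.exp ((α - a) * (phiPlus a l * Complex.I)) *
        (((‖1 - l * zPlus a l‖ ^ (β - 1) : ℝ) : ℂ) *
          Complex.exp ((β - 1) * psiAngle a l * Complex.I)) := by
    rw [saddleWeight, saddleBase, exp_phiPlus_mul_I h, e1,
      show ((α : ℂ) + 1) * (phiPlus a l * Complex.I) = (a + 1) * (phiPlus a l * Complex.I) +
        (α - a) * (phiPlus a l * Complex.I) by ring, Complex.exp_add]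
    ring
  rw [e2, saddleBase_phiPlus hl0 hl1 h, add_mul, add_mul, Complex.exp_add, Complex.exp_add]
  ring_nf

theorem jacobiKernel_phiPlus (ha : -1 < a) (hl0 : 0 < l) (hl1 : l < 1)
    (h : statRe a l ^ 2 < 1) (n : ℕ) : jacobiKernel a α β l n (phiPlus a l * Complex.I) =
      ((‖1 - l * zPlus a l‖ ^ (β - 1) : ℝ) : ℂ) *
        Complex.exp (((oscPhase a α β l n - Real.pi / 4 : ℝ) : ℂ) * Complex.I) := by
  rw [jacobiKernel, saddleBase_phiPlus hl0 hl1 h, saddleWeight_phiPlus ha hl0 hl1 h,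
    ← Complex.exp_nat_mul, mul_left_comm, ← Complex.exp_add, oscPhase]
  push_cast
  ring_nf

/-- The scaled Jacobi polynomial in the oscillatory range. -/
theorem scaledJacobi_oscillatory (hα : -1 < α) (β : ℝ) (ha : -1 < a) (hl0 : 0 < l)
    (hl1 : l < 1) (hal : -(2 * l / (1 + l)) < a) (h : statRe a l ^ 2 < 1) :
    ∃ C : ℝ, ∀ n : ℕ, 1 ≤ n →
      |scaledJacobi a α β l n - ‖1 - l * zPlus a l‖ ^ (β - 1) / Real.pi *
        Real.sqrt (Real.pi / (l * Real.sqrt (1 - statRe a l ^ 2) * (a + 1) ^ 2 / (1 - l ^ 2) * n)) *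
        Real.cos (oscPhase a α β l n)| ≤ C * (n : ℝ) ^ (-(3 / 2) : ℝ) := by
  have h1a : 0 < a + 1 := by linarith
  have h1l : 0 < 1 - l ^ 2 := by nlinarith
  have hS : 0 < Real.sqrt (1 - statRe a l ^ 2) := Real.sqrt_pos.2 (by linarith)
  have hlog : Real.log l < 0 := Real.log_neg hl0 hl1
  have hpi := Real.pi_pos
  have hD2 := saddleLogDeriv₂_phiPlus ha hl0 hl1 h
  set κ := l * Real.sqrt (1 - statRe a l ^ 2) * (a + 1) ^ 2 / (1 - l ^ 2) with hκ
  have hκ0 : 0 < κ := by positivity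
  obtain ⟨hφ0, hφπ⟩ := phiPlus_mem_Ioo h
  set w₀ : ℂ := phiPlus a l * Complex.I with hw₀
  have hw0 : |w₀.re| < -Real.log l := by simpa [hw₀] using hlog
  have h2 : Real.sqrt 2 ^ 2 = 2 := Real.sq_sqrt (by norm_num)
  have h2' : Real.sqrt 2 ≤ 2 := by
    rw [Real.sqrt_le_left (by norm_num)]
    norm_num
  have h20 : 0 < Real.sqrt 2 := by positivity
  -- The second-order coefficient is $-i\kappa$, so steepest descent requires $d^2=-i$; $d=e^{3\pi
  -- i/4}$ crosses from right to left going up. Its phase, combined with the shift $-\pi/4$, turns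
  -- the imaginary part into $\cos\theta_n$.
  set d : ℂ := ⟨-(Real.sqrt 2 / 2), Real.sqrt 2 / 2⟩ with hd
  have hdd : d ^ 2 = -Complex.I := by
    apply Complex.ext <;> simp only [hd, sq, Complex.mul_re, Complex.mul_im, Complex.neg_re,
      Complex.neg_im, Complex.I_re, Complex.I_im]
    · ring
    · linear_combination (-1 / 2) * h2
  have hd1 : ‖d‖ = 1 := by
    have : ‖d‖ ^ 2 = 1 := by rw [← norm_pow, hdd, norm_neg, Complex.norm_I]
    exact (pow_eq_one_iff_of_nonneg (norm_nonneg _) (by norm_num)).1 this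
  obtain ⟨δ₀, hδ₀, hseg⟩ := exists_kernel_quadratic_segment a α β hl0 (d := d) (κ := κ) hw0 hd1
    hκ0 (norm_saddleBase_mul_I a hl0 hl1 _) (saddleLogDeriv_phiPlus ha hl0 hl1 h) (by
      rw [hD2, hdd]
      linear_combination (κ : ℂ) * Complex.I_sq)
  -- The extra bounds keep both ends of the crossing at heights between $0$ and $\pi$.
  set δ := min δ₀ (min (phiPlus a l) (Real.pi - phiPlus a l)) with hδ
  have hδ0 : 0 < δ := lt_min hδ₀ (lt_min hφ0 (sub_pos.2 hφπ))
  have hδ1 : δ ≤ phiPlus a l := (min_le_right _ _).trans (min_le_left _ _)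
  have hδ2 : δ ≤ Real.pi - phiPlus a l := (min_le_right _ _).trans (min_le_right _ _)
  obtain ⟨⟨hin, hin'⟩, ⟨hb, hb'⟩, C, hC⟩ := hseg δ hδ0 (min_le_left _ _)
  set s := δ * (Real.sqrt 2 / 2) with hs
  have hs0 : 0 < s := by positivity
  have hsδ : s ≤ δ := mul_le_of_le_one_right hδ0.le (by linarith)
  set φ₁ := phiPlus a l - s with hφ₁
  set φ₂ := phiPlus a l + s with hφ₂
  have hc : w₀ + δ * d = (-s : ℝ) + φ₂ * Complex.I := by
    rw [hφ₂, hs, hw₀]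
    apply Complex.ext <;> simp [hd]
  have hc' : w₀ + (-δ : ℝ) * d = s + φ₁ * Complex.I := by
    rw [hφ₁, hs, hw₀]
    apply Complex.ext <;> simp [hd]
    ring
  rw [hc] at hin hb
  rw [hc'] at hin' hb'
  rw [hc, hc'] at hC
  have hsL : |-s| < -Real.log l := by simpa using hin
  have hsL' : |s| < -Real.log l := by simpa using hin'
  obtain ⟨C₁, hC₁⟩ := exists_vertical_increment_le_rpow a α β hl0 (p := 3 / 2) hsL' (norm_nonneg _)
    hb' (by norm_num)
  obtain ⟨C₂, hC₂⟩ := exists_vertical_increment_le_rpow a α β hl0 (p := 3 / 2) hsL (norm_nonneg _)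
    hb (by norm_num)
  obtain ⟨C₃, hC₃⟩ := exists_cutIntegral_le (p := 3 / 2) hα β ha hl0 hl1 hal.le
    (neg_neg_of_pos hs0) (by norm_num)
  refine ⟨(C + C₁ + C₂ + C₃) / Real.pi, fun n hn => ?_⟩
  obtain ⟨Φ, hΦ, hΦ0, hrep⟩ := exists_primitive_representation (β := β) hα ha hl0 hl1 n
  have e0 := (Complex.abs_im_le_norm _).trans (hC n hn Φ hΦ)
  -- On the right line the modulus grows up to the first corner, on the left line it falls from the
  -- second one. Both vertical pieces are therefore controlled by the corners, where the modulus is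
  -- below $1$.
  have e1 := hC₁ n hn Φ hΦ 0 φ₁ le_rfl (by linarith) (by linarith) (fun ψ hψ =>
    norm_saddleBase_le_of_pos a hl0 hl1 hs0.le
      (Real.cos_le_cos_of_nonneg_of_le_pi hψ.1 (by linarith) hψ.2))
  have e2 := hC₂ n hn Φ hΦ φ₂ Real.pi (by linarith) (by linarith) le_rfl (fun ψ hψ =>
    norm_saddleBase_le_of_neg a hl0 hl1 (by linarith [(abs_lt.1 hsL).1]) (by linarith)
      (Real.cos_le_cos_of_nonneg_of_le_pi (by linarith) hψ.2 hψ.1))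
  have e3 := hC₃ n hn (Real.pi * (a * n + α))
  have e4 := hrep (-s) hsL
  have e5 : (Φ (s + (0 : ℝ) * Complex.I)).im = 0 := by simpa using hΦ0 s hsL'
  rw [e5, sub_zero] at e1
  set R := ‖1 - l * zPlus a l‖ ^ (β - 1) with hR
  set X := Real.sqrt (Real.pi / (κ * n)) with hX
  set θ := oscPhase a α β l n with hθ
  have e6 : (d * (jacobiKernel a α β l n w₀ * (X : ℂ))).im = R * X * Real.cos θ := by
    rw [hw₀, jacobiKernel_phiPlus ha hl0 hl1 h, ← hR, ← hθ,
      show ∀ u : ℂ, d * (R * u * X) = ((R * X : ℝ) : ℂ) * (d * u) by intro u; push_cast; ring,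
      Complex.im_ofReal_mul, Complex.mul_im, Complex.exp_ofReal_mul_I_re,
      Complex.exp_ofReal_mul_I_im, Real.cos_sub, Real.sin_sub, Real.cos_pi_div_four,
      Real.sin_pi_div_four, hd]
    linear_combination (R * X * Real.cos θ / 2) * h2
  rw [Complex.sub_im, Complex.sub_im, e6, show (-3 / 2 : ℝ) = -(3 / 2) by norm_num] at e0
  have e7 : scaledJacobi a α β l n - R / Real.pi * X * Real.cos θ =
      ((((Φ ((-s : ℝ) + φ₂ * Complex.I)).im - (Φ (s + φ₁ * Complex.I)).im - R * X * Real.cos θ) +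
      (Φ (s + φ₁ * Complex.I)).im +
      ((Φ ((-s : ℝ) + Real.pi * Complex.I)).im - (Φ ((-s : ℝ) + φ₂ * Complex.I)).im)) -
      Real.sin (Real.pi * (a * n + α)) * cutIntegral a α β l n (-s)) / Real.pi := by
    rw [eq_div_iff hpi.ne', sub_mul, mul_comm _ Real.pi, e4]
    field_simp
    ring
  rw [e7, abs_div, abs_of_pos hpi, div_mul_eq_mul_div (C + C₁ + C₂ + C₃)]
  refine div_le_div_of_nonneg_right ?_ hpi.le
  refine (abs_sub _ _).trans ((add_le_add ((abs_add_le _ _).trans (add_le_add ((abs_add_le _ _).trans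
    (add_le_add e0 e1)) e2)) e3).trans (le_of_eq ?_))
  ring

/-- Asymptotics in the oscillatory range. -/
theorem varJacobi_oscillatory (hα : -1 < α) (β : ℝ) (ha : -1 < a) (hl0 : 0 < l)
    (hl1 : l < 1) (hal : -(2 * l / (1 + l)) < a) (hal' : a < 2 * l / (1 - l)) :
    (fun n : ℕ => varJacobi a α β l n - oscAmp a α β l n * Real.cos (oscPhase a α β l n))
        =O[atTop] fun n : ℕ => oscAmp a α β l n * (n : ℝ)⁻¹ := by
  have h := statRe_sq_lt_one ha hl0 hl1 hal hal'
  obtain ⟨C, hC⟩ := scaledJacobi_oscillatory hα β ha hl0 hl1 hal h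
  have h1a : 0 < a + 1 := by linarith
  have h1l : 0 < 1 - l ^ 2 := by nlinarith
  have hpi := Real.pi_pos
  have hE := one_sub_statRe_sq ha hl0
  have hS2 := Real.sq_sqrt (show 0 ≤ 1 - statRe a l ^ 2 by linarith)
  have hS : 0 < Real.sqrt (1 - statRe a l ^ 2) := Real.sqrt_pos.2 (by linarith)
  have hN : ‖1 - l * zPlus a l‖ ^ (β - 1) = ((1 - l ^ 2) / (a + 1)) ^ ((β - 1) / 2) := by
    rw [← norm_one_sub_mul_zPlus_sq ha hl0 h, ← Real.rpow_natCast, ← Real.rpow_mul (norm_nonneg _)]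
    congr 1
    push_cast
    ring
  rw [hN] at hC
  set S := Real.sqrt (1 - statRe a l ^ 2) with hSdef
  -- By `one_sub_statRe_sq` the radicand is the square of $2l(a+1)S$, so its fourth root is a square
  -- root.
  have hE4 : ((1 - l ^ 2) * ((a + 2) * l + a) * ((a + 2) * l - a)) ^ (1 / 4 : ℝ) =
      Real.sqrt (2 * l * (a + 1) * S) := by
    have hpos : 0 ≤ 2 * l * (a + 1) * S := by positivity
    rw [← hE, ← hS2, ← mul_pow, Real.sqrt_eq_rpow, ← Real.rpow_natCast, ← Real.rpow_mul hpos]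
    norm_num
  have hR : ((1 - l ^ 2) * (a + 1)) ^ (-β / 2) * Real.sqrt ((a + 1) / (1 - l ^ 2)) =
      (1 - l ^ 2) ^ (-β) * ((1 - l ^ 2) / (a + 1)) ^ ((β - 1) / 2) := by
    rw [Real.sqrt_eq_rpow, Real.mul_rpow h1l.le h1a.le, Real.div_rpow h1a.le h1l.le,
      Real.div_rpow h1l.le h1a.le, div_eq_mul_inv ((a + 1) ^ (1 / 2 : ℝ)),
      div_eq_mul_inv ((1 - l ^ 2) ^ ((β - 1) / 2)), ← Real.rpow_neg h1l.le, ← Real.rpow_neg h1a.le,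
      mul_comm ((a + 1) ^ (1 / 2 : ℝ)), mul_mul_mul_comm, ← Real.rpow_add h1l, ← Real.rpow_add h1a,
      ← mul_assoc, ← Real.rpow_add h1l]
    congr 2 <;> ring
  have hX : ∀ n : ℕ, 1 ≤ n → Real.sqrt (2 / (n * Real.pi)) = Real.sqrt ((a + 1) / (1 - l ^ 2)) *
      Real.sqrt (2 * l * (a + 1) * S) / Real.pi *
        Real.sqrt (Real.pi / (l * S * (a + 1) ^ 2 / (1 - l ^ 2) * n)) := by
    intro n hn
    have hn0 : (0 : ℝ) < n := by exact_mod_cast hn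
    rw [← Real.sqrt_mul (by positivity), div_mul_eq_mul_div, ← Real.sqrt_mul (by positivity),
      eq_div_iff hpi.ne']
    nth_rewrite 2 [← Real.sqrt_sq hpi.le]
    rw [← Real.sqrt_mul (by positivity)]
    congr 1
    field_simp
  set κ := l * S * (a + 1) ^ 2 / (1 - l ^ 2) with hκ
  have hκ0 : 0 < κ := by positivity
  have hlead : ∀ n : ℕ, 1 ≤ n → oscAmp a α β l n = l ^ (-(a * n + α)) * (1 - l ^ 2) ^ (-β) *
      (((1 - l ^ 2) / (a + 1)) ^ ((β - 1) / 2) / Real.pi * Real.sqrt (Real.pi / (κ * n))) := by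
    intro n hn
    have hq : 0 < Real.sqrt (2 * l * (a + 1) * S) := Real.sqrt_pos.2 (by positivity)
    rw [oscAmp, hE4, hX n hn, show -α - a * (n : ℝ) = -(a * n + α) by ring]
    generalize ((1 - l ^ 2) * (a + 1)) ^ (-β / 2) = P at hR
    calc _ = P * Real.sqrt ((a + 1) / (1 - l ^ 2)) *
          (l ^ (-(a * n + α)) * Real.sqrt (Real.pi / (κ * n)) / Real.pi) := by field_simp
      _ = _ := by
        rw [hR]
        ring
  refine varJacobi_sub_isBigO (c := ((1 - l ^ 2) / (a + 1)) ^ ((β - 1) / 2) / Real.pi *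
    Real.sqrt (Real.pi / κ)) hl0 hl1 (by positivity) hC (fun n hn => ?_) (fun n hn => ?_)
  · rw [hlead n hn]
    ring
  · have hn0 : (0 : ℝ) < n := by exact_mod_cast hn
    rw [hlead n hn, ← div_div, Real.sqrt_div (by positivity), show (-(3 / 2) : ℝ) = -1 - 1 / 2 by norm_num,
      Real.rpow_sub hn0, Real.rpow_neg_one, ← Real.sqrt_eq_rpow]
    ring

end

theorem theorem1p2 (α β a l : ℝ) (hα : -1 < α) (hβ : -1 < β) (ha : -1 < a)
    (hl0 : 0 < l) (hl1 : l < 1) :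
    -- (1) the oscillatory range
    (-(2 * l / (1 + l)) < a → a < 2 * l / (1 - l) →
      (fun n : ℕ => varJacobi a α β l n - oscAmp a α β l n * Real.cos (oscPhase a α β l n))
        =O[atTop] fun n : ℕ => oscAmp a α β l n * (n : ℝ)⁻¹) ∧
    -- (2) the two transition points
    (a = 2 * l / (1 - l) →
      (fun n : ℕ => varJacobi a α β l n - upperLead a α β l n)
        =O[atTop] fun n : ℕ => upperLead a α β l n * (n : ℝ) ^ (-(1 / 3) : ℝ)) ∧
    (a = -(2 * l / (1 + l)) →
      (fun n : ℕ => varJacobi a α β l n - lowerAmp a α β l n * lowerOsc a α n)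
        =O[atTop] fun n : ℕ => lowerAmp a α β l n * (n : ℝ) ^ (-(1 / 3) : ℝ)) ∧
    -- (3) exponential decay along the `n` for which `a n + α` is an integer
    (a < -(2 * l / (1 + l)) ∨ 2 * l / (1 - l) < a →
      ∃ C ρ : ℝ, 0 < C ∧ 0 < ρ ∧ ρ < 1 ∧
        ∀ n : ℕ, (∃ m : ℤ, a * n + α = m) → |scaledJacobi a α β l n| ≤ C * ρ ^ n) ∧
    -- (4) exponential growth below the lower transition point when `a n + α` is not an integer
    (a < -(2 * l / (1 + l)) →
      (∃ c C κ ρ : ℝ, 0 < c ∧ 0 < C ∧ 1 < κ ∧ 0 < ρ ∧ ρ < 1 ∧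
        ∀ n : ℕ, c * κ ^ n * |Real.sin (Real.pi * (a * n + α))| - C * ρ ^ n
          ≤ |scaledJacobi a α β l n|) ∧
      (∃ σ κ : ℝ, 0 < σ ∧ σ < 1 ∧ 1 < κ ∧
        ∀ᶠ n : ℕ in atTop, (∀ m : ℤ, σ ^ n ≤ |a * n + α - m|) →
          κ ^ n ≤ |scaledJacobi a α β l n|)) ∧
    -- (4) exponential decay above the upper transition point when `a n + α` is not an integer
    (2 * l / (1 - l) < a →
      ∃ C ρ : ℝ, 0 < C ∧ 0 < ρ ∧ ρ < 1 ∧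
        ∀ n : ℕ, (¬ ∃ m : ℤ, a * n + α = m) → |scaledJacobi a α β l n| ≤ C * ρ ^ n) := by
  refine ⟨varJacobi_oscillatory hα β ha hl0 hl1, varJacobi_upper_transition hα β ha hl0 hl1,
    varJacobi_lower_transition hα β ha hl0 hl1, fun h => ?_, fun h =>
      (scaledJacobi_growth hα β ha hl0 hl1 h).2, fun h => ?_⟩
  · rcases h with h | h
    · exact (scaledJacobi_growth hα β ha hl0 hl1 h).1
    -- Above the upper transition value the cut term decays as well, so the bound holds for every
    -- $n$ and serves both the integer and the non-integer case.
    · obtain ⟨C, ρ, hC, hρ, hρ1, hn⟩ := scaledJacobi_exp_decay_of_upper_lt hα β ha hl0 hl1 h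
      exact ⟨C, ρ, hC, hρ, hρ1, fun n _ => hn n⟩
  · obtain ⟨C, ρ, hC, hρ, hρ1, hn⟩ := scaledJacobi_exp_decay_of_upper_lt hα β ha hl0 hl1 h
    exact ⟨C, ρ, hC, hρ, hρ1, fun n _ => hn n⟩
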